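/- Let $X_1,\dots,X_n$ be independent random variables on a probability space $(\Omega,\mathcal F,\mathbb P)$ with values in measurable spaces $(E_1,\mathcal E_1),\dots,(E_n,\mathcal E_n)$, and let $W=f(X_1,\dots,X_n)\in L^1(\mathbb P)$ with $f:\prod_{j=1}^n E_j\to\mathbb R$ measurable. The Hoeffding decomposition of $W$ is the almost surely unique decomposition $W=\sum_{J\subseteq[n]}W_J$ (almost surely), $[n]=\{1,\dots,n\}$, into integrable random variables $W_J$ such that $W_J$ is $\sigma(X_i,\,i\in J)$-measurable for every $J\subseteq[n]$, and $\mathbb E[W_J\mid X_i,\,i\in K]=0$ almost surely for all $J,K\subseteq[n]$ with $J\not\subseteq K$. For $1\le p\le n$, $W$ is called a completely degenerate, not necessarily symmetric $U$-statistic of order $p$ based on $X_1,\dots,X_n$ if $W_K=0$ almost surely for every $K\subseteq[n]$ with $|K|\neq p$. **Theorem 1.** There are constants $\kappa_p\in(0,\infty)$, $p\in\mathbb N$, where $\kappa_p$ depends only on $p$, such that the following holds. Let $1\le p\le n$ be integers, and let $W\in L^4(\mathbb P)$ be a completely degenerate, not necessarily symmetric $U$-statistic of order $p$, based on independent random variables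 $X_1,\dots,X_n$, with $\operatorname{Var}(W)=1$. Then $$\sup_{t\in\mathbb R}\bigl|\mathbb P(W\le t)-\Phi(t)\bigr|\;\le\;11.9\sqrt{\bigl|\mathbb E[W^4]-3\bigr|}+\bigl(3.5+10.8\sqrt{\kappa_p}\bigr)\rho_n,$$ where $\Phi(t)=\frac1{\sqrt{2\pi}}\int_{-\infty}^t e^{-x^2/2}\,dx$ is the standard normal distribution function, and $\rho_n\ge 0$ is given by $$\rho_n^2=\max_{1\le i\le n}\ \sum_{J\subseteq[n]:\,|J|=p,\,i\in J}\sigma_J^2,\qquad \sigma_J^2=\mathbb E[W_J^2].$$ -/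

import Mathlib

open MeasureTheory ProbabilityTheory

noncomputable section

namespace DeJong

variable {Ω : Type*} {mΩ : MeasurableSpace Ω} {n : ℕ} {E : Fin n → Type*}
  [mE : ∀ i, MeasurableSpace (E i)]

/-- The sigma-field `σ(X_i, i ∈ J)` on `Ω` (trivial for `J = ∅`). -/
abbrev sigmaField (X : ∀ i, Ω → E i) (J : Finset (Fin n)) : MeasurableSpace Ω :=
  ⨆ i ∈ J, (mE i).comap (X i)

/-- `V` is a Hoeffding decomposition of the random variable `W` with respect to
`X_1, …, X_n`: `W = ∑_{J ⊆ [n]} V_J` almost surely, where `V_J` is integrable and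
`σ(X_i, i ∈ J)`-measurable, and `𝔼[V_J | X_i, i ∈ K] = 0` almost surely unless `J ⊆ K`.
For independent `X_1, …, X_n` the family `V` is almost surely determined by `W`. -/
structure IsHoeffdingDecomposition (μ : Measure Ω) (X : ∀ i, Ω → E i) (W : Ω → ℝ)
    (V : Finset (Fin n) → Ω → ℝ) : Prop where
  integrable : ∀ J, Integrable (V J) μ
  measurable : ∀ J, Measurable[sigmaField X J] (V J)
  condExp_eq_zero : ∀ J K, ¬ J ⊆ K → μ[V J | sigmaField X K] =ᵐ[μ] 0
  sum_eq : W =ᵐ[μ] fun ω => ∑ J, V J ω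

/-- `W` is a completely degenerate (not necessarily symmetric) U-statistic of order `p` based on
`X_1, …, X_n`, with Hoeffding components `V`: all Hoeffding components of `W` indexed by sets of
cardinality different from `p` vanish almost surely. -/
structure IsDegenerateUStatistic (μ : Measure Ω) (X : ∀ i, Ω → E i) (p : ℕ) (W : Ω → ℝ)
    (V : Finset (Fin n) → Ω → ℝ) : Prop where
  hoeffding : IsHoeffdingDecomposition μ X W V
  degenerate : ∀ J, J.card ≠ p → V J =ᵐ[μ] 0

/-- The maximal influence `ρ_n² = max_i ∑_{|J| = p, i ∈ J} σ_J²`, with `σ_J² = 𝔼[V_J²]`. -/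
def maxInfluence (μ : Measure Ω) (p : ℕ) (V : Finset (Fin n) → Ω → ℝ) : ℝ :=
  ⨆ i : Fin n, ∑ J ∈ (Finset.univ.powersetCard p).filter (fun J : Finset (Fin n) => i ∈ J),
    ∫ ω, V J ω ^ 2 ∂μ

/-- The Lindeberg-Feller type quantity `ρ_n`. -/
def rho (μ : Measure Ω) (p : ℕ) (V : Finset (Fin n) → Ω → ℝ) : ℝ :=
  Real.sqrt (maxInfluence μ p V)

/-- The Kolmogorov distance `sup_t |P(W ≤ t) - Φ(t)|` between the law of `W` and the standard
normal distribution (a supremum of numbers in `[0, 1]` when `μ` is a probability measure). -/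
def kolmogorovDist (μ : Measure Ω) (W : Ω → ℝ) : ℝ :=
  ⨆ t : ℝ, |μ.real {ω | W ω ≤ t} - cdf (gaussianReal 0 1) t|

end DeJong

end

noncomputable section

set_option linter.unusedSectionVars false

open Filter Topology Set

/-! The proof is Stein's method with the exchangeable pair given by resampling one coordinate,
carried out on the product space. Write `W` for the statistic and `D_i` for its change when `x_i` is
replaced by an independent copy, the result being `W_i`. Degeneracy of order `p` makes `W` an
eigenfunction of the resampling generator: `∑ i, E[D_i (G(W_i) - G(W))] = 2p E[W G(W)]` for suitable
functions `G`. Take for `G` the solution `f` of Stein's equation for `(-∞, z]` and expand to first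
order. The main term compares `energy = ∑ i, E[D_i² | x]` with `2p`.

The remainder needs neither third moments nor a concentration inequality. The function `w f(w) -
1_{w ≤ z}` is nondecreasing and bounded, and it controls the Taylor error. The error is therefore at
most `D_i |D_i|` times a difference of this function, and antisymmetry of `D_i |D_i|` under the
exchange leaves `signedEnergy = ∑ i, E[D_i |D_i| | x]` against a bounded function. This yields
`IsKernelFamily.abs_cdf_sub_le`: the distance is at most `(1/2p) E|2p - energy| + (1/p)
E|signedEnergy|`.

Both terms are bounded in `L²` through the Hoeffding components of `W²`. Let `low` and `top` be the
total squared norms of the components with `0 < |M| < 2p` and `|M| = 2p`, so that `E[W⁴] = 1 + low +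
top`. The components of the energy carry weights `2p - |M|`, so its variance is at most `(2p)² low`.
The second moment of `signedEnergy` is at most `2p ∑ i, E[D_i⁴]`, because the increments are
degenerate of order `p - 1`; and `∑ i, E[D_i⁴] ≤ 4p (2 low + 2 - top)`.

It remains to see that `top` is almost at least `2` (`two_sub_le_sum_squareEnergy`). Expanding the
squared top components gives a sum over quadruples of disjoint sets of products of contractions.
Allowing two of the sets to overlap completes it to a sum of squares, of which two explicit families
contribute `1` each, up to pairs of overlapping index sets. All overlaps cost at most `(4^p + 1) p
ρ²`. Then `low` is at most `|E[W⁴] - 3|` plus this cost, which gives the bound. -/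

namespace DeJong

/-! ### The normal law and Mills' ratio. -/

/-- The standard normal distribution function. -/
def stdCdf (w : ℝ) : ℝ := cdf (gaussianReal 0 1) w

/-- The standard normal density. -/
def stdPdf (w : ℝ) : ℝ := gaussianPDFReal 0 1 w

lemma stdPdf_eq (w : ℝ) : stdPdf w = (√(2 * Real.pi))⁻¹ * Real.exp (-(w ^ 2 / 2)) := by
  simp [stdPdf, gaussianPDFReal, neg_div]

lemma stdPdf_pos (w : ℝ) : 0 < stdPdf w := gaussianPDFReal_pos 0 1 w one_ne_zero

lemma stdPdf_neg (w : ℝ) : stdPdf (-w) = stdPdf w := by simp [stdPdf_eq]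

lemma hasDerivAt_stdPdf (w : ℝ) : HasDerivAt stdPdf (-w * stdPdf w) w := by
  have h : HasDerivAt (fun w : ℝ => (√(2 * Real.pi))⁻¹ * Real.exp (-(w ^ 2 / 2)))
      ((√(2 * Real.pi))⁻¹ * (Real.exp (-(w ^ 2 / 2)) * (-((2 : ℕ) * w ^ (2 - 1) / 2)))) w :=
    ((((hasDerivAt_pow 2 w).div_const 2).neg).exp).const_mul _
  rw [show stdPdf = fun w : ℝ => (√(2 * Real.pi))⁻¹ * Real.exp (-(w ^ 2 / 2)) from
    funext stdPdf_eq]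
  refine h.congr_deriv ?_
  push_cast
  ring

lemma continuous_stdPdf : Continuous stdPdf :=
  continuous_iff_continuousAt.2 fun w => (hasDerivAt_stdPdf w).continuousAt

lemma stdCdf_nonneg (w : ℝ) : 0 ≤ stdCdf w := cdf_nonneg _ w

lemma stdCdf_le_one (w : ℝ) : stdCdf w ≤ 1 := cdf_le_one _ w

lemma tendsto_stdCdf_atBot : Tendsto stdCdf atBot (𝓝 0) := tendsto_cdf_atBot _

lemma tendsto_stdCdf_atTop : Tendsto stdCdf atTop (𝓝 1) := tendsto_cdf_atTop _

lemma stdCdf_eq_integral (w : ℝ) : stdCdf w = ∫ x in Iic w, stdPdf x := by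
  rw [stdCdf, cdf_eq_real, Measure.real, gaussianReal_apply_eq_integral _ one_ne_zero,
    ENNReal.toReal_ofReal]
  · rfl
  · exact integral_nonneg fun x => gaussianPDFReal_nonneg _ _ _

lemma hasDerivAt_stdCdf (w : ℝ) : HasDerivAt stdCdf (stdPdf w) w := by
  have hint : Integrable stdPdf := integrable_gaussianPDFReal 0 1
  have h : stdCdf = fun b => (∫ x in (0 : ℝ)..b, stdPdf x) + stdCdf 0 := by
    funext b
    rw [stdCdf_eq_integral, stdCdf_eq_integral,
      intervalIntegral.integral_Iic_sub_Iic hint.integrableOn hint.integrableOn |>.symm]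
    ring
  rw [h]
  refine HasDerivAt.add_const _ ?_
  exact intervalIntegral.integral_hasDerivAt_right (hint.intervalIntegrable)
    (continuous_stdPdf.stronglyMeasurableAtFilter _ _) continuous_stdPdf.continuousAt

lemma stdCdf_neg (w : ℝ) : stdCdf (-w) = 1 - stdCdf w := by
  have hd : ∀ x, HasDerivAt (fun x => stdCdf x + stdCdf (-x)) 0 x := fun x => by
    have h := (hasDerivAt_stdCdf x).add
      ((hasDerivAt_stdCdf (-x)).comp x (hasDerivAt_neg x))
    refine h.congr_deriv ?_
    rw [stdPdf_neg]; ring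
  have hc : ∀ x y, stdCdf x + stdCdf (-x) = stdCdf y + stdCdf (-y) :=
    is_const_of_deriv_eq_zero (fun x => (hd x).differentiableAt) fun x => (hd x).deriv
  have ht : Tendsto (fun x => stdCdf x + stdCdf (-x)) atTop (𝓝 (1 + 0)) :=
    tendsto_stdCdf_atTop.add (tendsto_stdCdf_atBot.comp tendsto_neg_atTop_atBot)
  have : stdCdf w + stdCdf (-w) = 1 + 0 := by
    refine tendsto_nhds_unique ?_ ht
    exact tendsto_const_nhds.congr fun x => hc w x
  linarith

lemma tendsto_stdPdf_atBot : Tendsto stdPdf atBot (𝓝 0) := by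
  have h : Tendsto (fun w : ℝ => (√(2 * Real.pi))⁻¹ * Real.exp (-(w ^ 2 / 2))) atBot
      (𝓝 ((√(2 * Real.pi))⁻¹ * 0)) := by
    refine Tendsto.const_mul _ (Real.tendsto_exp_atBot.comp ?_)
    refine tendsto_neg_atTop_atBot.comp (Tendsto.atTop_div_const (by norm_num) ?_)
    exact ((tendsto_pow_atTop two_ne_zero).comp tendsto_neg_atBot_atTop).congr fun w => by
      simp [Function.comp]
  rw [mul_zero] at h
  exact h.congr fun w => (stdPdf_eq w).symm

/-- Upper bound for Mills' ratio in the lower tail. -/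
lemma neg_mul_stdCdf_le (w : ℝ) : -w * stdCdf w ≤ stdPdf w := by
  rcases le_or_gt 0 w with hw | hw
  · have := mul_nonneg hw (stdCdf_nonneg w)
    linarith [(stdPdf_pos w).le]
  -- `Φ + φ/x` decreases on the negative axis from its limit `0` at `-∞`, hence is nonpositive
  -- there.
  have hd : ∀ x < 0, HasDerivAt (fun x => stdCdf x + stdPdf x * x⁻¹)
      (-(stdPdf x / x ^ 2)) x := fun x hx => by
    refine ((hasDerivAt_stdCdf x).add
      ((hasDerivAt_stdPdf x).mul (hasDerivAt_inv hx.ne))).congr_deriv ?_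
    have := hx.ne
    field_simp
    ring
  have hanti : AntitoneOn (fun x => stdCdf x + stdPdf x * x⁻¹) (Iic w) := by
    refine antitoneOn_of_deriv_nonpos (convex_Iic w) (fun x hx => ?_) (fun x hx => ?_)
      fun x hx => ?_
    · exact (hd x (lt_of_le_of_lt hx hw)).continuousAt.continuousWithinAt
    · rw [interior_Iic] at hx
      exact (hd x (lt_trans hx hw)).differentiableAt.differentiableWithinAt
    · rw [interior_Iic] at hx
      rw [(hd x (lt_trans hx hw)).deriv]
      have := stdPdf_pos x
      have : 0 ≤ stdPdf x / x ^ 2 := by positivity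
      linarith
  have ht : Tendsto (fun x => stdCdf x + stdPdf x * x⁻¹) atBot (𝓝 (0 + 0 * 0)) :=
    tendsto_stdCdf_atBot.add (tendsto_stdPdf_atBot.mul tendsto_inv_atBot_zero)
  have h0 : stdCdf w + stdPdf w * w⁻¹ ≤ 0 + 0 * 0 := by
    refine ge_of_tendsto ht ?_
    filter_upwards [eventually_le_atBot w] with x hx
    exact hanti hx (mem_Iic.2 le_rfl) hx
  have h1 : -w * (stdCdf w + stdPdf w * w⁻¹) ≤ 0 :=
    mul_nonpos_of_nonneg_of_nonpos (by linarith) (by linarith)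
  have h2 : -w * (stdCdf w + stdPdf w * w⁻¹) = -w * stdCdf w - stdPdf w := by
    field_simp [hw.ne]
    ring
  linarith

/-- Lower bound for Mills' ratio. -/
lemma one_add_sq_mul_stdCdf_nonneg (w : ℝ) : 0 ≤ (1 + w ^ 2) * stdCdf w + w * stdPdf w := by
  have hp : ∀ x : ℝ, 0 < 1 + x ^ 2 := fun x => by positivity
  -- `Φ + φ x/(1 + x²)` increases from its limit `0` at `-∞`, hence is nonnegative.
  have hd : ∀ x, HasDerivAt (fun x => stdCdf x + stdPdf x * (x / (1 + x ^ 2)))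
      (2 * stdPdf x / (1 + x ^ 2) ^ 2) x := fun x => by
    have hq : HasDerivAt (fun x : ℝ => x / (1 + x ^ 2))
        ((1 * (1 + x ^ 2) - x * ((2 : ℕ) * x ^ (2 - 1))) / (1 + x ^ 2) ^ 2) x :=
      (hasDerivAt_id x).div ((hasDerivAt_pow 2 x).const_add 1) (hp x).ne'
    refine ((hasDerivAt_stdCdf x).add ((hasDerivAt_stdPdf x).mul hq)).congr_deriv ?_
    have := (hp x).ne'
    field_simp
    push_cast
    ring
  have hmono : Monotone (fun x => stdCdf x + stdPdf x * (x / (1 + x ^ 2))) := by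
    refine monotone_of_deriv_nonneg (fun x => (hd x).differentiableAt) fun x => ?_
    rw [(hd x).deriv]
    have := stdPdf_pos x
    positivity
  have hb : ∀ x : ℝ, |x / (1 + x ^ 2)| ≤ 1 := fun x => by
    rw [abs_div, abs_of_pos (hp x), div_le_one (hp x), abs_le]
    constructor <;> nlinarith [sq_nonneg (x + 1), sq_nonneg (x - 1)]
  have ht' : Tendsto (fun x => stdPdf x * (x / (1 + x ^ 2))) atBot (𝓝 0) := by
    refine squeeze_zero_norm (fun x => ?_) tendsto_stdPdf_atBot
    rw [norm_mul, Real.norm_eq_abs, Real.norm_eq_abs, abs_of_pos (stdPdf_pos x)]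
    exact mul_le_of_le_one_right (stdPdf_pos x).le (hb x)
  have ht : Tendsto (fun x => stdCdf x + stdPdf x * (x / (1 + x ^ 2))) atBot (𝓝 (0 + 0)) :=
    tendsto_stdCdf_atBot.add ht'
  have h0 : 0 + 0 ≤ stdCdf w + stdPdf w * (w / (1 + w ^ 2)) := hmono.le_of_tendsto ht w
  have h1 := mul_nonneg (hp w).le (by linarith : 0 ≤ stdCdf w + stdPdf w * (w / (1 + w ^ 2)))
  have := (hp w).ne'
  have h2 : (1 + w ^ 2) * (stdCdf w + stdPdf w * (w / (1 + w ^ 2)))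
      = (1 + w ^ 2) * stdCdf w + w * stdPdf w := by
    field_simp
  linarith

/-- Mills' ratio of the lower tail. -/
def mills (w : ℝ) : ℝ := stdCdf w / stdPdf w

lemma mills_nonneg (w : ℝ) : 0 ≤ mills w := div_nonneg (stdCdf_nonneg w) (stdPdf_pos w).le

lemma hasDerivAt_mills (w : ℝ) : HasDerivAt mills (1 + w * mills w) w := by
  refine ((hasDerivAt_stdCdf w).div (hasDerivAt_stdPdf w) (stdPdf_pos w).ne').congr_deriv ?_
  have := (stdPdf_pos w).ne'
  rw [mills]
  field_simp
  ring

lemma continuous_mills : Continuous mills :=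
  continuous_iff_continuousAt.2 fun w => (hasDerivAt_mills w).continuousAt

lemma neg_one_le_mul_mills (w : ℝ) : -1 ≤ w * mills w := by
  have h := neg_mul_stdCdf_le w
  have hp := stdPdf_pos w
  rw [mills, mul_div_assoc', le_div_iff₀ hp]
  linarith

lemma monotone_mills : Monotone mills :=
  monotone_of_deriv_nonneg (fun x => (hasDerivAt_mills x).differentiableAt) fun x => by
    rw [(hasDerivAt_mills x).deriv]
    linarith [neg_one_le_mul_mills x]

/-- The derivative is `((1 + x²) Φ + x φ)/φ`, nonnegative by the lower Mills bound. This is the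
source of the monotonicity of `w * steinSol z w`. -/
lemma monotone_mul_mills : Monotone fun w => w * mills w := by
  have hd : ∀ x, HasDerivAt (fun w => w * mills w) (1 * mills x + x * (1 + x * mills x)) x :=
    fun x => (hasDerivAt_id x).mul (hasDerivAt_mills x)
  refine monotone_of_deriv_nonneg (fun x => (hd x).differentiableAt) fun x => ?_
  rw [(hd x).deriv]
  have h := one_add_sq_mul_stdCdf_nonneg x
  have hp := stdPdf_pos x
  have : 1 * mills x + x * (1 + x * mills x)
      = ((1 + x ^ 2) * stdCdf x + x * stdPdf x) / stdPdf x := by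
    rw [mills]
    field_simp
    ring
  rw [this]
  positivity

/-! ### Stein's equation for half-lines. -/

/-- The bounded solution of Stein's equation for the indicator of `(-∞, z]`. -/
def steinSol (z w : ℝ) : ℝ :=
  if w ≤ z then stdCdf (-z) * mills w else stdCdf z * mills (-w)

/-- The indicator of `(-∞, z]`. -/
def halfLine (z w : ℝ) : ℝ := if w ≤ z then 1 else 0

/-- The derivative of the solution of Stein's equation, given by the equation itself. -/
def steinDeriv (z w : ℝ) : ℝ := w * steinSol z w + halfLine z w - stdCdf z

/-- The nondecreasing function that controls the oscillation of `steinDeriv z`. -/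
def steinOsc (z w : ℝ) : ℝ := w * steinSol z w - halfLine z w

lemma steinSol_of_le {z w : ℝ} (h : w ≤ z) : steinSol z w = stdCdf (-z) * mills w := if_pos h

lemma steinSol_of_ge {z w : ℝ} (h : z ≤ w) : steinSol z w = stdCdf z * mills (-w) := by
  rcases h.eq_or_lt with rfl | h
  · rw [steinSol_of_le le_rfl, mills, mills, stdPdf_neg]
    ring
  · exact if_neg (not_le.2 h)

lemma steinSol_nonneg (z w : ℝ) : 0 ≤ steinSol z w := by
  unfold steinSol
  split_ifs <;> exact mul_nonneg (stdCdf_nonneg _) (mills_nonneg _)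

/-- A crude bound, uniform in `w`, which serves only for integrability. -/
lemma steinSol_le (z w : ℝ) : steinSol z w ≤ mills z + mills (-z) := by
  rcases le_total w z with h | h
  · rw [steinSol_of_le h]
    have h1 := monotone_mills h
    nlinarith [mul_le_mul (stdCdf_le_one (-z)) h1 (mills_nonneg w) zero_le_one,
      mills_nonneg (-z)]
  · rw [steinSol_of_ge h]
    have h1 := monotone_mills (neg_le_neg h)
    nlinarith [mul_le_mul (stdCdf_le_one z) h1 (mills_nonneg (-w)) zero_le_one,
      mills_nonneg z]

lemma continuous_steinSol (z : ℝ) : Continuous (steinSol z) := by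
  refine Continuous.if_le (continuous_const.mul continuous_mills)
    (continuous_const.mul (continuous_mills.comp continuous_neg)) continuous_id continuous_const ?_
  intro x hx
  rw [← steinSol_of_le hx.le, ← steinSol_of_ge hx.ge]

lemma measurable_halfLine (z : ℝ) : Measurable (halfLine z) :=
  Measurable.ite measurableSet_Iic measurable_const measurable_const

lemma measurable_steinDeriv (z : ℝ) : Measurable (steinDeriv z) :=
  ((measurable_id.mul (continuous_steinSol z).measurable).add (measurable_halfLine z)).sub
    measurable_const

lemma measurable_steinOsc (z : ℝ) : Measurable (steinOsc z) :=
  (measurable_id.mul (continuous_steinSol z).measurable).sub (measurable_halfLine z)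

lemma monotone_mul_steinSol (z : ℝ) : Monotone fun w => w * steinSol z w := by
  have hle : ∀ {a b : ℝ}, a ≤ b → b ≤ z → a * steinSol z a ≤ b * steinSol z b := by
    intro a b hab hb
    rw [steinSol_of_le hb, steinSol_of_le (hab.trans hb)]
    have := mul_le_mul_of_nonneg_left (monotone_mul_mills hab) (stdCdf_nonneg (-z))
    simp only at this
    linarith
  have hge : ∀ {a b : ℝ}, a ≤ b → z ≤ a → a * steinSol z a ≤ b * steinSol z b := by
    intro a b hab ha
    rw [steinSol_of_ge ha, steinSol_of_ge (ha.trans hab)]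
    have := mul_le_mul_of_nonneg_left (monotone_mul_mills (neg_le_neg hab)) (stdCdf_nonneg z)
    simp only at this
    linarith
  intro a b hab
  rcases le_total b z with hb | hb
  · exact hle hab hb
  rcases le_total z a with ha | ha
  · exact hge hab ha
  · exact (hle ha le_rfl).trans (hge hb le_rfl)

/-- To the right of `z` this is the Mills bound at `-w`; monotonicity carries it to the left. -/
lemma mul_steinSol_le (z w : ℝ) : w * steinSol z w ≤ stdCdf z := by
  have key : ∀ w, z ≤ w → w * steinSol z w ≤ stdCdf z := fun w h => by
    rw [steinSol_of_ge h]
    nlinarith [neg_one_le_mul_mills (-w), stdCdf_nonneg z]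
  rcases le_total z w with h | h
  · exact key w h
  · exact (monotone_mul_steinSol z h).trans (key z le_rfl)

lemma le_mul_steinSol (z w : ℝ) : stdCdf z - 1 ≤ w * steinSol z w := by
  have hz := stdCdf_neg z
  have key : ∀ w, w ≤ z → stdCdf z - 1 ≤ w * steinSol z w := fun w h => by
    rw [steinSol_of_le h]
    nlinarith [neg_one_le_mul_mills w, stdCdf_nonneg (-z)]
  rcases le_total w z with h | h
  · exact key w h
  · exact (key z le_rfl).trans (monotone_mul_steinSol z h)

lemma abs_steinDeriv_le (z w : ℝ) : |steinDeriv z w| ≤ 1 := by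
  have h1 := le_mul_steinSol z w
  have h2 := mul_steinSol_le z w
  have h3 := stdCdf_nonneg z
  have h4 := stdCdf_le_one z
  rw [steinDeriv, halfLine, abs_le]
  split_ifs with h
  · have := monotone_mul_steinSol z h
    constructor <;> linarith
  · have := monotone_mul_steinSol z (not_le.1 h).le
    constructor <;> linarith

/-- The values lie in `[Φ(z) - 2, Φ(z)]`, whose midpoint is `Φ(z) - 1`. Centring there gives the
constant `1`, and the centring constant cancels in differences. -/
lemma abs_steinOsc_sub_le (z w : ℝ) : |steinOsc z w - (stdCdf z - 1)| ≤ 1 := by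
  have h1 := le_mul_steinSol z w
  have h2 := mul_steinSol_le z w
  rw [steinOsc, halfLine, abs_le]
  split_ifs <;> constructor <;> linarith

lemma antitone_halfLine (z : ℝ) : Antitone (halfLine z) := by
  intro a b hab
  unfold halfLine
  split_ifs <;> linarith

lemma monotone_steinOsc (z : ℝ) : Monotone (steinOsc z) := fun _ _ h => by
  have h1 := monotone_mul_steinSol z h
  have h2 := antitone_halfLine z h
  simp only at h1
  unfold steinOsc
  linarith

/-- The right derivative of the solution of Stein's equation. -/
lemma hasDerivWithinAt_steinSol (z w : ℝ) :
    HasDerivWithinAt (steinSol z)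
      (w * steinSol z w + (if w < z then 1 else 0) - stdCdf z) (Ici w) w := by
  split_ifs with h
  · have h1 : HasDerivAt (fun w => stdCdf (-z) * mills w) (stdCdf (-z) * (1 + w * mills w)) w :=
      (hasDerivAt_mills w).const_mul _
    have h2 : steinSol z =ᶠ[𝓝 w] fun w => stdCdf (-z) * mills w := by
      filter_upwards [Iio_mem_nhds h] with x hx using steinSol_of_le (le_of_lt hx)
    refine ((h1.congr_of_eventuallyEq h2).congr_deriv ?_).hasDerivWithinAt
    rw [steinSol_of_le h.le, stdCdf_neg]
    ring
  · push Not at h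
    have h1 : HasDerivAt (fun w => stdCdf z * mills (-w))
        (stdCdf z * ((1 + -w * mills (-w)) * -1)) w :=
      ((hasDerivAt_mills (-w)).comp w (hasDerivAt_neg w)).const_mul _
    refine (h1.hasDerivWithinAt.congr (fun x hx => steinSol_of_ge (h.trans hx))
      (steinSol_of_ge h)).congr_deriv ?_
    rw [steinSol_of_ge h]
    ring

/-- First-order Taylor expansion of the solution of Stein's equation. -/
lemma abs_steinSol_taylor_le (z a b : ℝ) :
    |steinSol z b - steinSol z a - (b - a) * steinDeriv z a|
      ≤ |b - a| * |steinOsc z b - steinOsc z a| := by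
  have hh := monotone_mul_steinSol z
  have hi := antitone_halfLine z
  have key : ∀ l r c : ℝ, l ≤ c → c ≤ r → l ≤ r →
      |(steinSol z r - r * steinDeriv z c) - (steinSol z l - l * steinDeriv z c)|
        ≤ (steinOsc z r - steinOsc z l) * (r - l) := by
    intro l r c hlc hcr hlr
    -- The solution has a kink at `z`, so the mean value inequality is used with right derivatives.
    -- The difference of two derivatives splits into a difference of the nondecreasing `w f(w)` and
    -- one of the nonincreasing indicator. Each is at most its variation over `[l, r]`, and the two
    -- variations add up to the increment of `steinOsc`.
    refine norm_image_sub_le_of_norm_deriv_right_le_segment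
      (f := fun x => steinSol z x - x * steinDeriv z c)
      (f' := fun w => w * steinSol z w + (if w < z then 1 else 0) - stdCdf z
        - 1 * steinDeriv z c)
      (a := l) (b := r) ?_ ?_ ?_ r ⟨hlr, le_rfl⟩
    · exact ((continuous_steinSol z).sub (continuous_id.mul continuous_const)).continuousOn
    · intro x _
      exact (hasDerivWithinAt_steinSol z x).sub ((hasDerivWithinAt_id x _).mul_const _)
    · intro x hx
      have e1 := hh hx.1
      have e2 := hh hx.2.le
      have e3 := hh hlc
      have e4 := hh hcr
      have i3 := hi hlc
      have i4 := hi hcr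
      have j1 : (if x < z then (1 : ℝ) else 0) ≤ halfLine z l := by
        unfold halfLine
        split_ifs <;> linarith [hx.1]
      have j2 : halfLine z r ≤ (if x < z then (1 : ℝ) else 0) := by
        unfold halfLine
        split_ifs <;> linarith [hx.2]
      simp only at e1 e2 e3 e4
      rw [Real.norm_eq_abs, abs_le]
      unfold steinDeriv steinOsc
      constructor <;> linarith
  have hk := monotone_steinOsc z
  rcases le_total a b with hab | hab
  · have := key a b a le_rfl hab hab
    rw [abs_of_nonneg (sub_nonneg.2 hab), abs_of_nonneg (sub_nonneg.2 (hk hab)),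
      show steinSol z b - steinSol z a - (b - a) * steinDeriv z a
        = steinSol z b - b * steinDeriv z a - (steinSol z a - a * steinDeriv z a) by ring,
      mul_comm (b - a)]
    exact this
  · have := key b a a hab le_rfl hab
    rw [abs_sub_comm b, abs_sub_comm (steinOsc z b), abs_of_nonneg (sub_nonneg.2 hab),
      abs_of_nonneg (sub_nonneg.2 (hk hab)), ← abs_neg,
      show -(steinSol z b - steinSol z a - (b - a) * steinDeriv z a)
        = steinSol z a - a * steinDeriv z a - (steinSol z b - b * steinDeriv z a) by ring,
      mul_comm (a - b)]
    exact this

/-! ### Exchanging coordinates between two copies, and conditional expectations. -/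

section ProductSpace

variable {ι : Type*} [Fintype ι] [DecidableEq ι] {E : ι → Type*} [∀ i, MeasurableSpace (E i)]

/-- The point with coordinates `z.1 i` for `i ∈ A` and `z.2 i` for `i ∉ A`. -/
def mix (A : Finset ι) (z : (∀ i, E i) × (∀ i, E i)) : ∀ i, E i :=
  fun i => if i ∈ A then z.1 i else z.2 i

lemma mix_apply_mem {A : Finset ι} {i : ι} (h : i ∈ A) (z : (∀ i, E i) × (∀ i, E i)) :
    mix A z i = z.1 i := if_pos h

lemma mix_apply_notMem {A : Finset ι} {i : ι} (h : i ∉ A) (z : (∀ i, E i) × (∀ i, E i)) :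
    mix A z i = z.2 i := if_neg h

lemma measurable_mix (A : Finset ι) : Measurable (mix A : (∀ i, E i) × (∀ i, E i) → ∀ i, E i) := by
  refine measurable_pi_iff.2 fun i => ?_
  unfold mix
  split_ifs <;> fun_prop

/-- Exchange the coordinates outside `A` between the two components. -/
def exch (A : Finset ι) : ((∀ i, E i) × (∀ i, E i)) ≃ᵐ ((∀ i, E i) × (∀ i, E i)) where
  toFun z := (mix A z, mix A z.swap)
  invFun z := (mix A z, mix A z.swap)
  left_inv z := by
    ext i <;> by_cases h : i ∈ A <;> simp [mix, h]
  right_inv z := by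
    ext i <;> by_cases h : i ∈ A <;> simp [mix, h]
  measurable_toFun := (measurable_mix A).prodMk ((measurable_mix A).comp measurable_swap)
  measurable_invFun := (measurable_mix A).prodMk ((measurable_mix A).comp measurable_swap)

lemma exch_apply (A : Finset ι) (z : (∀ i, E i) × (∀ i, E i)) :
    exch A z = (mix A z, mix A z.swap) := rfl

variable (ν : ∀ i, Measure (E i))

/-- The law of two independent copies. -/
abbrev twoCopies : Measure ((∀ i, E i) × (∀ i, E i)) := (Measure.pi ν).prod (Measure.pi ν)

variable [∀ i, IsProbabilityMeasure (ν i)]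

/-- Swapping `x_i` and `y_i` for `i ∉ A` preserves the law, as is seen on products of boxes. This
exchangeability is behind every symmetrisation below. -/
lemma measurePreserving_exch (A : Finset ι) :
    MeasurePreserving (exch A) (twoCopies ν) (twoCopies ν) := by
  refine ⟨(exch A).measurable, ?_⟩
  have hfin : (Measure.pi ν).FiniteSpanningSetsIn
      (Set.pi univ '' Set.pi univ fun i => {s : Set (E i) | MeasurableSet s}) :=
    ⟨fun _ => univ, fun _ => ⟨fun _ => univ, fun _ _ => MeasurableSet.univ, by simp⟩,
      fun _ => measure_lt_top _ _, iUnion_const _⟩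
  refine (Measure.prod_eq_generateFrom generateFrom_pi generateFrom_pi isPiSystem_pi
    isPiSystem_pi hfin hfin ?_).symm
  rintro _ ⟨S, hS, rfl⟩ _ ⟨T, hT, rfl⟩
  have hS' : ∀ i, MeasurableSet (S i) := fun i => hS i (mem_univ i)
  have hT' : ∀ i, MeasurableSet (T i) := fun i => hT i (mem_univ i)
  have hpre : exch A ⁻¹' (Set.pi univ S ×ˢ Set.pi univ T)
      = (Set.pi univ fun i => if i ∈ A then S i else T i) ×ˢ
        (Set.pi univ fun i => if i ∈ A then T i else S i) := by
    ext z
    simp only [mem_preimage, exch_apply, mem_prod, mem_univ_pi, mix, Prod.fst_swap, Prod.snd_swap]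
    constructor
    · rintro ⟨h1, h2⟩
      refine ⟨fun i => ?_, fun i => ?_⟩ <;>
      · have := h1 i
        have := h2 i
        by_cases h : i ∈ A <;> simp_all
    · rintro ⟨h1, h2⟩
      refine ⟨fun i => ?_, fun i => ?_⟩ <;>
      · have := h1 i
        have := h2 i
        by_cases h : i ∈ A <;> simp_all
  rw [Measure.map_apply (exch A).measurable
    ((MeasurableSet.univ_pi hS').prod (MeasurableSet.univ_pi hT')), hpre, Measure.prod_prod,
    Measure.pi_pi, Measure.pi_pi, Measure.pi_pi, Measure.pi_pi, ← Finset.prod_mul_distrib,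
    ← Finset.prod_mul_distrib]
  refine Finset.prod_congr rfl fun i _ => ?_
  split_ifs
  · rfl
  · rw [mul_comm]

lemma integral_exch (A : Finset ι) (f : (∀ i, E i) × (∀ i, E i) → ℝ) :
    ∫ z, f (exch A z) ∂(twoCopies ν) = ∫ z, f z ∂(twoCopies ν) :=
  (measurePreserving_exch ν A).integral_comp' f

lemma integral_fst_twoCopies (f : (∀ i, E i) → ℝ) :
    ∫ z, f z.1 ∂(twoCopies ν) = ∫ x, f x ∂(Measure.pi ν) := by
  rw [integral_fun_fst]
  simp

lemma integral_mix (A : Finset ι) (f : (∀ i, E i) → ℝ) :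
    ∫ z, f (mix A z) ∂(twoCopies ν) = ∫ x, f x ∂(Measure.pi ν) :=
  (integral_exch ν A fun z => f z.1).trans (integral_fst_twoCopies ν f)

lemma measurePreserving_mix (A : Finset ι) :
    MeasurePreserving (mix A) (twoCopies ν) (Measure.pi ν) :=
  measurePreserving_fst.comp (measurePreserving_exch ν A)

lemma dependsOn_mix {F : (∀ i, E i) → ℝ} {J : Finset ι} (hF : DependsOn F J) {A : Finset ι}
    (hJ : J ⊆ A) (z : (∀ i, E i) × (∀ i, E i)) : F (mix A z) = F z.1 :=
  hF fun _ hi => mix_apply_mem (hJ hi) z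

lemma dependsOn_mix' {F : (∀ i, E i) → ℝ} {J : Finset ι} (hF : DependsOn F J) {A : Finset ι}
    (hJ : Disjoint J A) (z : (∀ i, E i) × (∀ i, E i)) : F (mix A z) = F z.2 :=
  hF fun _ hi => mix_apply_notMem (Finset.disjoint_left.1 hJ hi) z

/-- Functions of disjoint blocks of coordinates are uncorrelated. -/
lemma integral_mul_of_disjoint {a b : (∀ i, E i) → ℝ} {S T : Finset ι} (ha : DependsOn a S)
    (hb : DependsOn b T) (h : Disjoint S T) :
    ∫ x, a x * b x ∂(Measure.pi ν) = (∫ x, a x ∂(Measure.pi ν)) * ∫ x, b x ∂(Measure.pi ν) := by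
  -- Start from `a` and `b` on separate copies. The exchange outside `S` moves `b` to the first copy
  -- and leaves `a` in place.
  rw [← integral_prod_mul, ← integral_exch ν S, ← integral_fst_twoCopies]
  refine integral_congr_ae (Eventually.of_forall fun z => ?_)
  simp only [exch_apply]
  rw [dependsOn_mix ha subset_rfl, dependsOn_mix' hb h.symm]
  rfl

/-- The conditional expectation of `F` given the coordinates in `A`. -/
def avg (A : Finset ι) (F : (∀ i, E i) → ℝ) (x : ∀ i, E i) : ℝ :=
  ∫ y, F (mix A (x, y)) ∂(Measure.pi ν)

lemma avg_of_dependsOn {A : Finset ι} {F : (∀ i, E i) → ℝ} (hF : DependsOn F A) :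
    avg ν A F = F := by
  funext x
  simp [avg, dependsOn_mix hF subset_rfl]

lemma avg_univ (F : (∀ i, E i) → ℝ) : avg ν Finset.univ F = F :=
  avg_of_dependsOn ν fun _ _ h => congrArg F (funext fun i => h i (by simp))

lemma dependsOn_avg (A : Finset ι) (F : (∀ i, E i) → ℝ) : DependsOn (avg ν A F) A := by
  intro x y h
  unfold avg
  congr 1
  funext w
  congr 1
  funext i
  by_cases hi : i ∈ A
  · simp [mix, hi, h i (by simpa using hi)]
  · simp [mix, hi]

lemma avg_eq_of_inter_eq {A B J : Finset ι} {F : (∀ i, E i) → ℝ} (hF : DependsOn F J)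
    (h : A ∩ J = B ∩ J) : avg ν A F = avg ν B F := by
  funext x
  unfold avg
  congr 1
  funext w
  refine hF fun i hi => ?_
  have hi' : i ∈ J := by simpa using hi
  have : i ∈ A ↔ i ∈ B := by
    have := congrArg (i ∈ ·) h
    simpa [hi'] using this
  by_cases hA : i ∈ A
  · simp [mix, hA, this.1 hA]
  · simp [mix, hA, mt this.2 hA]

lemma avg_mul_of_dependsOn {A : Finset ι} {G : (∀ i, E i) → ℝ} (hG : DependsOn G A)
    (F : (∀ i, E i) → ℝ) (x : ∀ i, E i) :
    avg ν A (fun x => G x * F x) x = G x * avg ν A F x := by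
  simp only [avg, dependsOn_mix hG subset_rfl]
  exact integral_const_mul _ _

lemma measurable_avg (A : Finset ι) {F : (∀ i, E i) → ℝ} (hF : Measurable F) :
    Measurable (avg ν A F) := by
  have : StronglyMeasurable fun z : (∀ i, E i) × (∀ i, E i) => F (mix A z) :=
    (hF.comp (measurable_mix A)).stronglyMeasurable
  exact this.integral_prod_right.measurable

lemma memLp_mix (A : Finset ι) {F : (∀ i, E i) → ℝ} {q : ENNReal} (hF : MemLp F q (Measure.pi ν)) :
    MemLp (fun z => F (mix A z)) q (twoCopies ν) :=
  hF.comp_measurePreserving (measurePreserving_mix ν A)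

lemma integrable_mix (A : Finset ι) {F : (∀ i, E i) → ℝ} (hF : Integrable F (Measure.pi ν)) :
    Integrable (fun z => F (mix A z)) (twoCopies ν) :=
  (measurePreserving_mix ν A).integrable_comp_of_integrable hF

lemma ae_integrable_mix (A : Finset ι) {F : (∀ i, E i) → ℝ} (hF : Integrable F (Measure.pi ν)) :
    ∀ᵐ x ∂(Measure.pi ν), Integrable (fun y => F (mix A (x, y))) (Measure.pi ν) :=
  (integrable_mix ν A hF).prod_right_ae

lemma integrable_avg (A : Finset ι) {F : (∀ i, E i) → ℝ} (hF : Integrable F (Measure.pi ν)) :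
    Integrable (avg ν A F) (Measure.pi ν) :=
  (integrable_mix ν A hF).integral_prod_left

lemma avg_congr_ae (A : Finset ι) {F G : (∀ i, E i) → ℝ} (h : F =ᵐ[Measure.pi ν] G) :
    avg ν A F =ᵐ[Measure.pi ν] avg ν A G := by
  have h1 : ∀ᵐ z ∂(twoCopies ν), F (mix A z) = G (mix A z) :=
    (measurePreserving_mix ν A).quasiMeasurePreserving.ae h
  filter_upwards [Measure.ae_ae_of_ae_prod h1] with x hx
  exact integral_congr_ae hx

lemma avg_finset_sum {κ : Type*} (A : Finset ι) (s : Finset κ) {F : κ → (∀ i, E i) → ℝ}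
    (hF : ∀ k ∈ s, Integrable (F k) (Measure.pi ν)) :
    avg ν A (fun x => ∑ k ∈ s, F k x) =ᵐ[Measure.pi ν] fun x => ∑ k ∈ s, avg ν A (F k) x := by
  have h : ∀ᵐ x ∂(Measure.pi ν), ∀ k ∈ s,
      Integrable (fun y => F k (mix A (x, y))) (Measure.pi ν) :=
    (ae_ball_iff s.countable_toSet).2 fun k hk => ae_integrable_mix ν A (hF k hk)
  filter_upwards [h] with x hx
  exact integral_finsetSum s hx

/-- By independence of the coordinates, resampling outside `B` and then outside `A` amounts to
resampling outside `A ∩ B`, because `mix B (y, w)` again has the product law. -/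
lemma avg_avg (A B : Finset ι) {F : (∀ i, E i) → ℝ} (hF : Integrable F (Measure.pi ν)) :
    avg ν A (avg ν B F) =ᵐ[Measure.pi ν] avg ν (A ∩ B) F := by
  filter_upwards [ae_integrable_mix ν (A ∩ B) hF] with x hx
  have hmix : ∀ y w : ∀ i, E i, mix B (mix A (x, y), w) = mix (A ∩ B) (x, mix B (y, w)) := by
    intro y w
    funext i
    by_cases hA : i ∈ A <;> by_cases hB : i ∈ B <;> simp [mix, hA, hB]
  have h2 := integrable_mix ν B hx
  have h3 := integral_mix ν B fun w => F (mix (A ∩ B) (x, w))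
  rw [integral_prod _ h2] at h3
  simp only [← hmix] at h3
  exact h3

lemma sq_integral_le {α : Type*} {mα : MeasurableSpace α} {μ : Measure α} [IsProbabilityMeasure μ]
    {f : α → ℝ} (hf : MemLp f 2 μ) : (∫ x, f x ∂μ) ^ 2 ≤ ∫ x, f x ^ 2 ∂μ := by
  have h1 := variance_nonneg f μ
  rw [variance_eq_sub hf] at h1
  simpa using h1

lemma sq_avg_le (A : Finset ι) {F : (∀ i, E i) → ℝ} (hF : MemLp F 2 (Measure.pi ν))
    (hm : Measurable F) :
    ∀ᵐ x ∂(Measure.pi ν), avg ν A F x ^ 2 ≤ avg ν A (fun x => F x ^ 2) x := by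
  filter_upwards [ae_integrable_mix ν A hF.integrable_sq] with x hx
  refine sq_integral_le ?_
  refine (memLp_two_iff_integrable_sq ?_).2 hx
  exact (hm.comp ((measurable_mix A).comp measurable_prodMk_left)).aestronglyMeasurable

lemma memLp_avg (A : Finset ι) {F : (∀ i, E i) → ℝ} (hF : MemLp F 2 (Measure.pi ν))
    (hm : Measurable F) : MemLp (avg ν A F) 2 (Measure.pi ν) := by
  refine (memLp_two_iff_integrable_sq (measurable_avg ν A hm).aestronglyMeasurable).2 ?_
  refine (integrable_avg ν A hF.integrable_sq).mono'
    ((measurable_avg ν A hm).pow_const 2).aestronglyMeasurable ?_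
  filter_upwards [sq_avg_le ν A hF hm] with x hx
  rw [Real.norm_of_nonneg (sq_nonneg _)]
  exact hx

lemma integral_avg_mul (A : Finset ι) {F G : (∀ i, E i) → ℝ} (hF : MemLp F 2 (Measure.pi ν))
    (hG : MemLp G 2 (Measure.pi ν)) :
    ∫ x, avg ν A F x * G x ∂(Measure.pi ν) = ∫ z, F (mix A z) * G z.1 ∂(twoCopies ν) := by
  have hG' : MemLp (fun z => G z.1) 2 (twoCopies ν) :=
    hG.comp_measurePreserving measurePreserving_fst
  rw [integral_prod (fun z => F (mix A z) * G z.1) ((memLp_mix ν A hF).integrable_mul hG')]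
  refine integral_congr_ae (Eventually.of_forall fun x => ?_)
  exact (integral_mul_const _ _).symm

/-- Self-adjointness: both sides are the correlation of `F` and `G` at two points sharing the
coordinates in `A`, and `exch A` interchanges those points. -/
lemma integral_mul_avg (A : Finset ι) {F G : (∀ i, E i) → ℝ} (hF : MemLp F 2 (Measure.pi ν))
    (hG : MemLp G 2 (Measure.pi ν)) :
    ∫ x, F x * avg ν A G x ∂(Measure.pi ν) = ∫ x, avg ν A F x * G x ∂(Measure.pi ν) := by
  have h := integral_avg_mul ν A hG hF
  rw [integral_avg_mul ν A hF hG]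
  simp only [mul_comm (F _)]
  rw [h, ← integral_exch ν A]
  refine integral_congr_ae (Eventually.of_forall fun z => ?_)
  have h1 : mix A (exch A z) = z.1 := congrArg Prod.fst ((exch A).left_inv z)
  simp only [h1]
  rfl

lemma integral_avg_mul_avg (A B : Finset ι) {F G : (∀ i, E i) → ℝ}
    (hF : MemLp F 2 (Measure.pi ν)) (hG : MemLp G 2 (Measure.pi ν)) (hmG : Measurable G) :
    ∫ x, avg ν A F x * avg ν B G x ∂(Measure.pi ν)
      = ∫ x, F x * avg ν (A ∩ B) G x ∂(Measure.pi ν) := by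
  rw [← integral_mul_avg ν A hF (memLp_avg ν B hG hmG)]
  refine integral_congr_ae ?_
  filter_upwards [avg_avg ν A B (hG.integrable one_le_two)] with x hx
  rw [hx]

end ProductSpace

/-! ### Möbius inversion and the Hoeffding decomposition. -/

section Moebius

variable {ι : Type*} [DecidableEq ι]

/-- Möbius inversion over the subsets of a finite set. -/
def mob (φ : Finset ι → ℝ) (M : Finset ι) : ℝ :=
  ∑ A ∈ M.powerset, (-1) ^ (M.card + A.card) * φ A

lemma mob_insert (φ : Finset ι → ℝ) {M : Finset ι} {i : ι} (hi : i ∉ M) :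
    mob φ (insert i M) = mob (fun A => φ (insert i A)) M - mob φ M := by
  unfold mob
  rw [Finset.sum_powerset_insert hi, add_comm, sub_eq_add_neg, ← Finset.sum_neg_distrib]
  congr 1
  · refine Finset.sum_congr rfl fun A hA => ?_
    have hiA : i ∉ A := fun h => hi (Finset.mem_powerset.1 hA h)
    rw [Finset.card_insert_of_notMem hi, Finset.card_insert_of_notMem hiA]
    ring
  · refine Finset.sum_congr rfl fun A _ => ?_
    rw [Finset.card_insert_of_notMem hi]
    ring

lemma sum_mob (B : Finset ι) (φ : Finset ι → ℝ) : ∑ M ∈ B.powerset, mob φ M = φ B := by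
  induction B using Finset.induction_on generalizing φ with
  | empty => simp [mob]
  | insert i B hi ih =>
    rw [Finset.sum_powerset_insert hi, ← ih fun A => φ (insert i A), ← Finset.sum_add_distrib]
    refine Finset.sum_congr rfl fun M hM => ?_
    rw [mob_insert φ fun h => hi (Finset.mem_powerset.1 hM h)]
    ring

lemma mob_congr {φ ψ : Finset ι → ℝ} {M : Finset ι} (h : ∀ A ⊆ M, φ A = ψ A) :
    mob φ M = mob ψ M :=
  Finset.sum_congr rfl fun A hA => by rw [h A (Finset.mem_powerset.1 hA)]

lemma mob_eq_zero {φ : Finset ι → ℝ} {M : Finset ι} {i : ι} (hi : i ∈ M)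
    (h : ∀ A, φ (insert i A) = φ A) : mob φ M = 0 := by
  rw [← Finset.insert_erase hi, mob_insert φ (Finset.notMem_erase i M), sub_eq_zero]
  exact mob_congr fun A _ => h A

/-- Some index lies in exactly one of `M` and `L`. Inserting it in the corresponding variable does
not change `A ∩ B`, so the alternating sum cancels in pairs. -/
lemma mob_mob_inter {c : Finset ι → ℝ} {M L : Finset ι} (h : M ≠ L) :
    mob (fun A => mob (fun B => c (A ∩ B)) L) M = 0 := by
  by_cases hML : M ⊆ L
  · obtain ⟨i, hiL, hiM⟩ := Finset.exists_of_ssubset (hML.ssubset_of_ne h)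
    have : ∀ A ⊆ M, mob (fun B => c (A ∩ B)) L = 0 := fun A hA => by
      refine mob_eq_zero hiL fun B => ?_
      rw [Finset.inter_insert_of_notMem fun hh => hiM (hA hh)]
    rw [mob_congr this]
    simp [mob]
  · obtain ⟨i, hiM, hiL⟩ := Finset.not_subset.1 hML
    refine mob_eq_zero hiM fun A => mob_congr fun B hB => ?_
    rw [Finset.insert_inter_of_notMem fun hh => hiL (hB hh)]

end Moebius

section Orthogonal

variable {α κ : Type*} {mα : MeasurableSpace α} {μ : Measure α}

/-- Bilinear Parseval identity for a finite orthogonal family. -/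
lemma integral_sum_mul_sum {h : κ → α → ℝ} (s : Finset κ) (hh : ∀ k, MemLp (h k) 2 μ)
    (horth : ∀ k l, k ≠ l → ∫ x, h k x * h l x ∂μ = 0) (c d : κ → ℝ) :
    ∫ x, (∑ k ∈ s, c k * h k x) * (∑ k ∈ s, d k * h k x) ∂μ
      = ∑ k ∈ s, c k * d k * ∫ x, h k x ^ 2 ∂μ := by
  classical
  have hint : ∀ k l, Integrable (fun x => c k * h k x * (d l * h l x)) μ := fun k l =>
    ((hh k).const_mul (c k)).integrable_mul ((hh l).const_mul (d l))
  simp only [Finset.sum_mul_sum]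
  rw [integral_finsetSum _ fun k _ => integrable_finsetSum _ fun l _ => hint k l]
  refine Finset.sum_congr rfl fun k hk => ?_
  rw [integral_finsetSum _ fun l _ => hint k l, Finset.sum_eq_single_of_mem k hk]
  · rw [← integral_const_mul]
    congr 1
    funext x
    ring
  · intro l _ hl
    have := horth k l (Ne.symm hl)
    rw [show (fun x => c k * h k x * (d l * h l x)) = fun x => c k * d l * (h k x * h l x) from
      funext fun x => by ring, integral_const_mul, this, mul_zero]

end Orthogonal

section Hoeffding

variable {ι : Type*} [Fintype ι] [DecidableEq ι] {E : ι → Type*} [∀ i, MeasurableSpace (E i)]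
  (ν : ∀ i, Measure (E i)) [∀ i, IsProbabilityMeasure (ν i)]

/-- The Hoeffding component of `F` with index `M`. -/
def hoeffding (M : Finset ι) (F : (∀ i, E i) → ℝ) (x : ∀ i, E i) : ℝ :=
  mob (fun A => avg ν A F x) M

lemma sum_hoeffding (B : Finset ι) (F : (∀ i, E i) → ℝ) (x : ∀ i, E i) :
    ∑ M ∈ B.powerset, hoeffding ν M F x = avg ν B F x := sum_mob B _

lemma sum_univ_hoeffding (F : (∀ i, E i) → ℝ) (x : ∀ i, E i) :
    ∑ M, hoeffding ν M F x = F x := by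
  rw [← Finset.powerset_univ, sum_hoeffding, avg_univ]

lemma hoeffding_empty (F : (∀ i, E i) → ℝ) (x : ∀ i, E i) :
    hoeffding ν ∅ F x = ∫ y, F y ∂(Measure.pi ν) := by
  have h : ∀ y, mix ∅ (x, y) = y := fun y => by
    funext i
    simp [mix]
  simp [hoeffding, mob, avg, h]

lemma hoeffding_of_dependsOn {J M : Finset ι} {F : (∀ i, E i) → ℝ} (hF : DependsOn F J)
    (h : ¬ M ⊆ J) (x : ∀ i, E i) : hoeffding ν M F x = 0 := by
  obtain ⟨i, hiM, hiJ⟩ := Finset.not_subset.1 h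
  refine mob_eq_zero hiM fun A => ?_
  rw [avg_eq_of_inter_eq ν hF (Finset.insert_inter_of_notMem hiJ)]

lemma memLp_hoeffding (M : Finset ι) {F : (∀ i, E i) → ℝ} (hF : MemLp F 2 (Measure.pi ν))
    (hm : Measurable F) : MemLp (hoeffding ν M F) 2 (Measure.pi ν) :=
  memLp_finsetSum _ fun A _ => (memLp_avg ν A hF hm).const_mul _

lemma hoeffding_finset_sum {κ : Type*} (M : Finset ι) (s : Finset κ) {F : κ → (∀ i, E i) → ℝ}
    (hF : ∀ k ∈ s, Integrable (F k) (Measure.pi ν)) :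
    hoeffding ν M (fun x => ∑ k ∈ s, F k x) =ᵐ[Measure.pi ν]
      fun x => ∑ k ∈ s, hoeffding ν M (F k) x := by
  have h : ∀ᵐ x ∂(Measure.pi ν), ∀ A : Finset ι,
      avg ν A (fun x => ∑ k ∈ s, F k x) x = ∑ k ∈ s, avg ν A (F k) x :=
    ae_all_iff.2 fun A => avg_finset_sum ν A s hF
  filter_upwards [h] with x hx
  simp only [hoeffding, mob, hx, Finset.mul_sum]
  exact Finset.sum_comm

/-- The inner product of `avg ν A F` and `avg ν B F` depends only on `A ∩ B`, so `mob_mob_inter`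
applies to the double Möbius sum. -/
lemma integral_hoeffding_mul {M L : Finset ι} (hML : M ≠ L) {F : (∀ i, E i) → ℝ}
    (hF : MemLp F 2 (Measure.pi ν)) (hm : Measurable F) :
    ∫ x, hoeffding ν M F x * hoeffding ν L F x ∂(Measure.pi ν) = 0 := by
  have hint : ∀ (r s : ℝ) (A B : Finset ι), Integrable
      (fun x => r * avg ν A F x * (s * avg ν B F x)) (Measure.pi ν) := fun r s A B =>
    ((memLp_avg ν A hF hm).const_mul r).integrable_mul ((memLp_avg ν B hF hm).const_mul s)
  rw [← mob_mob_inter (c := fun A => ∫ x, F x * avg ν A F x ∂(Measure.pi ν)) hML]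
  simp only [hoeffding, mob, Finset.sum_mul_sum]
  rw [integral_finsetSum _ fun A _ => integrable_finsetSum _ fun B _ => hint _ _ A B]
  refine Finset.sum_congr rfl fun A _ => ?_
  rw [integral_finsetSum _ fun B _ => hint _ _ A B, Finset.mul_sum]
  refine Finset.sum_congr rfl fun B _ => ?_
  rw [← integral_avg_mul_avg ν A B hF hF hm, ← integral_const_mul, ← integral_const_mul]
  congr 1
  funext x
  ring

lemma integral_sum_hoeffding_mul {F : (∀ i, E i) → ℝ} (hF : MemLp F 2 (Measure.pi ν))
    (hm : Measurable F) (c d : Finset ι → ℝ) :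
    ∫ x, (∑ M, c M * hoeffding ν M F x) * (∑ M, d M * hoeffding ν M F x) ∂(Measure.pi ν)
      = ∑ M, c M * d M * ∫ x, hoeffding ν M F x ^ 2 ∂(Measure.pi ν) :=
  integral_sum_mul_sum _ (fun M => memLp_hoeffding ν M hF hm)
    (fun _ _ h => integral_hoeffding_mul ν h hF hm) c d

/-- The number operator `∑ i, (F - 𝔼[F | x_j, j ≠ i])` acts diagonally on Hoeffding components. -/
lemma sum_sub_avg_compl (F : (∀ i, E i) → ℝ) (x : ∀ i, E i) :
    ∑ i, (F x - avg ν {i}ᶜ F x) = ∑ M : Finset ι, (M.card : ℝ) * hoeffding ν M F x := by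
  -- The `i`-th summand collects the components with `i ∈ M`, so each `M` is counted `|M|` times.
  have h : ∀ i, F x - avg ν {i}ᶜ F x
      = ∑ M : Finset ι, if i ∈ M then hoeffding ν M F x else 0 := fun i => by
    rw [← sum_hoeffding ν {i}ᶜ F x, ← sum_univ_hoeffding ν F x, sub_eq_iff_eq_add]
    rw [← Finset.sum_filter, show (({i}ᶜ : Finset ι).powerset)
      = Finset.univ.filter (fun M => ¬ i ∈ M) by
        ext M; simp [Finset.subset_compl_singleton]]
    exact (Finset.sum_filter_add_sum_filter_not _ _ _).symm
  simp only [h]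
  rw [Finset.sum_comm]
  refine Finset.sum_congr rfl fun M _ => ?_
  rw [← Finset.sum_filter, Finset.sum_const, Finset.filter_univ_mem, nsmul_eq_mul]

end Hoeffding

/-! ### Integrability of products of functions in `L⁴`. -/

section FourthPowers

variable {α : Type*} {mα : MeasurableSpace α} {μ : Measure α}

lemma memLp_two_mul {a b : α → ℝ} (ha : MemLp a 4 μ) (hb : MemLp b 4 μ) :
    MemLp (fun x => a x * b x) 2 μ := by
  have : ENNReal.HolderTriple 4 4 2 := ⟨by
    rw [← ENNReal.toReal_eq_toReal_iff' (by simp) (by simp), ENNReal.toReal_add (by simp) (by simp)]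
    simp only [ENNReal.toReal_inv, ENNReal.toReal_ofNat]
    norm_num⟩
  exact hb.mul' ha

lemma integrable_mul_four {a b c d : α → ℝ} (ha : MemLp a 4 μ) (hb : MemLp b 4 μ)
    (hc : MemLp c 4 μ) (hd : MemLp d 4 μ) : Integrable (fun x => a x * b x * (c x * d x)) μ :=
  (memLp_two_mul ha hb).integrable_mul (memLp_two_mul hc hd)

lemma integrable_pow_four {a : α → ℝ} (ha : MemLp a 4 μ) : Integrable (fun x => a x ^ 4) μ :=
  (integrable_mul_four ha ha ha ha).congr (Eventually.of_forall fun x => by ring)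

lemma integrable_mul_pow_three {a b : α → ℝ} (ha : MemLp a 4 μ) (hb : MemLp b 4 μ) :
    Integrable (fun x => a x * b x ^ 3) μ :=
  (integrable_mul_four ha hb hb hb).congr (Eventually.of_forall fun x => by ring)

lemma memLp_two_sq {a : α → ℝ} (ha : MemLp a 4 μ) : MemLp (fun x => a x ^ 2) 2 μ := by
  simpa only [sq] using memLp_two_mul ha ha

end FourthPowers

/-! ### Degenerate kernels and the resampling Dirichlet form. -/

section Kernels

variable {ι : Type*} [Fintype ι] [DecidableEq ι] {E : ι → Type*} [∀ i, MeasurableSpace (E i)]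
  {ν : ∀ i, Measure (E i)} [∀ i, IsProbabilityMeasure (ν i)] {p : ℕ}
  {g : Finset ι → (∀ i, E i) → ℝ}

/-- The value at `x` of the function `F` after resampling the coordinate `i`. -/
abbrev resample (i : ι) : (∀ i, E i) × (∀ i, E i) → ∀ i, E i := mix {i}ᶜ

lemma exch_resample_fst (i : ι) (z : (∀ i, E i) × (∀ i, E i)) :
    (exch {i}ᶜ z).1 = resample i z := rfl

lemma resample_exch (i : ι) (z : (∀ i, E i) × (∀ i, E i)) :
    resample i (exch {i}ᶜ z) = z.1 := congrArg Prod.fst ((exch {i}ᶜ).left_inv z)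

/-- The Dirichlet form in the `i`-th coordinate. -/
lemma integral_resample_sub_mul_sub (i : ι) {F G : (∀ i, E i) → ℝ}
    (h0 : Integrable (fun x => F x * G x) (Measure.pi ν))
    (h1 : Integrable (fun z => F (resample i z) * G z.1) (twoCopies ν)) :
    ∫ z, (F (resample i z) - F z.1) * (G (resample i z) - G z.1) ∂(twoCopies ν)
      = 2 * (∫ x, F x * G x ∂(Measure.pi ν) - ∫ z, F (resample i z) * G z.1 ∂(twoCopies ν)) := by
  have e1 : ∫ z, F z.1 * G (resample i z) ∂(twoCopies ν)
      = ∫ z, F (resample i z) * G z.1 ∂(twoCopies ν) := by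
    rw [← integral_exch ν {i}ᶜ]
    simp only [resample_exch, exch_resample_fst]
  have h2 : Integrable (fun z => F z.1 * G (resample i z)) (twoCopies ν) := by
    have := (measurePreserving_exch ν {i}ᶜ).integrable_comp_of_integrable h1
    refine this.congr (Eventually.of_forall fun z => ?_)
    simp only [Function.comp, resample_exch, exch_resample_fst]
  have h3 : Integrable (fun z => F (resample i z) * G (resample i z)) (twoCopies ν) :=
    integrable_mix ν {i}ᶜ h0
  have h4 : Integrable (fun z => F z.1 * G z.1) (twoCopies ν) := h0.comp_fst _
  have e3 : ∫ z, F (resample i z) * G (resample i z) ∂(twoCopies ν)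
      = ∫ x, F x * G x ∂(Measure.pi ν) := integral_mix ν {i}ᶜ fun x => F x * G x
  have e4 : ∫ z, F z.1 * G z.1 ∂(twoCopies ν) = ∫ x, F x * G x ∂(Measure.pi ν) :=
    integral_fst_twoCopies ν fun x => F x * G x
  calc _ = ∫ z, ((F (resample i z) * G (resample i z) - F (resample i z) * G z.1)
        - (F z.1 * G (resample i z) - F z.1 * G z.1)) ∂(twoCopies ν) := by
        congr 1
        funext z
        ring
    _ = _ := by
        rw [integral_sub (by exact h3.sub h1) (by exact h2.sub h4), integral_sub h3 h1,
          integral_sub h2 h4, e1, e3, e4]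
        ring

variable (ν p g) in
/-- The (not necessarily symmetric) kernels of a completely degenerate U-statistic of order `p`, as functions
on the product space. -/
structure IsKernelFamily : Prop where
  measurable : ∀ J, Measurable (g J)
  memLp : ∀ J, MemLp (g J) 4 (Measure.pi ν)
  dependsOn : ∀ J : Finset ι, DependsOn (g J) J
  -- Vanishing everywhere, and not only almost everywhere, lets kernels of the wrong size be
  -- discarded pointwise.
  eq_zero : ∀ J : Finset ι, J.card ≠ p → g J = 0
  avg_eq_zero : ∀ J A : Finset ι, ¬ J ⊆ A → avg ν A (g J) =ᵐ[Measure.pi ν] 0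

variable (g) in
/-- The U-statistic with kernels `g`. -/
def ustat (x : ∀ i, E i) : ℝ := ∑ J, g J x

namespace IsKernelFamily

variable (hg : IsKernelFamily ν p g)
include hg

lemma measurable_ustat : Measurable (ustat g) :=
  Finset.measurable_sum _ fun J _ => hg.measurable J

lemma memLp_ustat : MemLp (ustat g) 4 (Measure.pi ν) :=
  memLp_finsetSum _ fun J _ => hg.memLp J

lemma card_mul (J : Finset ι) (x : ∀ i, E i) : (J.card : ℝ) * g J x = p * g J x := by
  by_cases h : J.card = p
  · rw [h]
  · simp [hg.eq_zero J h]

/-- Degeneracy: a kernel with one resampled coordinate is uncorrelated with every function that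
does not depend on the resampled value. -/
lemma integral_resample_mul {J : Finset ι} {j : ι} (hj : j ∈ J)
    {H : (∀ i, E i) × (∀ i, E i) → ℝ}
    (hH : ∀ x, DependsOn (fun y => H (x, y)) (({j}ᶜ : Finset ι) : Set ι))
    (hint : Integrable (fun z => g J (resample j z) * H z) (twoCopies ν)) :
    ∫ z, g J (resample j z) * H z ∂(twoCopies ν) = 0 := by
  rw [integral_prod _ hint]
  refine integral_eq_zero_of_ae ?_
  filter_upwards [hg.avg_eq_zero J {j}ᶜ fun h => by simpa using h hj] with x hx
  have hdep : DependsOn (fun y => g J (resample j (x, y))) (({j} : Finset ι) : Set ι) := by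
    intro y y' h
    refine congrArg (g J) (funext fun i => ?_)
    by_cases hi : i = j
    · subst hi
      simpa [mix] using h
    · simp [mix, hi]
  rw [integral_mul_of_disjoint ν hdep (hH x) disjoint_compl_right]
  have : ∫ y, g J (resample j (x, y)) ∂(Measure.pi ν) = 0 := hx
  rw [this, zero_mul]
  rfl

/-- Exchanging the coordinate `i` undoes its resampling, which reduces the claim to
`integral_resample_mul`. -/
lemma integral_resample_resample_mul {J : Finset ι} {i j : ι} (hij : i ≠ j) (hj : j ∈ J)
    {H : (∀ i, E i) × (∀ i, E i) → ℝ}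
    (hH : ∀ x, DependsOn (fun y => H (x, y)) (({j}ᶜ : Finset ι) : Set ι))
    (hint : Integrable (fun z => g J (mix {i, j}ᶜ z) * H z) (twoCopies ν)) :
    ∫ z, g J (mix {i, j}ᶜ z) * H z ∂(twoCopies ν) = 0 := by
  have hm : ∀ z : (∀ i, E i) × (∀ i, E i), mix {i, j}ᶜ (exch {i}ᶜ z) = resample j z := by
    intro z
    funext k
    by_cases hi : k = i
    · subst hi
      simp [mix, exch_apply, hij]
    · simp [mix, exch_apply, hi]
  have hint' : Integrable (fun z => g J (resample j z) * H (exch {i}ᶜ z)) (twoCopies ν) := by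
    refine ((measurePreserving_exch ν {i}ᶜ).integrable_comp_of_integrable hint).congr
      (Eventually.of_forall fun z => ?_)
    simp only [Function.comp, hm]
  rw [← integral_exch ν {i}ᶜ]
  simp only [hm]
  refine hg.integral_resample_mul hj (fun x y y' h => ?_) hint'
  have e1 : mix {i}ᶜ (x, y) = mix {i}ᶜ (x, y') := by
    funext k
    by_cases hk : k = i
    · subst hk
      have := h k (by simpa using hij)
      simp [mix, this]
    · simp [mix, hk]
  simp only [exch_apply, e1]
  refine hH _ fun k hk => ?_
  have := h k hk
  simp [mix, this]

/-- Weak form of the eigenvalue equation `L W = -p W`. -/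
lemma sum_integral_resample_sub_mul_sub {G : (∀ i, E i) → ℝ}
    (h0 : ∀ J, Integrable (fun x => g J x * G x) (Measure.pi ν))
    (h1 : ∀ J i, Integrable (fun z => g J (resample i z) * G z.1) (twoCopies ν)) :
    ∑ i, ∫ z, (ustat g (resample i z) - ustat g z.1) * (G (resample i z) - G z.1) ∂(twoCopies ν)
      = 2 * p * ∫ x, ustat g x * G x ∂(Measure.pi ν) := by
  have hsum : ∫ x, ustat g x * G x ∂(Measure.pi ν) = ∑ J, ∫ x, g J x * G x ∂(Measure.pi ν) := by
    simp only [ustat, Finset.sum_mul]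
    exact integral_finsetSum _ fun J _ => h0 J
  -- Resampling `i` kills the kernels with `i ∈ J` by degeneracy and leaves the others untouched.
  -- Summed over `i`, each kernel is thus counted `|J| = p` times.
  have hres : ∀ i, ∫ z, ustat g (resample i z) * G z.1 ∂(twoCopies ν)
      = ∑ J, if i ∈ J then 0 else ∫ x, g J x * G x ∂(Measure.pi ν) := fun i => by
    simp only [ustat, Finset.sum_mul]
    rw [integral_finsetSum _ fun J _ => h1 J i]
    refine Finset.sum_congr rfl fun J _ => ?_
    split_ifs with hi
    · exact hg.integral_resample_mul (H := fun z => G z.1) hi (fun x y y' _ => rfl) (h1 J i)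
    · rw [← integral_fst_twoCopies ν fun x => g J x * G x]
      simp only [dependsOn_mix (hg.dependsOn J) (Finset.subset_compl_singleton.2 hi)]
  have hdir : ∀ i, ∫ z, (ustat g (resample i z) - ustat g z.1) * (G (resample i z) - G z.1)
      ∂(twoCopies ν) = 2 * ∑ J, if i ∈ J then ∫ x, g J x * G x ∂(Measure.pi ν) else 0 :=
    fun i => by
    rw [integral_resample_sub_mul_sub, hres, hsum, ← Finset.sum_sub_distrib]
    · congr 1
      refine Finset.sum_congr rfl fun J _ => ?_
      split_ifs <;> simp
    · simp only [ustat, Finset.sum_mul]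
      exact integrable_finsetSum _ fun J _ => h0 J
    · simp only [ustat, Finset.sum_mul]
      exact integrable_finsetSum _ fun J _ => h1 J i
  simp only [hdir]
  rw [← Finset.mul_sum, Finset.sum_comm, mul_assoc, hsum, Finset.mul_sum _ _ (p : ℝ)]
  congr 1
  refine Finset.sum_congr rfl fun J _ => ?_
  rw [← Finset.sum_filter, Finset.sum_const, Finset.filter_univ_mem, nsmul_eq_mul,
    ← integral_const_mul, ← integral_const_mul]
  congr 1
  funext x
  rw [← mul_assoc, hg.card_mul, mul_assoc]

/-- The increment of the U-statistic caused by resampling one coordinate. -/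
lemma memLp_increment (i : ι) :
    MemLp (fun z => ustat g (resample i z) - ustat g z.1) 4 (twoCopies ν) :=
  (memLp_mix ν {i}ᶜ hg.memLp_ustat).sub
    (hg.memLp_ustat.comp_measurePreserving measurePreserving_fst)

/-- The eigenvalue equation with `G = W³`, combined with `(b - a)(b³ - a³) = (b - a)⁴/4 + 3(b² -
a²)²/4`. -/
lemma sum_integral_increment_pow_four :
    (1 / 4 : ℝ) * ∑ i, ∫ z, (ustat g (resample i z) - ustat g z.1) ^ 4 ∂(twoCopies ν)
      = 2 * p * ∫ x, ustat g x ^ 4 ∂(Measure.pi ν)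
        - (3 / 4 : ℝ) * ∑ i, ∫ z, (ustat g (resample i z) ^ 2 - ustat g z.1 ^ 2) ^ 2
          ∂(twoCopies ν) := by
  have hW := hg.memLp_ustat
  have hW1 : MemLp (fun z => ustat g z.1) 4 (twoCopies ν) :=
    hW.comp_measurePreserving measurePreserving_fst
  have h := hg.sum_integral_resample_sub_mul_sub (G := fun x => ustat g x ^ 3)
    (fun J => integrable_mul_pow_three (hg.memLp J) hW)
    (fun J i => integrable_mul_pow_three (memLp_mix ν {i}ᶜ (hg.memLp J)) hW1)
  have e : ∫ x, ustat g x * ustat g x ^ 3 ∂(Measure.pi ν) = ∫ x, ustat g x ^ 4 ∂(Measure.pi ν) := by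
    congr 1
    funext x
    ring
  rw [e] at h
  rw [← h, Finset.mul_sum, Finset.mul_sum, ← Finset.sum_sub_distrib]
  refine Finset.sum_congr rfl fun i _ => ?_
  have hr : MemLp (fun z => ustat g (resample i z)) 4 (twoCopies ν) := memLp_mix ν {i}ᶜ hW
  have i1 : Integrable (fun z => (ustat g (resample i z) ^ 2 - ustat g z.1 ^ 2) ^ 2)
      (twoCopies ν) := ((memLp_two_sq hr).sub (memLp_two_sq hW1)).integrable_sq
  have i2 := integrable_pow_four (hg.memLp_increment i)
  rw [eq_sub_iff_add_eq, ← integral_const_mul, ← integral_const_mul,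
    ← integral_add (i2.const_mul _) (i1.const_mul _)]
  congr 1
  funext z
  ring

end IsKernelFamily
end Kernels

/-! ### Signed squares of the increments and their second moment. -/

/-- The signed square. -/
def signedSq (t : ℝ) : ℝ := t * |t|

lemma signedSq_neg (t : ℝ) : signedSq (-t) = -signedSq t := by simp [signedSq]

lemma signedSq_sq (t : ℝ) : signedSq t ^ 2 = t ^ 4 := by
  rw [signedSq, mul_pow, sq_abs]
  ring

lemma continuous_signedSq : Continuous signedSq := continuous_id.mul continuous_abs

/-- Since `t|t|` has derivative `2|t|`, the difference is at most `|a - b| (|a| + |b|)`. -/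
lemma signedSq_sub_sq_le (a b : ℝ) :
    (signedSq a - signedSq b) ^ 2 ≤ (a - b) ^ 2 * (2 * a ^ 2 + 2 * b ^ 2) := by
  unfold signedSq
  rcases abs_cases a with ⟨ha, ha'⟩ | ⟨ha, ha'⟩ <;> rcases abs_cases b with ⟨hb, hb'⟩ | ⟨hb, hb'⟩ <;>
    rw [ha, hb]
  · nlinarith [mul_nonneg (sq_nonneg (a - b)) (sq_nonneg (a - b))]
  · nlinarith [mul_nonneg (mul_nonneg ha' (neg_nonneg.2 hb'.le))
      (add_nonneg (sq_nonneg a) (sq_nonneg b)), sq_nonneg (a ^ 2 + b ^ 2)]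
  · nlinarith [mul_nonneg (mul_nonneg (neg_nonneg.2 ha'.le) hb')
      (add_nonneg (sq_nonneg a) (sq_nonneg b)), sq_nonneg (a ^ 2 + b ^ 2)]
  · nlinarith [mul_nonneg (sq_nonneg (a - b)) (sq_nonneg (a - b))]

section Kernels

variable {ι : Type*} [Fintype ι] [DecidableEq ι] {E : ι → Type*} [∀ i, MeasurableSpace (E i)]
  {ν : ∀ i, Measure (E i)} [∀ i, IsProbabilityMeasure (ν i)] {p : ℕ}
  {g : Finset ι → (∀ i, E i) → ℝ}

section Fiberwise

variable {α β : Type*} {mα : MeasurableSpace α} {mβ : MeasurableSpace β} {μ : Measure α}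
  {τ : Measure β} [IsProbabilityMeasure μ] [IsProbabilityMeasure τ]

lemma ae_sq_integral_fiber_le {h : α × β → ℝ} (hm : Measurable h) (hh : MemLp h 2 (μ.prod τ)) :
    ∀ᵐ x ∂μ, (∫ y, h (x, y) ∂τ) ^ 2 ≤ ∫ y, h (x, y) ^ 2 ∂τ := by
  filter_upwards [hh.integrable_sq.prod_right_ae] with x hx
  refine sq_integral_le ((memLp_two_iff_integrable_sq ?_).2 hx)
  exact (hm.comp measurable_prodMk_left).aestronglyMeasurable

lemma measurable_integral_fiber {h : α × β → ℝ} (hm : Measurable h) :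
    Measurable fun x => ∫ y, h (x, y) ∂τ :=
  hm.stronglyMeasurable.integral_prod_right'.measurable

lemma memLp_integral_fiber {h : α × β → ℝ} (hm : Measurable h) (hh : MemLp h 2 (μ.prod τ)) :
    MemLp (fun x => ∫ y, h (x, y) ∂τ) 2 μ := by
  have hm' : Measurable fun x => ∫ y, h (x, y) ∂τ := measurable_integral_fiber hm
  refine (memLp_two_iff_integrable_sq hm'.aestronglyMeasurable).2 ?_
  refine hh.integrable_sq.integral_prod_left.mono' (hm'.pow_const 2).aestronglyMeasurable ?_
  filter_upwards [ae_sq_integral_fiber_le hm hh] with x hx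
  rwa [Real.norm_of_nonneg (sq_nonneg _)]

lemma integral_sq_integral_fiber_le {h : α × β → ℝ} (hm : Measurable h)
    (hh : MemLp h 2 (μ.prod τ)) :
    ∫ x, (∫ y, h (x, y) ∂τ) ^ 2 ∂μ ≤ ∫ z, h z ^ 2 ∂(μ.prod τ) := by
  rw [integral_prod _ hh.integrable_sq]
  exact integral_mono_ae (memLp_integral_fiber hm hh).integrable_sq
    hh.integrable_sq.integral_prod_left (ae_sq_integral_fiber_le hm hh)

end Fiberwise

variable (g) in
/-- The increment of the U-statistic caused by resampling the coordinate `i`. -/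
def increment (i : ι) (z : (∀ i, E i) × (∀ i, E i)) : ℝ := ustat g (resample i z) - ustat g z.1

lemma increment_exch_self (i : ι) (z : (∀ i, E i) × (∀ i, E i)) :
    increment g i (exch {i}ᶜ z) = -increment g i z := by
  rw [increment, resample_exch, exch_resample_fst, increment]
  ring

lemma resample_exch_of_ne {i j : ι} (hij : i ≠ j) (z : (∀ i, E i) × (∀ i, E i)) :
    resample i (exch {j}ᶜ z) = mix {i, j}ᶜ z := by
  funext k
  by_cases hi : k = i
  · subst hi
    simp [mix, exch_apply, hij]
  · simp [mix, exch_apply, hi]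

lemma increment_exch_of_ne {i j : ι} (hij : i ≠ j) (z : (∀ i, E i) × (∀ i, E i)) :
    increment g i (exch {j}ᶜ z) = ustat g (mix {i, j}ᶜ z) - ustat g (resample j z) := by
  rw [increment, resample_exch_of_ne hij, exch_resample_fst]

/-- Resampling `j` does not disturb the antisymmetry in `i`: exchanging `i` swaps the two statistics
that are subtracted. -/
lemma increment_exch_exch {i j : ι} (hij : i ≠ j) (z : (∀ i, E i) × (∀ i, E i)) :
    increment g i (exch {j}ᶜ (exch {i}ᶜ z)) = -increment g i (exch {j}ᶜ z) := by
  have h1 : mix {i, j}ᶜ (exch {i}ᶜ z) = resample j z := by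
    funext k
    by_cases hi : k = i
    · subst hi
      simp [mix, exch_apply, hij]
    · simp [mix, exch_apply, hi]
  rw [increment_exch_of_ne hij, increment_exch_of_ne hij, h1, resample_exch_of_ne hij.symm,
    Finset.pair_comm]
  ring

lemma dependsOn_increment (i : ι) (x : ∀ i, E i) :
    DependsOn (fun y => increment g i (x, y)) (({i} : Finset ι) : Set ι) := by
  intro y y' h
  have : resample i (x, y) = resample i (x, y') := by
    funext k
    by_cases hk : k = i
    · subst hk
      simpa [mix] using h
    · simp [mix, hk]
  simp only [increment, this]

variable (ν g) in
/-- The conditional expectation of the sum of the signed squares of the increments. -/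
def signedEnergy (x : ∀ i, E i) : ℝ :=
  ∑ i, ∫ y, signedSq (increment g i (x, y)) ∂(Measure.pi ν)

namespace IsKernelFamily

variable (hg : IsKernelFamily ν p g)
include hg

lemma measurable_increment (i : ι) : Measurable (increment g i) :=
  (hg.measurable_ustat.comp (measurable_mix _)).sub (hg.measurable_ustat.comp measurable_fst)

lemma memLp_increment' (i : ι) : MemLp (increment g i) 4 (twoCopies ν) := hg.memLp_increment i

lemma memLp_increment_exch (i j : ι) :
    MemLp (fun z => increment g i (exch {j}ᶜ z)) 4 (twoCopies ν) :=
  (hg.memLp_increment i).comp_measurePreserving (measurePreserving_exch ν {j}ᶜ)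

lemma sum_integral_kernel_increment (i : ι) :
    ∑ J, ∫ z, (g J (resample i z) - g J z.1) * increment g i z ^ 3 ∂(twoCopies ν)
      = ∫ z, increment g i z ^ 4 ∂(twoCopies ν) := by
  have hint : ∀ J, Integrable (fun z => (g J (resample i z) - g J z.1) * increment g i z ^ 3)
      (twoCopies ν) := fun J => integrable_mul_pow_three ((memLp_mix ν {i}ᶜ (hg.memLp J)).sub
        ((hg.memLp J).comp_measurePreserving measurePreserving_fst)) (hg.memLp_increment i)
  rw [← integral_finsetSum _ fun J _ => hint J]
  congr 1
  funext z
  rw [← Finset.sum_mul, Finset.sum_sub_distrib]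
  change increment g i z * _ = _
  ring

/-- The cubed increment does not see the fresh value of `j`. Kernels with `j ∈ J`, evaluated at that
fresh value, integrate to zero against it, and kernels with `j ∉ J` do not change. -/
lemma integral_increment_exch_mul {i j : ι} (hij : i ≠ j) :
    ∫ z, increment g i (exch {j}ᶜ z) * increment g i z ^ 3 ∂(twoCopies ν)
      = ∑ J, if j ∈ J then 0 else
          ∫ z, (g J (resample i z) - g J z.1) * increment g i z ^ 3 ∂(twoCopies ν) := by
  have h1 : ∀ J, Integrable (fun z => g J (mix {i, j}ᶜ z) * increment g i z ^ 3)
      (twoCopies ν) := fun J =>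
    integrable_mul_pow_three (memLp_mix ν _ (hg.memLp J)) (hg.memLp_increment i)
  have h2 : ∀ J, Integrable (fun z => g J (resample j z) * increment g i z ^ 3)
      (twoCopies ν) := fun J =>
    integrable_mul_pow_three (memLp_mix ν _ (hg.memLp J)) (hg.memLp_increment i)
  have hdep : ∀ x, DependsOn (fun y => increment g i (x, y) ^ 3)
      (({j}ᶜ : Finset ι) : Set ι) := fun x y y' h => by
    refine congrArg (· ^ 3) (dependsOn_increment i x fun k hk => h k ?_)
    have : k = i := by simpa using hk
    simpa [this] using hij
  have hsum : ∀ z, increment g i (exch {j}ᶜ z) * increment g i z ^ 3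
      = ∑ J, (g J (mix {i, j}ᶜ z) * increment g i z ^ 3
        - g J (resample j z) * increment g i z ^ 3) := fun z => by
    rw [increment_exch_of_ne hij, ustat, ustat, Finset.sum_sub_distrib, sub_mul,
      Finset.sum_mul, Finset.sum_mul]
  simp only [hsum]
  rw [integral_finsetSum _ fun J _ => by exact (h1 J).sub (h2 J)]
  refine Finset.sum_congr rfl fun J _ => ?_
  split_ifs with hj
  · rw [integral_sub (h1 J) (h2 J),
      hg.integral_resample_resample_mul (H := fun z => increment g i z ^ 3) hij hj hdep (h1 J),
      hg.integral_resample_mul (H := fun z => increment g i z ^ 3) hj hdep (h2 J), sub_zero]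
  · congr 1
    funext z
    have e1 : g J (mix {i, j}ᶜ z) = g J (resample i z) := by
      refine hg.dependsOn J fun k hk => ?_
      have : k ≠ j := fun h => hj (h ▸ hk)
      simp [mix, this]
    rw [e1, dependsOn_mix (hg.dependsOn J) (Finset.subset_compl_singleton.2 hj)]
    ring

/-- Increments of a degenerate U-statistic of order `p` are themselves degenerate of order
`p - 1`, which bounds the energy of their squares. -/
lemma sum_integral_increment_sub_sq_le (i : ι) :
    ∑ j ∈ Finset.univ.erase i, ∫ z, (increment g i z - increment g i (exch {j}ᶜ z)) ^ 2
        * increment g i z ^ 2 ∂(twoCopies ν)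
      ≤ 2 * (p - 1) * ∫ z, increment g i z ^ 4 ∂(twoCopies ν) := by
  have hu := hg.memLp_increment' i
  set k : Finset ι → ℝ := fun J =>
    ∫ z, (g J (resample i z) - g J z.1) * increment g i z ^ 3 ∂(twoCopies ν) with hk
  have hstep : ∀ j ∈ Finset.univ.erase i,
      ∫ z, (increment g i z - increment g i (exch {j}ᶜ z)) ^ 2 * increment g i z ^ 2
        ∂(twoCopies ν) ≤ 2 * ∑ J, if j ∈ J then k J else 0 := by
    intro j hj
    have hij : i ≠ j := (Finset.ne_of_mem_erase hj).symm
    have hv := hg.memLp_increment_exch i j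
    set v : (∀ i, E i) × (∀ i, E i) → ℝ := fun z => increment g i (exch {j}ᶜ z) with hvdef
    have hvv : ∀ z, v (exch {j}ᶜ z) = increment g i z := fun z =>
      congrArg (increment g i) ((exch {j}ᶜ).left_inv z)
    have huv := hu.sub hv
    have i1 : Integrable (fun z => (increment g i z - v z) ^ 2 * increment g i z ^ 2)
        (twoCopies ν) := (integrable_mul_four huv huv hu hu).congr
          (Eventually.of_forall fun z => by simp only [Pi.sub_apply]; ring)
    have i2 : Integrable (fun z => (increment g i z - v z) ^ 2 * v z ^ 2)
        (twoCopies ν) := (integrable_mul_four huv huv hv hv).congr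
          (Eventually.of_forall fun z => by simp only [Pi.sub_apply]; ring)
    have i3 : Integrable (fun z => increment g i z ^ 4) (twoCopies ν) := integrable_pow_four hu
    have i4 : Integrable (fun z => v z ^ 4) (twoCopies ν) := integrable_pow_four hv
    have i5 : Integrable (fun z => v z * increment g i z ^ 3) (twoCopies ν) :=
      integrable_mul_pow_three hv hu
    have i6 : Integrable (fun z => increment g i z * v z ^ 3) (twoCopies ν) :=
      integrable_mul_pow_three hu hv
    have s2 : ∫ z, (increment g i z - v z) ^ 2 * v z ^ 2 ∂(twoCopies ν)
        = ∫ z, (increment g i z - v z) ^ 2 * increment g i z ^ 2 ∂(twoCopies ν) := by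
      rw [← integral_exch ν {j}ᶜ]
      congr 1
      funext z
      rw [hvv]
      simp only [hvdef]
      ring
    have s4 : ∫ z, v z ^ 4 ∂(twoCopies ν) = ∫ z, increment g i z ^ 4 ∂(twoCopies ν) :=
      integral_exch ν {j}ᶜ fun z => increment g i z ^ 4
    have s6 : ∫ z, increment g i z * v z ^ 3 ∂(twoCopies ν)
        = ∫ z, v z * increment g i z ^ 3 ∂(twoCopies ν) := by
      rw [← integral_exch ν {j}ᶜ]
      simp only [hvv]
      rfl
    -- With `u` the increment, this is `(u - v)² (u² + v²) ≤ 2 (u - v)(u³ - v³)`, whose defect is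
    -- `(u - v)² (u + v)²`. Exchanging `j` swaps `u` and `v`, so the terms on each side pair up into
    -- equal integrals.
    have key : ∫ z, ((increment g i z - v z) ^ 2 * increment g i z ^ 2
          + (increment g i z - v z) ^ 2 * v z ^ 2) ∂(twoCopies ν)
        ≤ ∫ z, 2 * ((increment g i z ^ 4 - v z * increment g i z ^ 3)
          + (v z ^ 4 - increment g i z * v z ^ 3)) ∂(twoCopies ν) := by
      refine integral_mono (i1.add i2) (((i3.sub i5).add (i4.sub i6)).const_mul 2) fun z => ?_
      have := mul_nonneg (sq_nonneg (increment g i z - v z)) (sq_nonneg (increment g i z + v z))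
      simp only
      nlinarith
    rw [integral_add i1 i2, integral_const_mul, integral_add (by exact i3.sub i5)
      (by exact i4.sub i6), integral_sub i3 i5, integral_sub i4 i6, s2, s4, s6,
      hg.integral_increment_exch_mul hij, ← hg.sum_integral_kernel_increment i,
      ← Finset.sum_sub_distrib] at key
    have e : ∀ J, (∫ z, (g J (resample i z) - g J z.1) * increment g i z ^ 3 ∂(twoCopies ν)
        - if j ∈ J then 0 else
          ∫ z, (g J (resample i z) - g J z.1) * increment g i z ^ 3 ∂(twoCopies ν))
        = if j ∈ J then k J else 0 := fun J => by
      split_ifs <;> simp [hk]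
    simp only [e] at key
    linarith
  refine (Finset.sum_le_sum hstep).trans_eq ?_
  rw [← Finset.mul_sum, Finset.sum_comm, mul_assoc, ← hg.sum_integral_kernel_increment i,
    Finset.mul_sum _ _ ((p : ℝ) - 1)]
  congr 1
  refine Finset.sum_congr rfl fun J _ => ?_
  rw [← Finset.sum_filter, Finset.sum_const, nsmul_eq_mul]
  change _ * k J = _ * k J
  by_cases hp : J.card = p
  -- A kernel containing `i` is counted once for each `j ∈ J` other than `i`, that is `p - 1` times;
  -- a kernel avoiding `i` has zero increment.
  · by_cases hi : i ∈ J
    · have : (Finset.univ.erase i).filter (· ∈ J) = J.erase i := by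
        ext a; simp
      rw [this, Finset.card_erase_of_mem hi, hp, Nat.cast_sub, Nat.cast_one]
      rw [← hp]
      exact Finset.card_pos.2 ⟨i, hi⟩
    · have : k J = 0 := by
        simp only [hk]
        simp only [dependsOn_mix (hg.dependsOn J) (Finset.subset_compl_singleton.2 hi), sub_self,
          zero_mul, integral_zero]
      rw [this, mul_zero, mul_zero]
  · have : k J = 0 := by
      simp only [hk, hg.eq_zero J hp]
      simp
    rw [this, mul_zero, mul_zero]

lemma memLp_signedSq_increment (i : ι) :
    MemLp (fun z => signedSq (increment g i z)) 2 (twoCopies ν) :=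
  memLp_two_mul (hg.memLp_increment' i) (hg.memLp_increment' i).abs

lemma measurable_signedSq_increment (i : ι) :
    Measurable fun z => signedSq (increment g i z) :=
  continuous_signedSq.measurable.comp (hg.measurable_increment i)

/-- Let `S_i` be the signed squares and `τ_j` the exchange of `j`. Since `S_i` is odd under `τ_i`,
`4 E[S_i S_j] = E[(S_i - S_i∘τ_j)(S_j - S_j∘τ_i)]`. Apply `ab ≤ (a² + b²)/2` and
`signedSq_sub_sq_le`. -/
lemma integral_signedSq_mul_le {i j : ι} (hij : i ≠ j) :
    ∫ z, signedSq (increment g i z) * signedSq (increment g j z) ∂(twoCopies ν)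
      ≤ (1 / 2) * (∫ z, (increment g i z - increment g i (exch {j}ᶜ z)) ^ 2
          * increment g i z ^ 2 ∂(twoCopies ν))
        + (1 / 2) * ∫ z, (increment g j z - increment g j (exch {i}ᶜ z)) ^ 2
          * increment g j z ^ 2 ∂(twoCopies ν) := by
  have hm : ∀ i j : ι, MemLp (fun z => signedSq (increment g i (exch {j}ᶜ z))) 2
      (twoCopies ν) := fun i j =>
    (hg.memLp_signedSq_increment i).comp_measurePreserving (measurePreserving_exch ν {j}ᶜ)
  have hu := hg.memLp_signedSq_increment
  have e1 : ∫ z, signedSq (increment g i z) * signedSq (increment g j (exch {i}ᶜ z)) ∂(twoCopies ν)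
      = -∫ z, signedSq (increment g i z) * signedSq (increment g j z) ∂(twoCopies ν) := by
    rw [← integral_exch ν {i}ᶜ fun z => signedSq (increment g i z) * signedSq (increment g j z),
      ← integral_neg]
    congr 1
    funext z
    rw [increment_exch_self, signedSq_neg]
    ring
  have e2 : ∫ z, signedSq (increment g i (exch {j}ᶜ z)) * signedSq (increment g j z) ∂(twoCopies ν)
      = -∫ z, signedSq (increment g i z) * signedSq (increment g j z) ∂(twoCopies ν) := by
    rw [← integral_exch ν {j}ᶜ fun z => signedSq (increment g i z) * signedSq (increment g j z),
      ← integral_neg]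
    congr 1
    funext z
    rw [increment_exch_self, signedSq_neg]
    ring
  have e3 : ∫ z, signedSq (increment g i (exch {j}ᶜ z)) * signedSq (increment g j (exch {i}ᶜ z))
      ∂(twoCopies ν)
      = ∫ z, signedSq (increment g i z) * signedSq (increment g j z) ∂(twoCopies ν) := by
    rw [← neg_eq_iff_eq_neg] at e2
    rw [← e2, ← integral_neg, ← integral_exch ν {i}ᶜ fun z =>
      -(signedSq (increment g i (exch {j}ᶜ z)) * signedSq (increment g j z))]
    congr 1
    funext z
    rw [increment_exch_exch hij, signedSq_neg]
    ring
  have bound : ∀ i j : ι, ∫ z, (signedSq (increment g i z) - signedSq (increment g i (exch {j}ᶜ z)))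
        ^ 2 ∂(twoCopies ν)
      ≤ 4 * ∫ z, (increment g i z - increment g i (exch {j}ᶜ z)) ^ 2
          * increment g i z ^ 2 ∂(twoCopies ν) := by
    intro i j
    have hu := hg.memLp_increment' i
    have hv := hg.memLp_increment_exch i j
    have huv := hu.sub hv
    have i1 : Integrable (fun z => (increment g i z - increment g i (exch {j}ᶜ z)) ^ 2
        * increment g i z ^ 2) (twoCopies ν) := (integrable_mul_four huv huv hu hu).congr
          (Eventually.of_forall fun z => by simp only [Pi.sub_apply]; ring)
    have i2 : Integrable (fun z => (increment g i z - increment g i (exch {j}ᶜ z)) ^ 2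
        * increment g i (exch {j}ᶜ z) ^ 2) (twoCopies ν) :=
      (integrable_mul_four huv huv hv hv).congr
          (Eventually.of_forall fun z => by simp only [Pi.sub_apply]; ring)
    have s2 : ∫ z, (increment g i z - increment g i (exch {j}ᶜ z)) ^ 2
          * increment g i (exch {j}ᶜ z) ^ 2 ∂(twoCopies ν)
        = ∫ z, (increment g i z - increment g i (exch {j}ᶜ z)) ^ 2
          * increment g i z ^ 2 ∂(twoCopies ν) := by
      rw [← integral_exch ν {j}ᶜ]
      congr 1
      funext z
      rw [show exch {j}ᶜ (exch {j}ᶜ z) = z from (exch {j}ᶜ).left_inv z]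
      ring
    calc _ ≤ ∫ z, (2 * ((increment g i z - increment g i (exch {j}ᶜ z)) ^ 2
              * increment g i z ^ 2) + 2 * ((increment g i z - increment g i (exch {j}ᶜ z)) ^ 2
              * increment g i (exch {j}ᶜ z) ^ 2)) ∂(twoCopies ν) := by
          refine integral_mono ((hg.memLp_signedSq_increment i).sub (hm i j)).integrable_sq
            ((i1.const_mul 2).add (i2.const_mul 2)) fun z => ?_
          exact (signedSq_sub_sq_le _ _).trans_eq (by ring)
      _ = _ := by
          rw [integral_add (i1.const_mul 2) (i2.const_mul 2), integral_const_mul,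
            integral_const_mul, s2]
          ring
  have i1 := (hu i).integrable_mul (hu j)
  have i2 := (hu i).integrable_mul (hm j i)
  have i3 := (hm i j).integrable_mul (hu j)
  have i4 := (hm i j).integrable_mul (hm j i)
  have j1 := ((hu i).sub (hm i j)).integrable_sq
  have j2 := ((hu j).sub (hm j i)).integrable_sq
  have key : ∫ z, ((signedSq (increment g i z) * signedSq (increment g j z)
        - signedSq (increment g i z) * signedSq (increment g j (exch {i}ᶜ z)))
        - (signedSq (increment g i (exch {j}ᶜ z)) * signedSq (increment g j z)
        - signedSq (increment g i (exch {j}ᶜ z)) * signedSq (increment g j (exch {i}ᶜ z))))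
        ∂(twoCopies ν)
      ≤ ∫ z, ((1 / 2) * (signedSq (increment g i z) - signedSq (increment g i (exch {j}ᶜ z))) ^ 2
        + (1 / 2) * (signedSq (increment g j z) - signedSq (increment g j (exch {i}ᶜ z))) ^ 2)
        ∂(twoCopies ν) := by
    refine integral_mono ((i1.sub i2).sub (i3.sub i4)) ((j1.const_mul _).add (j2.const_mul _))
      fun z => ?_
    simp only
    nlinarith [sq_nonneg (signedSq (increment g i z) - signedSq (increment g i (exch {j}ᶜ z))
      - (signedSq (increment g j z) - signedSq (increment g j (exch {i}ᶜ z))))]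
  rw [integral_sub (by exact i1.sub i2) (by exact i3.sub i4), integral_sub (by exact i1)
    (by exact i2), integral_sub (by exact i3) (by exact i4), integral_add
    (by exact j1.const_mul _) (by exact j2.const_mul _), integral_const_mul, integral_const_mul,
    e1, e2, e3] at key
  have b1 := bound i j
  have b2 := bound j i
  linarith

lemma memLp_signedEnergy : MemLp (signedEnergy ν g) 2 (Measure.pi ν) :=
  memLp_finsetSum _ fun i _ => memLp_integral_fiber (hg.measurable_signedSq_increment i)
    (hg.memLp_signedSq_increment i)

/-- The diagonal contributes at most `∑ i, E[D_i⁴]` by Jensen, the off-diagonal part at most `2(p -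
1)` times that sum; `2p - 1` is rounded up to `2p`. -/
lemma integral_signedEnergy_sq_le :
    ∫ x, signedEnergy ν g x ^ 2 ∂(Measure.pi ν)
      ≤ 2 * p * ∑ i, ∫ z, increment g i z ^ 4 ∂(twoCopies ν) := by
  set Y : ι → (∀ i, E i) → ℝ := fun i x => ∫ y, signedSq (increment g i (x, y)) ∂(Measure.pi ν)
    with hY
  have hYm : ∀ i, MemLp (Y i) 2 (Measure.pi ν) := fun i =>
    memLp_integral_fiber (hg.measurable_signedSq_increment i) (hg.memLp_signedSq_increment i)
  set R : ι → ι → ℝ := fun i j => ∫ z, (increment g i z - increment g i (exch {j}ᶜ z)) ^ 2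
          * increment g i z ^ 2 ∂(twoCopies ν) with hR
  have hdiag : ∀ i, ∫ x, Y i x * Y i x ∂(Measure.pi ν)
      ≤ ∫ z, increment g i z ^ 4 ∂(twoCopies ν) := fun i => by
    have := integral_sq_integral_fiber_le (hg.measurable_signedSq_increment i)
      (hg.memLp_signedSq_increment i)
    simp only [signedSq_sq] at this
    simpa only [sq] using this
  -- For fixed `x` the two increments use different fresh coordinates, so the product of their
  -- conditional means is the conditional mean of the product.
  have hoff : ∀ i j, j ≠ i → ∫ x, Y i x * Y j x ∂(Measure.pi ν)
      ≤ (1 / 2) * R i j + (1 / 2) * R j i := fun i j hij => by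
    refine le_trans (le_of_eq ?_) (hg.integral_signedSq_mul_le hij.symm)
    have hint := (hg.memLp_signedSq_increment i).integrable_mul (hg.memLp_signedSq_increment j)
    rw [integral_prod _ (by exact hint)]
    congr 1
    funext x
    have hd : ∀ i, DependsOn (fun y => signedSq (increment g i (x, y)))
        (({i} : Finset ι) : Set ι) := fun i y y' h =>
      congrArg signedSq (dependsOn_increment i x h)
    exact (integral_mul_of_disjoint ν (hd i) (hd j)
      (Finset.disjoint_singleton.2 hij.symm)).symm
  calc ∫ x, signedEnergy ν g x ^ 2 ∂(Measure.pi ν)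
      = ∑ i, ∑ j, ∫ x, Y i x * Y j x ∂(Measure.pi ν) := by
        have hint : ∀ i j, Integrable (fun x => Y i x * Y j x) (Measure.pi ν) := fun i j =>
          (hYm i).integrable_mul (hYm j)
        simp only [signedEnergy, sq, Finset.sum_mul_sum]
        rw [integral_finsetSum _ fun i _ => integrable_finsetSum _ fun j _ => hint i j]
        exact Finset.sum_congr rfl fun i _ => integral_finsetSum _ fun j _ => hint i j
    _ ≤ ∑ i, (∫ z, increment g i z ^ 4 ∂(twoCopies ν)
          + ∑ j ∈ Finset.univ.erase i, ((1 / 2) * R i j + (1 / 2) * R j i)) := by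
        refine Finset.sum_le_sum fun i _ => ?_
        rw [← Finset.add_sum_erase _ _ (Finset.mem_univ i)]
        exact add_le_add (hdiag i) (Finset.sum_le_sum fun j hj =>
          hoff i j (Finset.ne_of_mem_erase hj))
    _ = ∑ i, (∫ z, increment g i z ^ 4 ∂(twoCopies ν) + ∑ j ∈ Finset.univ.erase i, R i j) := by
        have hsymm : ∑ i, ∑ j ∈ Finset.univ.erase i, R j i
            = ∑ i, ∑ j ∈ Finset.univ.erase i, R i j := by
          refine Finset.sum_comm' fun i j => ?_
          simp [eq_comm]
        simp only [Finset.sum_add_distrib, ← Finset.mul_sum, hsymm]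
        ring
    _ ≤ ∑ i, (∫ z, increment g i z ^ 4 ∂(twoCopies ν)
          + 2 * (p - 1) * ∫ z, increment g i z ^ 4 ∂(twoCopies ν)) :=
        Finset.sum_le_sum fun i _ => by
          have := hg.sum_integral_increment_sub_sq_le i
          gcongr
    _ ≤ _ := by
        rw [Finset.mul_sum]
        refine Finset.sum_le_sum fun i _ => ?_
        have : 0 ≤ ∫ z, increment g i z ^ 4 ∂(twoCopies ν) :=
          integral_nonneg fun z => by positivity
        linarith

end IsKernelFamily
end Kernels

/-! ### Stein's method for the resampling pair. -/

section Kernels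

variable {ι : Type*} [Fintype ι] [DecidableEq ι] {E : ι → Type*} [∀ i, MeasurableSpace (E i)]
  {ν : ∀ i, Measure (E i)} [∀ i, IsProbabilityMeasure (ν i)] {p : ℕ}
  {g : Finset ι → (∀ i, E i) → ℝ}

lemma integral_abs_le_sqrt {α : Type*} {mα : MeasurableSpace α} {μ : Measure α}
    [IsProbabilityMeasure μ] {f : α → ℝ} (hf : MemLp f 2 μ) :
    ∫ x, |f x| ∂μ ≤ √(∫ x, f x ^ 2 ∂μ) := by
  refine Real.le_sqrt_of_sq_le ?_
  have := sq_integral_le hf.abs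
  simpa only [Pi.abs_apply, sq_abs] using this

variable (ν g) in
/-- The conditional expectation of the sum of the squares of the increments. -/
def energy (x : ∀ i, E i) : ℝ := ∑ i, ∫ y, increment g i (x, y) ^ 2 ∂(Measure.pi ν)

namespace IsKernelFamily

variable (hg : IsKernelFamily ν p g)
include hg

lemma memLp_energy : MemLp (energy ν g) 2 (Measure.pi ν) :=
  memLp_finsetSum _ fun i _ => memLp_integral_fiber ((hg.measurable_increment i).pow_const 2)
    (memLp_two_sq (hg.memLp_increment' i))

lemma integral_mul_steinSol (z : ℝ) :
    ∑ i, ∫ w, increment g i w * (steinSol z (ustat g (resample i w)) - steinSol z (ustat g w.1))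
        ∂(twoCopies ν)
      = 2 * p * ∫ x, ustat g x * steinSol z (ustat g x) ∂(Measure.pi ν) := by
  have hb : ∀ w, ‖steinSol z w‖ ≤ mills z + mills (-z) := fun w => by
    rw [Real.norm_of_nonneg (steinSol_nonneg z w)]
    exact steinSol_le z w
  have hm : Measurable fun x => steinSol z (ustat g x) :=
    (continuous_steinSol z).measurable.comp hg.measurable_ustat
  refine hg.sum_integral_resample_sub_mul_sub (G := fun x => steinSol z (ustat g x))
    (fun J => ?_) fun J i => ?_
  · exact ((hg.memLp J).integrable (by norm_num)).mul_bdd hm.aestronglyMeasurable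
      (Eventually.of_forall fun x => hb _)
  · exact (integrable_mix ν {i}ᶜ ((hg.memLp J).integrable (by norm_num))).mul_bdd
      (hm.comp measurable_fst).aestronglyMeasurable (Eventually.of_forall fun x => hb _)

/-- The signed square is odd under the exchange, so the resampled term is minus the other one. The
constant `Φ(z) - 1` cancels in the difference and is inserted to make the factor bounded by `1`. -/
lemma integral_signedSq_increment_mul (z : ℝ) (i : ι) :
    ∫ w, signedSq (increment g i w) * (steinOsc z (ustat g (resample i w))
        - steinOsc z (ustat g w.1)) ∂(twoCopies ν)
      = -2 * ∫ x, (∫ y, signedSq (increment g i (x, y)) ∂(Measure.pi ν))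
          * (steinOsc z (ustat g x) - (stdCdf z - 1)) ∂(Measure.pi ν) := by
  set k : (∀ i, E i) → ℝ := fun x => steinOsc z (ustat g x) - (stdCdf z - 1) with hk
  have hkm : Measurable k :=
    ((measurable_steinOsc z).comp hg.measurable_ustat).sub measurable_const
  have hint := (hg.memLp_signedSq_increment i).integrable one_le_two
  have h1 : Integrable (fun w => signedSq (increment g i w) * k w.1) (twoCopies ν) :=
    hint.mul_bdd (c := 1) (hkm.comp measurable_fst).aestronglyMeasurable
      (Eventually.of_forall fun x => abs_steinOsc_sub_le z _)
  have h2 : Integrable (fun w => signedSq (increment g i w) * k (resample i w)) (twoCopies ν) :=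
    hint.mul_bdd (c := 1) (hkm.comp (measurable_mix _)).aestronglyMeasurable
      (Eventually.of_forall fun x => abs_steinOsc_sub_le z _)
  have h3 : ∫ w, signedSq (increment g i w) * k (resample i w) ∂(twoCopies ν)
      = -∫ w, signedSq (increment g i w) * k w.1 ∂(twoCopies ν) := by
    rw [← integral_exch ν {i}ᶜ, ← integral_neg]
    congr 1
    funext w
    rw [increment_exch_self, signedSq_neg, resample_exch]
    ring
  have h4 : ∫ x, (∫ y, signedSq (increment g i (x, y)) ∂(Measure.pi ν)) * k x ∂(Measure.pi ν)
      = ∫ w, signedSq (increment g i w) * k w.1 ∂(twoCopies ν) := by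
    rw [integral_prod _ h1]
    simp only [integral_mul_const]
  calc _ = ∫ w, (signedSq (increment g i w) * k (resample i w)
        - signedSq (increment g i w) * k w.1) ∂(twoCopies ν) := by
        congr 1
        funext w
        simp only [hk]
        ring
    _ = _ := by
        rw [integral_sub h2 h1, h3, h4]
        ring

/-- Stein's bound on the Kolmogorov distance to the normal law in terms of the conditional second
moments of the increments. -/
lemma abs_cdf_sub_le (hp : 0 < p) (z : ℝ) :
    |(Measure.pi ν).real {x | ustat g x ≤ z} - stdCdf z|
      ≤ 1 / (2 * p) * ∫ x, |2 * p - energy ν g x| ∂(Measure.pi ν)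
        + 1 / p * ∫ x, |signedEnergy ν g x| ∂(Measure.pi ν) := by
  have hp' : (0 : ℝ) < p := by exact_mod_cast hp
  set π := Measure.pi ν
  have hWm := hg.measurable_ustat
  have hdm : Measurable fun x => steinDeriv z (ustat g x) := (measurable_steinDeriv z).comp hWm
  have hfm : Measurable fun x => steinSol z (ustat g x) :=
    (continuous_steinSol z).measurable.comp hWm
  have hom : Measurable fun x => steinOsc z (ustat g x) := (measurable_steinOsc z).comp hWm
  have hfb : ∀ w, ‖steinSol z w‖ ≤ mills z + mills (-z) := fun w => by
    rw [Real.norm_of_nonneg (steinSol_nonneg z w)]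
    exact steinSol_le z w
  have hdint : Integrable (fun x => steinDeriv z (ustat g x)) π :=
    Integrable.of_bound hdm.aestronglyMeasurable 1
      (Eventually.of_forall fun x => abs_steinDeriv_le z _)
  have hfint : Integrable (fun x => ustat g x * steinSol z (ustat g x)) π :=
    (hg.memLp_ustat.integrable (by norm_num)).mul_bdd hfm.aestronglyMeasurable
      (Eventually.of_forall fun x => hfb _)
  have hcdf : π.real {x | ustat g x ≤ z} - stdCdf z
      = ∫ x, steinDeriv z (ustat g x) ∂π - ∫ x, ustat g x * steinSol z (ustat g x) ∂π := by
    have hset : MeasurableSet {x | ustat g x ≤ z} := hWm measurableSet_Iic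
    have e : ∀ x, steinDeriv z (ustat g x) - ustat g x * steinSol z (ustat g x)
        = {x | ustat g x ≤ z}.indicator (fun _ => (1 : ℝ)) x - stdCdf z := fun x => by
      simp only [steinDeriv, halfLine, indicator, mem_ofPred_eq]
      ring
    rw [← integral_sub hdint hfint]
    simp only [e]
    rw [integral_sub ((integrable_const _).indicator hset) (integrable_const _),
      integral_indicator hset]
    simp
  have hen : ∑ i, ∫ w, increment g i w ^ 2 * steinDeriv z (ustat g w.1) ∂(twoCopies ν)
      = ∫ x, energy ν g x * steinDeriv z (ustat g x) ∂π := by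
    have hint : ∀ i, Integrable (fun w => increment g i w ^ 2 * steinDeriv z (ustat g w.1))
        (twoCopies ν) := fun i =>
      ((memLp_two_sq (hg.memLp_increment' i)).integrable one_le_two).mul_bdd (c := 1)
        (hdm.comp measurable_fst).aestronglyMeasurable
        (Eventually.of_forall fun x => abs_steinDeriv_le z _)
    simp only [energy, Finset.sum_mul]
    rw [integral_finsetSum]
    · refine Finset.sum_congr rfl fun i _ => ?_
      rw [integral_prod _ (hint i)]
      simp only [integral_mul_const]
      rfl
    · intro i _
      have := (hint i).integral_prod_left
      simp only [integral_mul_const] at this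
      exact this
  have hrem : |2 * p * ∫ x, ustat g x * steinSol z (ustat g x) ∂π
      - ∫ x, energy ν g x * steinDeriv z (ustat g x) ∂π|
      ≤ 2 * ∫ x, |signedEnergy ν g x| ∂π := by
    rw [← hg.integral_mul_steinSol z, ← hen, ← Finset.sum_sub_distrib]
    have hi1 : ∀ i, Integrable (fun w => increment g i w * (steinSol z (ustat g (resample i w))
        - steinSol z (ustat g w.1))) (twoCopies ν) := fun i =>
      ((hg.memLp_increment' i).integrable (by norm_num)).mul_bdd
        (c := (mills z + mills (-z)) + (mills z + mills (-z)))
        ((hfm.comp (measurable_mix _)).sub (hfm.comp measurable_fst)).aestronglyMeasurable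
        (Eventually.of_forall fun w => (norm_sub_le _ _).trans (add_le_add (hfb _) (hfb _)))
    have hi2 : ∀ i, Integrable (fun w => increment g i w ^ 2 * steinDeriv z (ustat g w.1))
        (twoCopies ν) := fun i =>
      ((memLp_two_sq (hg.memLp_increment' i)).integrable one_le_two).mul_bdd (c := 1)
        (hdm.comp measurable_fst).aestronglyMeasurable
        (Eventually.of_forall fun x => abs_steinDeriv_le z _)
    have hi3 : ∀ i, Integrable (fun w => signedSq (increment g i w)
        * (steinOsc z (ustat g (resample i w)) - steinOsc z (ustat g w.1))) (twoCopies ν) :=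
      fun i => ((hg.memLp_signedSq_increment i).integrable one_le_two).mul_bdd (c := 1 + 1)
        ((hom.comp (measurable_mix _)).sub (hom.comp measurable_fst)).aestronglyMeasurable
        (Eventually.of_forall fun w => by
          rw [← sub_sub_sub_cancel_right _ _ (stdCdf z - 1)]
          exact (norm_sub_le _ _).trans
            (add_le_add (abs_steinOsc_sub_le z _) (abs_steinOsc_sub_le z _)))
    have hpt : ∀ i (w : (∀ i, E i) × (∀ i, E i)),
        |increment g i w * (steinSol z (ustat g (resample i w)) - steinSol z (ustat g w.1))
          - increment g i w ^ 2 * steinDeriv z (ustat g w.1)|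
        ≤ signedSq (increment g i w)
          * (steinOsc z (ustat g (resample i w)) - steinOsc z (ustat g w.1)) := by
      intro i w
      have h := abs_steinSol_taylor_le z (ustat g w.1) (ustat g (resample i w))
      change |_ - _ - increment g i w * _| ≤ |increment g i w| * _ at h
      -- By monotonicity of `steinOsc z` its difference has the sign of the increment, so the
      -- absolute values can be dropped. Only then can the exchange be applied.
      have h2 : signedSq (increment g i w)
          * (steinOsc z (ustat g (resample i w)) - steinOsc z (ustat g w.1))
          = |increment g i w| * (|increment g i w|
            * |steinOsc z (ustat g (resample i w)) - steinOsc z (ustat g w.1)|) := by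
        have hmono := monotone_steinOsc z
        rcases le_total (ustat g w.1) (ustat g (resample i w)) with hle | hle
        · have h0 : 0 ≤ increment g i w := sub_nonneg.2 hle
          rw [signedSq, abs_of_nonneg h0, abs_of_nonneg (sub_nonneg.2 (hmono hle))]
          ring
        · have h0 : increment g i w ≤ 0 := sub_nonpos.2 hle
          rw [signedSq, abs_of_nonpos h0, abs_of_nonpos (sub_nonpos.2 (hmono hle))]
          ring
      rw [h2]
      calc _ = |increment g i w| * |steinSol z (ustat g (resample i w)) - steinSol z (ustat g w.1)
            - increment g i w * steinDeriv z (ustat g w.1)| := by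
            rw [← abs_mul]
            congr 1
            ring
        _ ≤ _ := mul_le_mul_of_nonneg_left h (abs_nonneg _)
    have hY : ∀ i, Integrable (fun x => (∫ y, signedSq (increment g i (x, y)) ∂π)
        * (steinOsc z (ustat g x) - (stdCdf z - 1))) π := fun i =>
      ((memLp_integral_fiber (hg.measurable_signedSq_increment i)
        (hg.memLp_signedSq_increment i)).integrable one_le_two).mul_bdd (c := 1)
        (hom.sub measurable_const).aestronglyMeasurable
        (Eventually.of_forall fun x => abs_steinOsc_sub_le z _)
    calc _ ≤ ∑ i, ∫ w, signedSq (increment g i w)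
          * (steinOsc z (ustat g (resample i w)) - steinOsc z (ustat g w.1)) ∂(twoCopies ν) := by
          refine (Finset.abs_sum_le_sum_abs _ _).trans (Finset.sum_le_sum fun i _ => ?_)
          rw [← integral_sub (hi1 i) (hi2 i)]
          refine abs_integral_le_integral_abs.trans (integral_mono ((hi1 i).sub (hi2 i)).abs (hi3 i)
            (hpt i))
      _ = -2 * ∫ x, signedEnergy ν g x * (steinOsc z (ustat g x) - (stdCdf z - 1)) ∂π := by
          simp only [hg.integral_signedSq_increment_mul, signedEnergy, Finset.sum_mul]
          rw [integral_finsetSum _ fun i _ => hY i, Finset.mul_sum]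
      _ ≤ 2 * |∫ x, signedEnergy ν g x * (steinOsc z (ustat g x) - (stdCdf z - 1)) ∂π| := by
          linarith [neg_abs_le (∫ x, signedEnergy ν g x
            * (steinOsc z (ustat g x) - (stdCdf z - 1)) ∂π)]
      _ ≤ 2 * ∫ x, |signedEnergy ν g x| ∂π := by
          gcongr
          refine abs_integral_le_integral_abs.trans (integral_mono_of_nonneg
            (Eventually.of_forall fun x => abs_nonneg _)
            (hg.memLp_signedEnergy.integrable one_le_two).abs (Eventually.of_forall fun x => ?_))
          simp only [abs_mul]
          exact mul_le_of_le_one_right (abs_nonneg _) (abs_steinOsc_sub_le z _)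
  have hmain : |∫ x, (2 * p - energy ν g x) * steinDeriv z (ustat g x) ∂π|
      ≤ ∫ x, |2 * p - energy ν g x| ∂π := by
    refine abs_integral_le_integral_abs.trans (integral_mono_of_nonneg
      (Eventually.of_forall fun x => abs_nonneg _)
      ((integrable_const _).sub (hg.memLp_energy.integrable one_le_two)).abs
      (Eventually.of_forall fun x => ?_))
    simp only [abs_mul]
    exact mul_le_of_le_one_right (abs_nonneg _) (abs_steinDeriv_le z _)
  have hsplit : ∫ x, (2 * p - energy ν g x) * steinDeriv z (ustat g x) ∂π
      = 2 * p * ∫ x, steinDeriv z (ustat g x) ∂π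
        - ∫ x, energy ν g x * steinDeriv z (ustat g x) ∂π := by
    simp only [sub_mul]
    rw [integral_sub (hdint.const_mul _), integral_const_mul]
    exact (hg.memLp_energy.integrable one_le_two).mul_bdd (c := 1) hdm.aestronglyMeasurable
      (Eventually.of_forall fun x => abs_steinDeriv_le z _)
  rw [hsplit] at hmain
  have hfinal : |2 * p * (π.real {x | ustat g x ≤ z} - stdCdf z)|
      ≤ ∫ x, |2 * p - energy ν g x| ∂π + 2 * ∫ x, |signedEnergy ν g x| ∂π := by
    rw [hcdf]
    rw [abs_le] at *
    constructor <;> linarith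
  rw [abs_mul, abs_of_pos (by positivity : (0 : ℝ) < 2 * p), mul_comm, ← le_div_iff₀
    (by positivity)] at hfinal
  refine hfinal.trans_eq ?_
  field_simp

end IsKernelFamily
end Kernels

/-! ### Hoeffding components of the square and the fourth moment. -/

section Kernels

variable {ι : Type*} [Fintype ι] [DecidableEq ι] {E : ι → Type*} [∀ i, MeasurableSpace (E i)]
  {ν : ∀ i, Measure (E i)} [∀ i, IsProbabilityMeasure (ν i)] {p : ℕ}
  {g : Finset ι → (∀ i, E i) → ℝ}

variable (ν g) in
/-- The squared `L²` norm of a Hoeffding component of the square of the U-statistic. -/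
def squareEnergy (M : Finset ι) : ℝ :=
  ∫ x, hoeffding ν M (fun x => ustat g x ^ 2) x ^ 2 ∂(Measure.pi ν)

lemma squareEnergy_nonneg (M : Finset ι) : 0 ≤ squareEnergy ν g M :=
  integral_nonneg fun _ => sq_nonneg _

namespace IsKernelFamily

variable (hg : IsKernelFamily ν p g)
include hg

lemma dependsOn_mul (J K : Finset ι) :
    DependsOn (fun x => g J x * g K x) ((J ∪ K : Finset ι) : Set ι) := fun x y h => by
  have h1 : g J x = g J y := hg.dependsOn J fun i hi => h i (by simp [Finset.mem_coe.1 hi])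
  have h2 : g K x = g K y := hg.dependsOn K fun i hi => h i (by simp [Finset.mem_coe.1 hi])
  simp only [h1, h2]

lemma integrable_mul (J K : Finset ι) : Integrable (fun x => g J x * g K x) (Measure.pi ν) :=
  (memLp_two_mul (hg.memLp J) (hg.memLp K)).integrable one_le_two

lemma sum_ustat_sub_avg :
    ∀ᵐ x ∂(Measure.pi ν), ∑ i, (ustat g x - avg ν {i}ᶜ (ustat g) x) = p * ustat g x := by
  have h1 : ∀ᵐ x ∂(Measure.pi ν), ∀ i, avg ν {i}ᶜ (ustat g) x = ∑ J, avg ν {i}ᶜ (g J) x :=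
    ae_all_iff.2 fun i => avg_finset_sum ν {i}ᶜ Finset.univ fun J _ =>
      (hg.memLp J).integrable (by norm_num)
  have h2 : ∀ᵐ x ∂(Measure.pi ν), ∀ i, ∀ J : Finset ι, i ∈ J → avg ν {i}ᶜ (g J) x = 0 := by
    refine ae_all_iff.2 fun i => ae_all_iff.2 fun J => ?_
    by_cases hi : i ∈ J
    · filter_upwards [hg.avg_eq_zero J {i}ᶜ fun h => by simpa using h hi] with x hx _ using hx
    · exact Eventually.of_forall fun x h => absurd h hi
  filter_upwards [h1, h2] with x hx1 hx2
  have h3 : ∀ i, ustat g x - avg ν {i}ᶜ (ustat g) x = ∑ J, if i ∈ J then g J x else 0 :=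
    fun i => by
    rw [hx1, ustat, ← Finset.sum_sub_distrib]
    refine Finset.sum_congr rfl fun J _ => ?_
    split_ifs with hi
    · rw [hx2 i J hi, sub_zero]
    · rw [avg_of_dependsOn ν fun x y h => hg.dependsOn J fun k hk => h k (by
        have : k ≠ i := fun hki => hi (hki ▸ Finset.mem_coe.1 hk)
        simpa using this), sub_self]
  simp only [h3]
  rw [Finset.sum_comm, ustat, Finset.mul_sum]
  refine Finset.sum_congr rfl fun J _ => ?_
  rw [← Finset.sum_filter, Finset.sum_const, Finset.filter_univ_mem, nsmul_eq_mul, hg.card_mul]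

/-- The conditional energy is a linear function of the number operator applied to the square. -/
lemma energy_eq_sum_hoeffding :
    energy ν g =ᵐ[Measure.pi ν]
      fun x => ∑ M : Finset ι, (2 * p - M.card : ℝ) * hoeffding ν M (fun x => ustat g x ^ 2) x := by
  have hW := hg.memLp_ustat
  have i1 : ∀ᵐ x ∂(Measure.pi ν), ∀ i, Integrable (fun y => ustat g (resample i (x, y)))
      (Measure.pi ν) := ae_all_iff.2 fun i =>
    ae_integrable_mix ν {i}ᶜ (hW.integrable (by norm_num))
  have i2 : ∀ᵐ x ∂(Measure.pi ν), ∀ i, Integrable (fun y => ustat g (resample i (x, y)) ^ 2)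
      (Measure.pi ν) := ae_all_iff.2 fun i =>
    ae_integrable_mix ν {i}ᶜ ((memLp_two_sq hW).integrable one_le_two)
  filter_upwards [i1, i2, hg.sum_ustat_sub_avg] with x h1 h2 h3
  -- From `(b - a)² = 2a(a - b) - (a² - b²)`. Summed over `i`, the first part gives `2p W²` and the
  -- second the number operator applied to `W²`.
  have h4 : ∀ i, ∫ y, increment g i (x, y) ^ 2 ∂(Measure.pi ν)
      = 2 * ustat g x * (ustat g x - avg ν {i}ᶜ (ustat g) x)
        - (ustat g x ^ 2 - avg ν {i}ᶜ (fun x => ustat g x ^ 2) x) := fun i => by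
    have e : ∀ y, increment g i (x, y) ^ 2 = ustat g (resample i (x, y)) ^ 2
        - (2 * ustat g x * ustat g (resample i (x, y)) - ustat g x ^ 2) := fun y => by
      simp only [increment]
      ring
    simp only [e]
    rw [integral_sub (h2 i) (by exact ((h1 i).const_mul _).sub (integrable_const _)),
      integral_sub ((h1 i).const_mul _) (integrable_const _), integral_const_mul]
    simp only [avg, integral_const, probReal_univ, one_smul]
    ring
  simp only [energy, h4, Finset.sum_sub_distrib (f := fun i => 2 * ustat g x * _), sub_mul,
    Finset.sum_sub_distrib (f := fun M : Finset ι => 2 * (p : ℝ) * _)]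
  rw [sum_sub_avg_compl ν (fun x => ustat g x ^ 2) x, ← Finset.mul_sum, h3, ← Finset.mul_sum,
    sum_univ_hoeffding]
  ring

lemma hoeffding_sq_eq_sum (M : Finset ι) :
    hoeffding ν M (fun x => ustat g x ^ 2) =ᵐ[Measure.pi ν]
      fun x => ∑ JK : Finset ι × Finset ι, hoeffding ν M (fun x => g JK.1 x * g JK.2 x) x := by
  have h := hoeffding_finset_sum ν M (Finset.univ : Finset (Finset ι × Finset ι))
    (F := fun JK x => g JK.1 x * g JK.2 x) fun JK _ => hg.integrable_mul JK.1 JK.2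
  have e : (fun x => ustat g x ^ 2)
      = fun x => ∑ JK : Finset ι × Finset ι, g JK.1 x * g JK.2 x := by
    funext x
    rw [ustat, sq, Finset.sum_mul_sum, Fintype.sum_prod_type]
  rw [e]
  exact h

/-- The product depends only on `J ∪ K`, of size at most `2p`. A set `M ⊆ J ∪ K` with `|M| ≥ 2p`
forces `M = J ∪ K` with `J`, `K` disjoint, the excluded case. -/
lemma hoeffding_mul_eq_zero {J K M : Finset ι} (h : M = J ∪ K → ¬ Disjoint J K)
    (hM : 2 * p ≤ M.card) (x : ∀ i, E i) : hoeffding ν M (fun x => g J x * g K x) x = 0 := by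
  have hz : ∀ {F : (∀ i, E i) → ℝ}, (∀ x, F x = 0) → hoeffding ν M F x = 0 := fun hF => by
    simp [hoeffding, mob, avg, hF]
  by_cases hJ : J.card = p
  swap
  · exact hz fun x => by simp [hg.eq_zero J hJ]
  by_cases hK : K.card = p
  swap
  · exact hz fun x => by simp [hg.eq_zero K hK]
  by_cases hMJ : M ⊆ J ∪ K
  · have h1 := Finset.card_union_add_card_inter J K
    have h2 := Finset.card_le_card hMJ
    have h3 : M = J ∪ K := Finset.eq_of_subset_of_card_le hMJ (by omega)
    refine absurd ?_ (h h3)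
    rw [Finset.disjoint_iff_inter_eq_empty, ← Finset.card_eq_zero]
    omega
  · exact hoeffding_of_dependsOn ν (hg.dependsOn_mul J K) hMJ x

/-- Average first over one coordinate of `J ∪ K` outside `A`: it enters only one of the two kernels,
and that kernel averages to zero. -/
lemma avg_mul_eq_zero {J K A : Finset ι} (hJK : Disjoint J K) (h : ¬ J ∪ K ⊆ A) :
    avg ν A (fun x => g J x * g K x) =ᵐ[Measure.pi ν] 0 := by
  have key : ∀ J K : Finset ι, Disjoint J K → ¬ J ⊆ A →
      avg ν A (fun x => g J x * g K x) =ᵐ[Measure.pi ν] 0 := by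
    intro J K hJK hJ
    obtain ⟨i, hiJ, hiA⟩ := Finset.not_subset.1 hJ
    have h1 := avg_avg ν A {i}ᶜ (hg.integrable_mul J K)
    rw [Finset.inter_eq_left.2 (Finset.subset_compl_singleton.2 hiA)] at h1
    have h2 : avg ν {i}ᶜ (fun x => g J x * g K x) =ᵐ[Measure.pi ν] fun _ => 0 := by
      filter_upwards [hg.avg_eq_zero J {i}ᶜ fun h => by simpa using h hiJ] with x hx
      have hdep : DependsOn (g K) (({i}ᶜ : Finset ι) : Set ι) := fun x y hxy =>
        hg.dependsOn K fun k hk => hxy k (by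
          have : k ≠ i := fun hki =>
            Finset.disjoint_left.1 hJK hiJ (hki ▸ Finset.mem_coe.1 hk)
          simpa using this)
      have := avg_mul_of_dependsOn ν hdep (g J) x
      simp only [mul_comm (g J _)]
      rw [this, hx]
      simp
    filter_upwards [h1, avg_congr_ae ν A h2] with x hx1 hx2
    rw [← hx1, hx2]
    simp [avg]
  rcases not_and_or.1 (mt (fun hh : J ⊆ A ∧ K ⊆ A => Finset.union_subset hh.1 hh.2) h) with h | h
  · exact key J K hJK h
  · simpa only [mul_comm (g J _)] using key K J hJK.symm h

lemma hoeffding_mul_of_disjoint {J K : Finset ι} (hJK : Disjoint J K) :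
    hoeffding ν (J ∪ K) (fun x => g J x * g K x) =ᵐ[Measure.pi ν] fun x => g J x * g K x := by
  have h : ∀ᵐ x ∂(Measure.pi ν), ∀ A : Finset ι, ¬ J ∪ K ⊆ A →
      avg ν A (fun x => g J x * g K x) x = 0 := by
    refine ae_all_iff.2 fun A => ?_
    by_cases hA : J ∪ K ⊆ A
    · exact Eventually.of_forall fun x hx => absurd hA hx
    · filter_upwards [hg.avg_mul_eq_zero hJK hA] with x hx _ using hx
  filter_upwards [h] with x hx
  rw [hoeffding, mob, Finset.sum_eq_single_of_mem (J ∪ K) (Finset.mem_powerset_self _),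
    avg_of_dependsOn ν (hg.dependsOn_mul J K)]
  · rw [← two_mul, pow_mul]
    simp
  · intro A hA hne
    rw [hx A fun hh => hne (Finset.Subset.antisymm (Finset.mem_powerset.1 hA) hh), mul_zero]

lemma squareEnergy_eq_zero {M : Finset ι} (hM : 2 * p < M.card) : squareEnergy ν g M = 0 := by
  refine integral_eq_zero_of_ae ?_
  filter_upwards [hg.hoeffding_sq_eq_sum M] with x hx
  rw [hx, Finset.sum_eq_zero]
  · simp
  rintro ⟨J, K⟩ _
  by_cases hJ : J.card = p
  swap
  · simp [hoeffding, mob, avg, hg.eq_zero J hJ]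
  by_cases hK : K.card = p
  swap
  · simp [hoeffding, mob, avg, hg.eq_zero K hK]
  refine hg.hoeffding_mul_eq_zero (fun h => ?_) hM.le x
  have := Finset.card_union_le J K
  simp only at h
  rw [h] at hM
  omega

/-- The top-order Hoeffding component of the square of the U-statistic. -/
lemma squareEnergy_of_card_eq {M : Finset ι} (hM : M.card = 2 * p) :
    squareEnergy ν g M = ∫ x, (∑ JK : Finset ι × Finset ι with Disjoint JK.1 JK.2 ∧
      JK.1 ∪ JK.2 = M, g JK.1 x * g JK.2 x) ^ 2 ∂(Measure.pi ν) := by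
  refine integral_congr_ae ?_
  have h : ∀ᵐ x ∂(Measure.pi ν), ∀ J K : Finset ι, Disjoint J K → J ∪ K = M →
      hoeffding ν M (fun x => g J x * g K x) x = g J x * g K x := by
    refine ae_all_iff.2 fun J => ae_all_iff.2 fun K => ?_
    by_cases hJK : Disjoint J K ∧ J ∪ K = M
    · obtain ⟨hJK, rfl⟩ := hJK
      filter_upwards [hg.hoeffding_mul_of_disjoint hJK] with x hx _ _ using hx
    · exact Eventually.of_forall fun x h1 h2 => absurd ⟨h1, h2⟩ hJK
  filter_upwards [hg.hoeffding_sq_eq_sum M, h] with x hx1 hx2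
  rw [hx1, Finset.sum_filter]
  congr 1
  refine Finset.sum_congr rfl fun JK _ => ?_
  split_ifs with hJK
  · exact hx2 _ _ hJK.1 hJK.2
  · exact hg.hoeffding_mul_eq_zero (fun hh hd => hJK ⟨hd, hh.symm⟩) hM.ge x

lemma memLp_sq : MemLp (fun x => ustat g x ^ 2) 2 (Measure.pi ν) := memLp_two_sq hg.memLp_ustat

lemma measurable_sq : Measurable fun x => ustat g x ^ 2 := hg.measurable_ustat.pow_const 2

lemma sum_squareEnergy :
    ∑ M, squareEnergy ν g M = ∫ x, ustat g x ^ 4 ∂(Measure.pi ν) := by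
  have h := integral_sum_hoeffding_mul ν hg.memLp_sq hg.measurable_sq (fun _ => 1) fun _ => 1
  simp only [one_mul, sum_univ_hoeffding] at h
  rw [show (∑ M, squareEnergy ν g M) = _ from h.symm]
  congr 1
  funext x
  ring

/-- The left side is the Dirichlet form of `W²`, twice its inner product with its image under the
number operator, which is diagonal on Hoeffding components. -/
lemma sum_card_mul_squareEnergy :
    ∑ i, ∫ z, (ustat g (resample i z) ^ 2 - ustat g z.1 ^ 2) ^ 2 ∂(twoCopies ν)
      = 2 * ∑ M : Finset ι, (M.card : ℝ) * squareEnergy ν g M := by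
  set F : (∀ i, E i) → ℝ := fun x => ustat g x ^ 2 with hF
  have hF2 : MemLp F 2 (Measure.pi ν) := hg.memLp_sq
  have h1 : ∀ i, ∫ z, (F (resample i z) - F z.1) ^ 2 ∂(twoCopies ν)
      = 2 * ∫ x, F x * (F x - avg ν {i}ᶜ F x) ∂(Measure.pi ν) := fun i => by
    have i0 : Integrable (fun x => F x * F x) (Measure.pi ν) := hF2.integrable_mul hF2
    have i1 : Integrable (fun z => F (resample i z) * F z.1) (twoCopies ν) :=
      (memLp_mix ν {i}ᶜ hF2).integrable_mul
        (hF2.comp_measurePreserving measurePreserving_fst)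
    have i2 : Integrable (fun x => F x * avg ν {i}ᶜ F x) (Measure.pi ν) :=
      hF2.integrable_mul (memLp_avg ν _ hF2 hg.measurable_sq)
    have := integral_resample_sub_mul_sub i i0 i1
    simp only [sq (F _ - F _)]
    rw [this]
    simp only [mul_sub (F _)]
    rw [integral_sub i0 i2, integral_mul_avg ν _ hF2 hF2, integral_avg_mul ν _ hF2 hF2]
  have h2 := integral_sum_hoeffding_mul ν hF2 hg.measurable_sq (fun _ => 1) fun M => (M.card : ℝ)
  simp only [one_mul, sum_univ_hoeffding, ← sum_sub_avg_compl] at h2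
  change ∑ i, ∫ z, (F (resample i z) - F z.1) ^ 2 ∂(twoCopies ν) = _
  simp only [h1]
  rw [← Finset.mul_sum, show (∑ M : Finset ι, (M.card : ℝ) * squareEnergy ν g M) = _ from h2.symm]
  have h3 : ∀ x, F x * ∑ i, (F x - avg ν {i}ᶜ F x) = ∑ i, F x * (F x - avg ν {i}ᶜ F x) :=
    fun x => Finset.mul_sum _ _ _
  simp only [h3]
  rw [integral_finsetSum]
  intro i _
  exact hF2.integrable_mul (hF2.sub (memLp_avg ν _ hF2 hg.measurable_sq))

/-- The contribution of the intermediate Hoeffding components to the fourth moment. -/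
lemma integral_pow_four_eq (hp : 0 < p) (hvar : ∫ x, ustat g x ^ 2 ∂(Measure.pi ν) = 1) :
    ∫ x, ustat g x ^ 4 ∂(Measure.pi ν)
      = 1 + (∑ M : Finset ι with M.card ≠ 0 ∧ M.card < 2 * p, squareEnergy ν g M)
        + ∑ M : Finset ι with M.card = 2 * p, squareEnergy ν g M := by
  rw [← hg.sum_squareEnergy, ← Finset.add_sum_erase _ _ (Finset.mem_univ ∅)]
  have h1 : squareEnergy ν g ∅ = 1 := by
    simp [squareEnergy, hoeffding_empty, hvar]
  rw [h1, add_assoc, ← Finset.sum_union]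
  · congr 1
    symm
    refine Finset.sum_subset_zero_on_sdiff (fun M hM => ?_) (fun M hM => ?_) fun _ _ => rfl
    · simp only [Finset.mem_union, Finset.mem_filter_univ] at hM
      simp only [Finset.mem_erase, Finset.mem_univ, and_true]
      rintro rfl
      simp only [Finset.card_empty] at hM
      omega
    · simp only [Finset.mem_sdiff, Finset.mem_erase, Finset.mem_univ, and_true, Finset.mem_union,
        Finset.mem_filter_univ, ← Finset.card_eq_zero, Ne] at hM
      exact hg.squareEnergy_eq_zero (by omega)
  · refine Finset.disjoint_filter.2 fun M _ h => ?_
    omega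

/-- In `energy_eq_sum_hoeffding` the constant component cancels `2p`, the weight `2p - |M|` vanishes
at `|M| = 2p`, larger components are zero, and the remaining weights are at most `2p`. -/
lemma integral_energy_sub_sq_le (hvar : ∫ x, ustat g x ^ 2 ∂(Measure.pi ν) = 1) :
    ∫ x, (2 * p - energy ν g x) ^ 2 ∂(Measure.pi ν)
      ≤ (2 * p) ^ 2 * ∑ M : Finset ι with M.card ≠ 0 ∧ M.card < 2 * p, squareEnergy ν g M := by
  set c : Finset ι → ℝ := fun M => if M = ∅ then 0 else (2 * p - M.card : ℝ) with hc
  have h1 : (fun x => (2 * p - energy ν g x) ^ 2) =ᵐ[Measure.pi ν] fun x =>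
      (∑ M, c M * hoeffding ν M (fun x => ustat g x ^ 2) x)
        * ∑ M, c M * hoeffding ν M (fun x => ustat g x ^ 2) x := by
    filter_upwards [hg.energy_eq_sum_hoeffding] with x hx
    rw [hx, ← Finset.add_sum_erase _ _ (Finset.mem_univ ∅),
      ← Finset.add_sum_erase Finset.univ (fun M => c M * _) (Finset.mem_univ ∅)]
    have e : ∀ M ∈ Finset.univ.erase (∅ : Finset ι),
        c M * hoeffding ν M (fun x => ustat g x ^ 2) x
        = (2 * p - M.card : ℝ) * hoeffding ν M (fun x => ustat g x ^ 2) x := fun M hM => by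
      simp [hc, Finset.ne_of_mem_erase hM]
    rw [Finset.sum_congr rfl e, hoeffding_empty, hvar]
    simp only [hc, if_true, Finset.card_empty, Nat.cast_zero]
    ring
  rw [integral_congr_ae h1, integral_sum_hoeffding_mul ν hg.memLp_sq hg.measurable_sq,
    Finset.sum_filter, Finset.mul_sum]
  refine Finset.sum_le_sum fun M _ => ?_
  change c M * c M * squareEnergy ν g M ≤ _
  have h0 := squareEnergy_nonneg (ν := ν) (g := g) M
  by_cases hM : M = ∅
  · simp [hM, hc]
  have hM' : M.card ≠ 0 := by simpa using hM
  simp only [hc, hM, if_false]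
  rcases lt_trichotomy M.card (2 * p) with h | h | h
  · rw [if_pos ⟨hM', h⟩]
    refine mul_le_mul_of_nonneg_right ?_ h0
    have h3 : (M.card : ℝ) ≤ 2 * p := by exact_mod_cast h.le
    have h4 : (0 : ℝ) ≤ M.card := Nat.cast_nonneg _
    nlinarith
  · simp [h]
  · simp [hg.squareEnergy_eq_zero h]

/-- In `sum_integral_increment_pow_four` only the top components are kept in the subtracted term,
where they carry the weight `|M| = 2p`. -/
lemma sum_increment_pow_four_le (hp : 0 < p) (hvar : ∫ x, ustat g x ^ 2 ∂(Measure.pi ν) = 1) :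
    ∑ i, ∫ z, increment g i z ^ 4 ∂(twoCopies ν)
      ≤ 4 * p * (2 * (∑ M : Finset ι with M.card ≠ 0 ∧ M.card < 2 * p, squareEnergy ν g M)
        + 2 - ∑ M : Finset ι with M.card = 2 * p, squareEnergy ν g M) := by
  have h1 := hg.sum_integral_increment_pow_four
  rw [hg.sum_card_mul_squareEnergy, hg.integral_pow_four_eq hp hvar] at h1
  have h2 : 2 * p * ∑ M : Finset ι with M.card = 2 * p, squareEnergy ν g M
      ≤ ∑ M : Finset ι, (M.card : ℝ) * squareEnergy ν g M := by
    rw [Finset.mul_sum, Finset.sum_filter]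
    refine Finset.sum_le_sum fun M _ => ?_
    split_ifs with h
    · rw [h]
      push_cast
      rfl
    · exact mul_nonneg (Nat.cast_nonneg _) (squareEnergy_nonneg M)
  change (1 / 4 : ℝ) * (∑ i, ∫ z, increment g i z ^ 4 ∂(twoCopies ν)) = _ at h1
  linarith

/-- The Berry-Esseen bound in terms of a lower bound on the top Hoeffding components of the
square. -/
lemma abs_cdf_sub_le_of_top (hp : 0 < p) (hvar : ∫ x, ustat g x ^ 2 ∂(Measure.pi ν) = 1)
    {δ : ℝ} (hδ : 0 ≤ δ)
    (htop : 2 - δ ≤ ∑ M : Finset ι with M.card = 2 * p, squareEnergy ν g M) (z : ℝ) :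
    |(Measure.pi ν).real {x | ustat g x ≤ z} - stdCdf z|
      ≤ 5 * √|(∫ x, ustat g x ^ 4 ∂(Measure.pi ν)) - 3| + 6 * √δ := by
  have hp' : (0 : ℝ) < p := by exact_mod_cast hp
  set η := |(∫ x, ustat g x ^ 4 ∂(Measure.pi ν)) - 3| with hη
  have hη0 : 0 ≤ η := abs_nonneg _
  have h4 := hg.integral_pow_four_eq hp hvar
  set low := ∑ M : Finset ι with M.card ≠ 0 ∧ M.card < 2 * p, squareEnergy ν g M
  set top := ∑ M : Finset ι with M.card = 2 * p, squareEnergy ν g M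
  have hlow : low ≤ η + δ := by
    have := le_abs_self ((∫ x, ustat g x ^ 4 ∂(Measure.pi ν)) - 3)
    linarith
  have hE : 1 / (2 * p) * ∫ x, |2 * p - energy ν g x| ∂(Measure.pi ν) ≤ √η + √δ := by
    have h1 : ∫ x, |2 * p - energy ν g x| ∂(Measure.pi ν) ≤ √((2 * p) ^ 2 * (√η + √δ) ^ 2) := by
      refine (integral_abs_le_sqrt ((memLp_const _).sub hg.memLp_energy)).trans
        (Real.sqrt_le_sqrt ?_)
      refine (hg.integral_energy_sub_sq_le hvar).trans ?_
      refine mul_le_mul_of_nonneg_left ?_ (by positivity)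
      have := Real.sq_sqrt hη0
      have := Real.sq_sqrt hδ
      nlinarith [mul_nonneg (Real.sqrt_nonneg η) (Real.sqrt_nonneg δ)]
    rw [← mul_pow, Real.sqrt_sq (by positivity)] at h1
    rw [one_div, inv_mul_le_iff₀ (by positivity)]
    exact h1
  -- The second moment is at most `2p · 4p (2η + 3δ) = p² (16η + 24δ)`, and `24` is rounded up to
  -- `5²`.
  have hS : 1 / p * ∫ x, |signedEnergy ν g x| ∂(Measure.pi ν) ≤ 4 * √η + 5 * √δ := by
    have h1 : ∫ x, |signedEnergy ν g x| ∂(Measure.pi ν) ≤ √(p ^ 2 * (4 * √η + 5 * √δ) ^ 2) := by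
      refine (integral_abs_le_sqrt hg.memLp_signedEnergy).trans (Real.sqrt_le_sqrt ?_)
      refine hg.integral_signedEnergy_sq_le.trans ?_
      have h2 := hg.sum_increment_pow_four_le hp hvar
      have h3 : 4 * p * (2 * low + 2 - top) ≤ 4 * p * (2 * η + 3 * δ) :=
        mul_le_mul_of_nonneg_left (by linarith) (by positivity)
      calc _ ≤ 2 * p * (4 * p * (2 * η + 3 * δ)) :=
            mul_le_mul_of_nonneg_left (h2.trans h3) (by positivity)
        _ = p ^ 2 * (16 * η + 24 * δ) := by ring
        _ ≤ _ := by
            refine mul_le_mul_of_nonneg_left ?_ (by positivity)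
            have := Real.sq_sqrt hη0
            have := Real.sq_sqrt hδ
            nlinarith [mul_nonneg (Real.sqrt_nonneg η) (Real.sqrt_nonneg δ)]
    rw [← mul_pow, Real.sqrt_sq (by positivity)] at h1
    rw [one_div, inv_mul_le_iff₀ (by positivity)]
    exact h1
  have := hg.abs_cdf_sub_le hp z
  linarith

end IsKernelFamily
end Kernels

/-! ### Combinatorics of disjoint and overlapping index sets. -/

section Reindex
variable {ι : Type*} [Fintype ι] [DecidableEq ι]

variable (ι) in
/-- Quadruples `((A, D), (B, C))` of pairwise disjoint sets. -/
def disjointQuadruples : Finset ((Finset ι × Finset ι) × (Finset ι × Finset ι)) :=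
  {t | Disjoint t.1.1 t.1.2 ∧ (Disjoint t.2.1 (t.1.1 ∪ t.1.2) ∧ Disjoint t.2.2 (t.1.1 ∪ t.1.2)) ∧
    Disjoint t.2.1 t.2.2}

/-- Two ways of splitting a set in two parts correspond to a way of splitting it in four parts. -/
lemma sum_pairs_eq_sum_disjointQuadruples (f : Finset ι × Finset ι → Finset ι × Finset ι → ℝ) :
    ∑ M : Finset ι, ∑ a : Finset ι × Finset ι with Disjoint a.1 a.2 ∧ a.1 ∪ a.2 = M,
      ∑ b : Finset ι × Finset ι with Disjoint b.1 b.2 ∧ b.1 ∪ b.2 = M, f a b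
    = ∑ t ∈ disjointQuadruples ι,
      f (t.1.1 ∪ t.2.1, t.2.2 ∪ t.1.2) (t.1.1 ∪ t.2.2, t.2.1 ∪ t.1.2) := by
  simp only [← Finset.sum_product']
  rw [Finset.sum_sigma']
  -- For `M = a₁ ⊔ a₂ = b₁ ⊔ b₂` the four parts are `A = a₁ ∩ b₁`, `D = a₂ ∩ b₂`, `B = a₁ ∩ b₂`, `C
  -- = a₂ ∩ b₁`.
  refine Finset.sum_nbij'
    (fun q => ((q.2.1.1 ∩ q.2.2.1, q.2.1.2 ∩ q.2.2.2), (q.2.1.1 ∩ q.2.2.2, q.2.1.2 ∩ q.2.2.1)))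
    (fun t => ⟨t.1.1 ∪ t.1.2 ∪ (t.2.1 ∪ t.2.2),
      ((t.1.1 ∪ t.2.1, t.2.2 ∪ t.1.2), (t.1.1 ∪ t.2.2, t.2.1 ∪ t.1.2))⟩) ?_ ?_ ?_ ?_ ?_
  · rintro ⟨M, ⟨a1, a2⟩, ⟨b1, b2⟩⟩ h
    simp only [Finset.mem_sigma, Finset.mem_univ, true_and, Finset.mem_product,
      Finset.mem_filter_univ, disjointQuadruples, Finset.disjoint_left, Finset.ext_iff,
      Finset.mem_union, Finset.mem_inter] at h ⊢
    grind
  · rintro ⟨⟨A, D⟩, ⟨B, C⟩⟩ h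
    simp only [Finset.mem_sigma, Finset.mem_univ, true_and, Finset.mem_product,
      Finset.mem_filter_univ, disjointQuadruples, Finset.disjoint_left, Finset.ext_iff,
      Finset.mem_union] at h ⊢
    grind
  · rintro ⟨M, ⟨a1, a2⟩, ⟨b1, b2⟩⟩ h
    simp only [Finset.mem_sigma, Finset.mem_univ, true_and, Finset.mem_product,
      Finset.mem_filter_univ, Finset.disjoint_left, Finset.ext_iff, Finset.mem_union] at h
    have h1 : a1 ∩ b1 ∪ a1 ∩ b2 = a1 := by grind
    have h2 : a2 ∩ b1 ∪ a2 ∩ b2 = a2 := by grind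
    have h3 : a1 ∩ b1 ∪ a2 ∩ b1 = b1 := by grind
    have h4 : a1 ∩ b2 ∪ a2 ∩ b2 = b2 := by grind
    have h5 : a1 ∩ b1 ∪ a2 ∩ b2 ∪ (a1 ∩ b2 ∪ a2 ∩ b1) = M := by grind
    simp only [h1, h2, h3, h4, h5]
  · rintro ⟨⟨A, D⟩, ⟨B, C⟩⟩ h
    simp only [Finset.mem_filter_univ, disjointQuadruples, Finset.disjoint_left,
      Finset.mem_union] at h
    have h1 : (A ∪ B) ∩ (A ∪ C) = A := by grind
    have h2 : (C ∪ D) ∩ (B ∪ D) = D := by grind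
    have h3 : (A ∪ B) ∩ (B ∪ D) = B := by grind
    have h4 : (C ∪ D) ∩ (A ∪ C) = C := by grind
    simp only [h1, h2, h3, h4]
  · rintro ⟨M, ⟨a1, a2⟩, ⟨b1, b2⟩⟩ h
    simp only [Finset.mem_sigma, Finset.mem_univ, true_and, Finset.mem_product,
      Finset.mem_filter_univ, Finset.disjoint_left, Finset.ext_iff, Finset.mem_union] at h
    have h1 : a1 ∩ b1 ∪ a1 ∩ b2 = a1 := by grind
    have h2 : a2 ∩ b1 ∪ a2 ∩ b2 = a2 := by grind
    have h3 : a1 ∩ b1 ∪ a2 ∩ b1 = b1 := by grind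
    have h4 : a1 ∩ b2 ∪ a2 ∩ b2 = b2 := by grind
    simp only [h1, h2, h3, h4]

/-- Counting: overlapping quadruples are controlled by overlapping pairs. -/
lemma sum_overlapping_le {s : Finset ι → ℝ} (hs : ∀ J, 0 ≤ s J) {p : ℕ}
    (hp : ∀ J, J.card ≠ p → s J = 0) :
    ∑ t : (Finset ι × Finset ι) × (Finset ι × Finset ι) with
        (Disjoint t.2.1 (t.1.1 ∪ t.1.2) ∧ Disjoint t.2.2 (t.1.1 ∪ t.1.2)) ∧
        ¬ Disjoint t.2.1 t.2.2, s (t.1.1 ∪ t.2.1) * s (t.2.2 ∪ t.1.2)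
      ≤ 4 ^ p * ∑ a : Finset ι × Finset ι with ¬ Disjoint a.1 a.2, s a.1 * s a.2 := by
  -- With `J = A ∪ B` and `K = C ∪ D`, the quadruple is recovered from `J, K, A, D`, and `J`, `K`
  -- overlap because `B`, `C` do. Each pair `(J, K)` of sets of size `p` admits `2^p · 2^p` choices
  -- of `A ⊆ J`, `D ⊆ K`.
  set e : (Finset ι × Finset ι) × (Finset ι × Finset ι) →
      (Finset ι × Finset ι) × (Finset ι × Finset ι) := fun t =>
    ((t.1.1 ∪ t.2.1, t.2.2 ∪ t.1.2), (t.1.1, t.1.2)) with he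
  set f : (Finset ι × Finset ι) × (Finset ι × Finset ι) → ℝ := fun u => s u.1.1 * s u.1.2 with hf
  have hinj : Set.InjOn e (({t | (Disjoint t.2.1 (t.1.1 ∪ t.1.2) ∧
      Disjoint t.2.2 (t.1.1 ∪ t.1.2)) ∧ ¬ Disjoint t.2.1 t.2.2} :
        Finset ((Finset ι × Finset ι) × (Finset ι × Finset ι))) : Set _) := by
    rintro ⟨⟨A, D⟩, ⟨B, C⟩⟩ h ⟨⟨A', D'⟩, ⟨B', C'⟩⟩ h' heq
    simp only [Finset.coe_filter, Finset.mem_univ, true_and, mem_ofPred_eq, Finset.disjoint_left,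
      Finset.mem_union] at h h'
    simp only [he, Prod.mk.injEq] at heq
    obtain ⟨⟨h1, h2⟩, rfl, rfl⟩ := heq
    have e1 : B = B' := by
      have h1 := Finset.ext_iff.1 h1
      ext i
      have := h1 i
      grind
    have e2 : C = C' := by
      have h2 := Finset.ext_iff.1 h2
      ext i
      have := h2 i
      grind
    rw [e1, e2]
  calc _ = ∑ t ∈ ({t | (Disjoint t.2.1 (t.1.1 ∪ t.1.2) ∧
      Disjoint t.2.2 (t.1.1 ∪ t.1.2)) ∧ ¬ Disjoint t.2.1 t.2.2} :
        Finset ((Finset ι × Finset ι) × (Finset ι × Finset ι))), f (e t) := rfl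
    _ = ∑ u ∈ Finset.image e _, f u := (Finset.sum_image hinj).symm
    _ ≤ ∑ u ∈ (Finset.univ.filter fun a : Finset ι × Finset ι => ¬ Disjoint a.1 a.2).sigma
        (fun a => a.1.powerset ×ˢ a.2.powerset), f (u.1, u.2) := by
        refine le_of_le_of_eq ?_ (Finset.sum_map _ (Equiv.sigmaEquivProd _ _).toEmbedding f)
        refine Finset.sum_le_sum_of_subset_of_nonneg (fun u hu => ?_)
          fun u _ _ => mul_nonneg (hs _) (hs _)
        obtain ⟨⟨⟨A, D⟩, ⟨B, C⟩⟩, ht, rfl⟩ := Finset.mem_image.1 hu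
        simp only [Finset.mem_filter_univ] at ht
        refine Finset.mem_map.2 ⟨⟨(A ∪ B, C ∪ D), (A, D)⟩, ?_, rfl⟩
        simp only [Finset.mem_sigma, Finset.mem_filter_univ, Finset.mem_product,
          Finset.mem_powerset]
        refine ⟨fun hd => ht.2 ?_, Finset.subset_union_left, Finset.subset_union_right⟩
        exact hd.mono Finset.subset_union_right Finset.subset_union_left
    _ = ∑ a : Finset ι × Finset ι with ¬ Disjoint a.1 a.2,
          2 ^ a.1.card * 2 ^ a.2.card * (s a.1 * s a.2) := by
        rw [Finset.sum_sigma]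
        refine Finset.sum_congr rfl fun a _ => ?_
        simp only [hf]
        rw [Finset.sum_const, Finset.card_product, Finset.card_powerset, Finset.card_powerset,
          nsmul_eq_mul]
        push_cast
        rfl
    _ = _ := by
        rw [Finset.mul_sum]
        refine Finset.sum_congr rfl fun a _ => ?_
        by_cases h1 : a.1.card = p
        · by_cases h2 : a.2.card = p
          · rw [h1, h2, ← mul_pow]
            norm_num
          · simp [hp _ h2]
        · simp [hp _ h1]

/-- Overlapping pairs are controlled by the maximal influence. -/
lemma sum_not_disjoint_le {s : Finset ι → ℝ} (hs : ∀ J, 0 ≤ s J) {p : ℕ}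
    (hp : ∀ J, J.card ≠ p → s J = 0) {r : ℝ} (hr : ∀ i, ∑ J with i ∈ J, s J ≤ r) :
    ∑ a : Finset ι × Finset ι with ¬ Disjoint a.1 a.2, s a.1 * s a.2 ≤ p * r * ∑ J, s J := by
  -- Union bound over a common element `i ∈ J`: there are `p` choices of `i`, and each costs at most
  -- `r`.
  have h1 : ∀ a : Finset ι × Finset ι, (if ¬ Disjoint a.1 a.2 then s a.1 * s a.2 else 0)
      ≤ ∑ i ∈ a.1, if i ∈ a.2 then s a.1 * s a.2 else 0 := fun a => by
    have h0 : ∀ i, 0 ≤ if i ∈ a.2 then s a.1 * s a.2 else 0 := fun i => by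
      have := mul_nonneg (hs a.1) (hs a.2)
      split_ifs <;> simp [this]
    split_ifs with h
    · exact Finset.sum_nonneg fun i _ => h0 i
    · obtain ⟨i, h1, h2⟩ := Finset.not_disjoint_iff.1 h
      refine le_trans (le_of_eq ?_) (Finset.single_le_sum (fun i _ => h0 i) h1)
      rw [if_pos h2]
  rw [Finset.sum_filter]
  refine (Finset.sum_le_sum fun a _ => h1 a).trans ?_
  rw [Fintype.sum_prod_type, Finset.mul_sum]
  refine Finset.sum_le_sum fun J _ => ?_
  rw [Finset.sum_comm]
  calc ∑ i ∈ J, ∑ K : Finset ι, (if i ∈ K then s J * s K else 0)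
      = ∑ i ∈ J, s J * ∑ K with i ∈ K, s K := by
        refine Finset.sum_congr rfl fun i _ => ?_
        rw [← Finset.sum_filter, Finset.mul_sum]
    _ ≤ ∑ i ∈ J, s J * r :=
        Finset.sum_le_sum fun i _ => mul_le_mul_of_nonneg_left (hr i) (hs J)
    _ = p * r * s J := by
        rw [Finset.sum_const, nsmul_eq_mul]
        by_cases h : J.card = p
        · rw [h]
          ring
        · rw [hp J h]
          ring

end Reindex

/-! ### Contractions of kernels. -/

section Kernels

variable {ι : Type*} [Fintype ι] [DecidableEq ι] {E : ι → Type*} [∀ i, MeasurableSpace (E i)]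
  {ν : ∀ i, Measure (E i)} [∀ i, IsProbabilityMeasure (ν i)] {p : ℕ}
  {g : Finset ι → (∀ i, E i) → ℝ}

lemma sq_integral_mul_le {α : Type*} {mα : MeasurableSpace α} {μ : Measure α} {a b : α → ℝ}
    (ha : MemLp a 2 μ) (hb : MemLp b 2 μ) :
    (∫ x, a x * b x ∂μ) ^ 2 ≤ (∫ x, a x ^ 2 ∂μ) * ∫ x, b x ^ 2 ∂μ := by
  have h : ∀ t : ℝ, 0 ≤ (∫ x, b x ^ 2 ∂μ) * (t * t) + (2 * ∫ x, a x * b x ∂μ) * t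
      + ∫ x, a x ^ 2 ∂μ := fun t => by
    have i1 := ha.integrable_sq
    have i2 := hb.integrable_sq
    have i3 : Integrable (fun x => a x * b x) μ := ha.integrable_mul hb
    have : ∫ x, (a x + t * b x) ^ 2 ∂μ = (∫ x, b x ^ 2 ∂μ) * (t * t)
        + (2 * ∫ x, a x * b x ∂μ) * t + ∫ x, a x ^ 2 ∂μ := by
      calc _ = ∫ x, (a x ^ 2 + (2 * t * (a x * b x) + t * t * b x ^ 2)) ∂μ := by
            congr 1
            funext x
            ring
        _ = _ := by
            rw [integral_add i1 (by exact (i3.const_mul _).add (i2.const_mul _)),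
              integral_add (i3.const_mul _) (i2.const_mul _), integral_const_mul,
              integral_const_mul]
            ring
    rw [← this]
    exact integral_nonneg fun x => sq_nonneg _
  have := discrim_le_zero h
  rw [discrim] at this
  nlinarith

variable (ν g) in
/-- The variance of a kernel. -/
def kernelVar (J : Finset ι) : ℝ := ∫ x, g J x ^ 2 ∂(Measure.pi ν)

lemma kernelVar_nonneg (J : Finset ι) : 0 ≤ kernelVar ν g J :=
  integral_nonneg fun _ => sq_nonneg _

variable (ν g) in
/-- The contraction of the kernels indexed by `A ∪ B` and `B ∪ D` over the coordinates in `B`. -/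
def contraction (A D B : Finset ι) : (∀ i, E i) → ℝ :=
  avg ν (A ∪ D) fun x => g (A ∪ B) x * g (B ∪ D) x

namespace IsKernelFamily

variable (hg : IsKernelFamily ν p g)
include hg

lemma kernelVar_eq_zero (J : Finset ι) (hJ : J.card ≠ p) : kernelVar ν g J = 0 := by
  simp [kernelVar, hg.eq_zero J hJ]

lemma integral_mul_eq_zero {J K : Finset ι} (h : J ≠ K) :
    ∫ x, g J x * g K x ∂(Measure.pi ν) = 0 := by
  by_cases hJ : J.card = p
  swap
  · simp [hg.eq_zero J hJ]
  by_cases hK : K.card = p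
  swap
  · simp [hg.eq_zero K hK]
  have hJK : ¬ J ⊆ K := fun hs => h (Finset.eq_of_subset_of_card_le hs (by omega))
  have hJ2 : MemLp (g J) 2 (Measure.pi ν) := (hg.memLp J).mono_exponent (by norm_num)
  have hK2 : MemLp (g K) 2 (Measure.pi ν) := (hg.memLp K).mono_exponent (by norm_num)
  have h1 := integral_mul_avg ν K hJ2 hK2
  rw [avg_of_dependsOn ν (hg.dependsOn K)] at h1
  rw [h1]
  refine integral_eq_zero_of_ae ?_
  filter_upwards [hg.avg_eq_zero J K hJK] with x hx
  simp [hx]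

lemma sum_kernelVar : ∑ J, kernelVar ν g J = ∫ x, ustat g x ^ 2 ∂(Measure.pi ν) := by
  have h := integral_sum_mul_sum (μ := Measure.pi ν) (h := g) Finset.univ
    (fun J => (hg.memLp J).mono_exponent (by norm_num))
    (fun J K hJK => hg.integral_mul_eq_zero hJK) (fun _ => 1) fun _ => 1
  simp only [one_mul, ← sq, one_pow] at h
  exact h.symm

lemma integral_sq_mul_sq {J K : Finset ι} (h : Disjoint J K) :
    ∫ x, g J x ^ 2 * g K x ^ 2 ∂(Measure.pi ν) = kernelVar ν g J * kernelVar ν g K :=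
  integral_mul_of_disjoint ν (a := fun x => g J x ^ 2) (b := fun x => g K x ^ 2)
    (fun _ _ hxy => congrArg (· ^ 2) (hg.dependsOn J hxy))
    (fun _ _ hxy => congrArg (· ^ 2) (hg.dependsOn K hxy)) h

lemma memLp_two_kernel_mul (J K : Finset ι) :
    MemLp (fun x => g J x * g K x) 2 (Measure.pi ν) := memLp_two_mul (hg.memLp J) (hg.memLp K)

lemma measurable_kernel_mul (J K : Finset ι) : Measurable fun x => g J x * g K x :=
  (hg.measurable J).mul (hg.measurable K)

lemma memLp_contraction (A D B : Finset ι) :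
    MemLp (contraction ν g A D B) 2 (Measure.pi ν) :=
  memLp_avg ν _ (hg.memLp_two_kernel_mul _ _) (hg.measurable_kernel_mul _ _)

/-- Given the coordinates in `A ∪ D`, the two products involve the disjoint blocks `B` and `C` and
are conditionally independent. -/
lemma integral_contraction_mul {A B C D : Finset ι} (hB : Disjoint B (A ∪ D))
    (hC : Disjoint C (A ∪ D)) (hBC : Disjoint B C) :
    ∫ x, contraction ν g A D B x * contraction ν g A D C x ∂(Measure.pi ν)
      = ∫ x, g (A ∪ B) x * g (B ∪ D) x * (g (A ∪ C) x * g (C ∪ D) x) ∂(Measure.pi ν) := by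
  have h1 := integral_avg_mul_avg ν (A ∪ D) (A ∪ D) (hg.memLp_two_kernel_mul (A ∪ B) (B ∪ D))
    (hg.memLp_two_kernel_mul (A ∪ C) (C ∪ D)) (hg.measurable_kernel_mul _ _)
  have h2 := integral_avg_mul_avg ν (A ∪ B ∪ (B ∪ D)) (A ∪ C ∪ (C ∪ D))
    (hg.memLp_two_kernel_mul (A ∪ B) (B ∪ D))
    (hg.memLp_two_kernel_mul (A ∪ C) (C ∪ D)) (hg.measurable_kernel_mul _ _)
  rw [avg_of_dependsOn ν (hg.dependsOn_mul _ _), avg_of_dependsOn ν (hg.dependsOn_mul _ _)] at h2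
  have h3 : (A ∪ B ∪ (B ∪ D)) ∩ (A ∪ C ∪ (C ∪ D)) = (A ∪ D) ∩ (A ∪ D) := by
    simp only [Finset.disjoint_left, Finset.mem_union] at hB hC hBC
    ext i
    have := @hB i
    have := @hC i
    have := @hBC i
    grind
  rw [h3, ← h1] at h2
  exact h2.symm

/-- The first factor reads `A` from the first copy and `B` from the second; the other reads `B` and
`D` from the first. Exchanging `A` puts the two factors on separate copies. -/
lemma integral_mix_sq_mul_sq {A B D : Finset ι} (hAD : Disjoint A D) (hB : Disjoint B (A ∪ D)) :
    ∫ z, g (A ∪ B) (mix (A ∪ D) z) ^ 2 * g (B ∪ D) z.1 ^ 2 ∂(twoCopies ν)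
      = kernelVar ν g (A ∪ B) * kernelVar ν g (B ∪ D) := by
  have h := integral_prod_mul (μ := Measure.pi ν) (ν := Measure.pi ν)
    (fun x => g (B ∪ D) x ^ 2) fun x => g (A ∪ B) x ^ 2
  rw [mul_comm, kernelVar, kernelVar, ← h, ← integral_exch ν Aᶜ]
  simp only [Finset.disjoint_left, Finset.mem_union] at hAD hB
  congr 1
  funext z
  have e1 : g (A ∪ B) (mix (A ∪ D) (exch Aᶜ z)) = g (A ∪ B) z.2 := by
    refine hg.dependsOn _ fun i hi => ?_
    have hi' : i ∈ A ∨ i ∈ B := by simpa using hi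
    by_cases hA : i ∈ A
    · simp [mix, exch_apply, hA]
    · have hiB : i ∈ B := hi'.resolve_left hA
      have hD : i ∉ D := fun hD => hB hiB (Or.inr hD)
      simp [mix, exch_apply, hA, hD]
  have e2 : g (B ∪ D) (exch Aᶜ z).1 = g (B ∪ D) z.1 := by
    refine hg.dependsOn _ fun i hi => ?_
    have hi' : i ∈ B ∨ i ∈ D := by simpa using hi
    have hA : i ∉ A := fun hA => hi'.elim (fun hb => hB hb (Or.inl hA)) fun hd => hAD hA hd
    simp [mix, exch_apply, hA]
  rw [e1, e2, mul_comm]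

/-- The squared conditional expectation is a product of four kernels on two copies sharing `A ∪ D`.
Pairing each kernel at the mixed point with the other kernel at the first point makes the factors of
each pair independent; then `ab ≤ (a² + b²)/2`. -/
lemma integral_contraction_sq_le {A B D : Finset ι} (hAD : Disjoint A D)
    (hB : Disjoint B (A ∪ D)) :
    ∫ x, contraction ν g A D B x ^ 2 ∂(Measure.pi ν)
      ≤ kernelVar ν g (A ∪ B) * kernelVar ν g (B ∪ D) := by
  have hF := hg.memLp_two_kernel_mul (A ∪ B) (B ∪ D)
  have h1 := integral_avg_mul_avg ν (A ∪ D) (A ∪ D) hF hF (hg.measurable_kernel_mul _ _)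
  rw [Finset.inter_self, integral_mul_avg ν _ hF hF, integral_avg_mul ν _ hF hF] at h1
  have h2 := hg.integral_mix_sq_mul_sq hAD hB
  have h3 := hg.integral_mix_sq_mul_sq hAD.symm (Finset.union_comm A D ▸ hB)
  rw [Finset.union_comm D A, Finset.union_comm D B, Finset.union_comm B A] at h3
  have m1 : ∀ J, MemLp (fun z => g J (mix (A ∪ D) z)) 4 (twoCopies ν) := fun J =>
    memLp_mix ν _ (hg.memLp J)
  have m2 : ∀ J, MemLp (fun z => g J z.1) 4 (twoCopies ν) := fun J =>
    (hg.memLp J).comp_measurePreserving measurePreserving_fst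
  have i1 := (memLp_two_mul (m1 (A ∪ B)) (m2 (B ∪ D))).integrable_sq
  have i2 := (memLp_two_mul (m1 (B ∪ D)) (m2 (A ∪ B))).integrable_sq
  simp only [sq (contraction ν g A D B _)]
  change ∫ x, contraction ν g A D B x * contraction ν g A D B x ∂(Measure.pi ν) = _ at h1
  rw [h1]
  calc _ ≤ ∫ z, ((1 / 2) * (g (A ∪ B) (mix (A ∪ D) z) * g (B ∪ D) z.1) ^ 2
        + (1 / 2) * (g (B ∪ D) (mix (A ∪ D) z) * g (A ∪ B) z.1) ^ 2) ∂(twoCopies ν) := by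
        refine integral_mono (integrable_mul_four (m1 _) (m1 _) (m2 _) (m2 _))
          ((i1.const_mul _).add (i2.const_mul _)) fun z => ?_
        simp only
        nlinarith [sq_nonneg (g (A ∪ B) (mix (A ∪ D) z) * g (B ∪ D) z.1
          - g (B ∪ D) (mix (A ∪ D) z) * g (A ∪ B) z.1)]
    _ = _ := by
        rw [integral_add (i1.const_mul _) (i2.const_mul _), integral_const_mul,
          integral_const_mul]
        simp only [mul_pow]
        rw [h2, h3]
        ring

/-- Cauchy-Schwarz gives the square root of the product of the four variances. They are then grouped
as `A ∪ B` with `C ∪ D` and `A ∪ C` with `B ∪ D`, the form that `sum_overlapping_le` can count. -/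
lemma integral_contraction_mul_le {A B C D : Finset ι} (hAD : Disjoint A D)
    (hB : Disjoint B (A ∪ D)) (hC : Disjoint C (A ∪ D)) :
    ∫ x, contraction ν g A D B x * contraction ν g A D C x ∂(Measure.pi ν)
      ≤ (1 / 2) * (kernelVar ν g (A ∪ B) * kernelVar ν g (C ∪ D))
        + (1 / 2) * (kernelVar ν g (A ∪ C) * kernelVar ν g (B ∪ D)) := by
  have h1 := sq_integral_mul_le (hg.memLp_contraction A D B) (hg.memLp_contraction A D C)
  have h2 := hg.integral_contraction_sq_le hAD hB
  have h3 := hg.integral_contraction_sq_le hAD hC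
  have n1 := kernelVar_nonneg (ν := ν) (g := g) (A ∪ B)
  have n2 := kernelVar_nonneg (ν := ν) (g := g) (B ∪ D)
  have n3 := kernelVar_nonneg (ν := ν) (g := g) (A ∪ C)
  have n4 := kernelVar_nonneg (ν := ν) (g := g) (C ∪ D)
  set u1 := kernelVar ν g (A ∪ B)
  set u2 := kernelVar ν g (B ∪ D)
  set u3 := kernelVar ν g (A ∪ C)
  set u4 := kernelVar ν g (C ∪ D)
  have h4 := mul_le_mul h2 h3 (integral_nonneg fun _ => sq_nonneg _) (mul_nonneg n1 n2)
  refine (le_abs_self _).trans (abs_le_of_sq_le_sq ?_ (by positivity))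
  nlinarith [sq_nonneg (u1 * u4 - u3 * u2)]

end IsKernelFamily
end Kernels

/-! ### Lower bound for the top components of the square. -/

section Kernels

variable {ι : Type*} [Fintype ι] [DecidableEq ι] {E : ι → Type*} [∀ i, MeasurableSpace (E i)]
  {ν : ∀ i, Measure (E i)} [∀ i, IsProbabilityMeasure (ν i)] {p : ℕ}
  {g : Finset ι → (∀ i, E i) → ℝ}

namespace IsKernelFamily

variable (hg : IsKernelFamily ν p g)
include hg

lemma sum_squareEnergy_of_card_eq :
    ∑ M : Finset ι with M.card = 2 * p, squareEnergy ν g M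
      = ∑ t ∈ disjointQuadruples ι, ∫ x, contraction ν g t.1.1 t.1.2 t.2.1 x
          * contraction ν g t.1.1 t.1.2 t.2.2 x ∂(Measure.pi ν) := by
  have h0 := sum_pairs_eq_sum_disjointQuadruples fun a b : Finset ι × Finset ι =>
    ∫ x, g a.1 x * g a.2 x * (g b.1 x * g b.2 x) ∂(Measure.pi ν)
  calc _ = ∑ M : Finset ι, ∑ a : Finset ι × Finset ι with Disjoint a.1 a.2 ∧ a.1 ∪ a.2 = M,
      ∑ b : Finset ι × Finset ι with Disjoint b.1 b.2 ∧ b.1 ∪ b.2 = M,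
        ∫ x, g a.1 x * g a.2 x * (g b.1 x * g b.2 x) ∂(Measure.pi ν) := by
        rw [Finset.sum_filter]
        refine Finset.sum_congr rfl fun M _ => ?_
        split_ifs with hM
        · rw [hg.squareEnergy_of_card_eq hM]
          simp only [sq, Finset.sum_mul_sum]
          have hi := fun J => hg.memLp J
          rw [integral_finsetSum _ fun a _ => integrable_finsetSum _ fun b _ =>
            integrable_mul_four (hi _) (hi _) (hi _) (hi _)]
          exact Finset.sum_congr rfl fun a _ => integral_finsetSum _ fun b _ =>
            integrable_mul_four (hi _) (hi _) (hi _) (hi _)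
        · refine (Finset.sum_eq_zero fun a ha => Finset.sum_eq_zero fun b _ => ?_).symm
          obtain ⟨-, h1, h2⟩ := Finset.mem_filter.1 ha
          have h3 : a.1.card + a.2.card ≠ 2 * p := by
            rwa [← Finset.card_union_of_disjoint h1, h2]
          by_cases h4 : a.1.card = p
          · simp [hg.eq_zero a.2 (by omega)]
          · simp [hg.eq_zero a.1 h4]
    _ = _ := by
        rw [h0]
        refine Finset.sum_congr rfl fun t ht => ?_
        obtain ⟨-, h1, ⟨h2, h3⟩, h4⟩ := Finset.mem_filter.1 ht
        rw [hg.integral_contraction_mul h2 h3 h4]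
        congr 1
        funext x
        ring

/-- If `|A| = p`, only `B = ∅` survives and its contraction is `g A * g D`. If `A = D = ∅`, the
contractions are the constants `kernelVar ν g B`. In all other cases nonnegativity suffices. -/
lemma kernelVar_mul_le_integral_sq (hp : 0 < p) {A D : Finset ι} (hAD : Disjoint A D) :
    (if A = ∅ ∧ D = ∅ then (∑ J, kernelVar ν g J) ^ 2 else 0) + kernelVar ν g A * kernelVar ν g D
      ≤ ∫ x, (∑ B : Finset ι with Disjoint B (A ∪ D), contraction ν g A D B x) ^ 2
          ∂(Measure.pi ν) := by
  by_cases hA : A.card = p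
  · have hne : A ≠ ∅ := fun h => by simp [h] at hA; omega
    rw [if_neg fun h => hne h.1, zero_add, ← hg.integral_sq_mul_sq hAD]
    refine le_of_eq (congrArg _ (funext fun x => ?_))
    rw [Finset.sum_eq_single ∅]
    · rw [contraction, Finset.union_empty, Finset.empty_union,
        avg_of_dependsOn ν (hg.dependsOn_mul A D), mul_pow]
    · intro B hB hB0
      have h1 : (A ∪ B).card ≠ p := by
        rw [Finset.card_union_of_disjoint
          ((Finset.disjoint_union_right.1 (Finset.mem_filter.1 hB).2).1).symm, hA]
        have := Finset.card_pos.2 (Finset.nonempty_iff_ne_empty.2 hB0)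
        omega
      simp [contraction, avg, hg.eq_zero _ h1]
    · simp
  · rw [hg.kernelVar_eq_zero A hA, zero_mul, add_zero]
    split_ifs with h
    · obtain ⟨rfl, rfl⟩ := h
      have h1 : ∀ B x, contraction ν g ∅ ∅ B x = kernelVar ν g B := fun B x => by
        simp only [contraction, Finset.empty_union, Finset.union_empty, kernelVar, sq]
        have h2 : ∀ y, mix ∅ (x, y) = y := fun y => funext fun i => by simp [mix]
        simp only [avg, h2]
      simp [h1]
    · exact integral_nonneg fun x => sq_nonneg _

/-- Expand the square and bound the overlapping pairs `(B, C)` by `integral_contraction_mul_le`;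
swapping `B` and `C` shows that its two halves have equal sums. -/
lemma kernelVar_mul_le_sum (hp : 0 < p) {A D : Finset ι} (hAD : Disjoint A D) :
    (if A = ∅ ∧ D = ∅ then (∑ J, kernelVar ν g J) ^ 2 else 0) + kernelVar ν g A * kernelVar ν g D
      ≤ (∑ b : Finset ι × Finset ι with
          (Disjoint b.1 (A ∪ D) ∧ Disjoint b.2 (A ∪ D)) ∧ Disjoint b.1 b.2,
          ∫ x, contraction ν g A D b.1 x * contraction ν g A D b.2 x ∂(Measure.pi ν))
        + ∑ b : Finset ι × Finset ι with
          (Disjoint b.1 (A ∪ D) ∧ Disjoint b.2 (A ∪ D)) ∧ ¬ Disjoint b.1 b.2,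
          kernelVar ν g (A ∪ b.1) * kernelVar ν g (b.2 ∪ D) := by
  refine (hg.kernelVar_mul_le_integral_sq hp hAD).trans ?_
  have hi := hg.memLp_contraction A D
  have h1 : ∫ x, (∑ B : Finset ι with Disjoint B (A ∪ D), contraction ν g A D B x) ^ 2
      ∂(Measure.pi ν) = ∑ b : Finset ι × Finset ι with
        Disjoint b.1 (A ∪ D) ∧ Disjoint b.2 (A ∪ D),
        ∫ x, contraction ν g A D b.1 x * contraction ν g A D b.2 x ∂(Measure.pi ν) := by
    simp only [sq, Finset.sum_mul_sum]
    have hi2 : ∀ B C, Integrable (fun x => contraction ν g A D B x * contraction ν g A D C x)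
        (Measure.pi ν) := fun B C => (hi B).integrable_mul (hi C)
    rw [integral_finsetSum _ fun B _ => integrable_finsetSum _ fun C _ => hi2 B C]
    have h2 : (Finset.univ.filter fun b : Finset ι × Finset ι =>
        Disjoint b.1 (A ∪ D) ∧ Disjoint b.2 (A ∪ D))
        = (Finset.univ.filter (Disjoint · (A ∪ D))) ×ˢ (Finset.univ.filter (Disjoint · (A ∪ D))) := by
      ext b
      simp
    rw [h2, Finset.sum_product]
    exact Finset.sum_congr rfl fun B _ => integral_finsetSum _ fun C _ => hi2 B C
  rw [h1, ← Finset.sum_filter_add_sum_filter_not _ fun b : Finset ι × Finset ι =>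
    Disjoint b.1 b.2, Finset.filter_filter, Finset.filter_filter]
  refine add_le_add le_rfl ?_
  have h2 : ∑ b : Finset ι × Finset ι with
      (Disjoint b.1 (A ∪ D) ∧ Disjoint b.2 (A ∪ D)) ∧ ¬ Disjoint b.1 b.2,
        kernelVar ν g (A ∪ b.2) * kernelVar ν g (b.1 ∪ D)
      = ∑ b : Finset ι × Finset ι with
        (Disjoint b.1 (A ∪ D) ∧ Disjoint b.2 (A ∪ D)) ∧ ¬ Disjoint b.1 b.2,
        kernelVar ν g (A ∪ b.1) * kernelVar ν g (b.2 ∪ D) := by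
    refine Finset.sum_nbij' Prod.swap Prod.swap ?_ ?_ (fun _ _ => rfl) (fun _ _ => rfl)
      fun _ _ => rfl
    all_goals
      intro b hb
      simp only [Finset.mem_filter_univ, Prod.fst_swap, Prod.snd_swap] at hb ⊢
      exact ⟨hb.1.symm, fun h => hb.2 h.symm⟩
  calc _ ≤ ∑ b : Finset ι × Finset ι with
      (Disjoint b.1 (A ∪ D) ∧ Disjoint b.2 (A ∪ D)) ∧ ¬ Disjoint b.1 b.2,
        ((1 / 2) * (kernelVar ν g (A ∪ b.1) * kernelVar ν g (b.2 ∪ D))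
        + (1 / 2) * (kernelVar ν g (A ∪ b.2) * kernelVar ν g (b.1 ∪ D))) :=
        Finset.sum_le_sum fun b hb => by
          obtain ⟨-, ⟨h3, h4⟩, -⟩ := Finset.mem_filter.1 hb
          exact hg.integral_contraction_mul_le hAD h3 h4
    _ = _ := by
        rw [Finset.sum_add_distrib, ← Finset.mul_sum, ← Finset.mul_sum, h2]
        ring

/-- Lower bound for the top components of the square of a U-statistic in terms of the maximal
influence. -/
lemma two_sub_le_sum_squareEnergy (hp : 0 < p)
    (hvar : ∫ x, ustat g x ^ 2 ∂(Measure.pi ν) = 1) {r : ℝ}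
    (hr : ∀ i, ∑ J with i ∈ J, kernelVar ν g J ≤ r) :
    2 - (4 ^ p + 1) * p * r ≤ ∑ M : Finset ι with M.card = 2 * p, squareEnergy ν g M := by
  have hs := fun J => kernelVar_nonneg (ν := ν) (g := g) J
  have hsum : ∑ J, kernelVar ν g J = 1 := hg.sum_kernelVar.trans hvar
  have h1 := sum_not_disjoint_le hs hg.kernelVar_eq_zero hr
  have h2 := sum_overlapping_le hs hg.kernelVar_eq_zero
  rw [hsum, mul_one] at h1
  have h3 : (∑ a : Finset ι × Finset ι with Disjoint a.1 a.2,
        kernelVar ν g a.1 * kernelVar ν g a.2)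
      + ∑ a : Finset ι × Finset ι with ¬ Disjoint a.1 a.2,
        kernelVar ν g a.1 * kernelVar ν g a.2 = 1 := by
    rw [Finset.sum_filter_add_sum_filter_not, Fintype.sum_prod_type, ← Finset.sum_mul_sum, hsum,
      one_mul]
  -- Summed over disjoint `(A, D)`, the left side is `1` from `A = D = ∅` plus `1` minus the
  -- overlapping pairs; the right side is the top energy plus the overlapping quadruples.
  have h4 := Finset.sum_le_sum fun (a : Finset ι × Finset ι)
    (ha : a ∈ Finset.univ.filter fun a : Finset ι × Finset ι => Disjoint a.1 a.2) =>
      hg.kernelVar_mul_le_sum hp (Finset.mem_filter.1 ha).2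
  rw [Finset.sum_add_distrib, Finset.sum_add_distrib, hsum] at h4
  have h5 : ∑ a : Finset ι × Finset ι with Disjoint a.1 a.2,
      (if a.1 = ∅ ∧ a.2 = ∅ then (1 : ℝ) ^ 2 else 0) = 1 := by
    rw [Finset.sum_eq_single (∅, ∅)]
    · simp
    · rintro ⟨A, D⟩ - h
      rw [if_neg]
      rintro ⟨h6, h7⟩
      exact h (Prod.ext h6 h7)
    · simp
  have hprod : ∀ f : (Finset ι × Finset ι) × (Finset ι × Finset ι) → ℝ,
      ∑ t, f t = ∑ a, ∑ b, f (a, b) := Fintype.sum_prod_type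
  have h6 : ∑ a : Finset ι × Finset ι with Disjoint a.1 a.2, ∑ b : Finset ι × Finset ι with
          (Disjoint b.1 (a.1 ∪ a.2) ∧ Disjoint b.2 (a.1 ∪ a.2)) ∧ Disjoint b.1 b.2,
          ∫ x, contraction ν g a.1 a.2 b.1 x * contraction ν g a.1 a.2 b.2 x ∂(Measure.pi ν)
      = ∑ M : Finset ι with M.card = 2 * p, squareEnergy ν g M := by
    rw [hg.sum_squareEnergy_of_card_eq, disjointQuadruples, Finset.sum_filter, Finset.sum_filter,
      hprod]
    refine Finset.sum_congr rfl fun a _ => ?_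
    rw [Finset.sum_filter]
    split_ifs with h
    · simp [h]
    · simp [h]
  have h7 : ∑ a : Finset ι × Finset ι with Disjoint a.1 a.2, ∑ b : Finset ι × Finset ι with
          (Disjoint b.1 (a.1 ∪ a.2) ∧ Disjoint b.2 (a.1 ∪ a.2)) ∧ ¬ Disjoint b.1 b.2,
          kernelVar ν g (a.1 ∪ b.1) * kernelVar ν g (b.2 ∪ a.2)
      ≤ ∑ t : (Finset ι × Finset ι) × (Finset ι × Finset ι) with
        (Disjoint t.2.1 (t.1.1 ∪ t.1.2) ∧ Disjoint t.2.2 (t.1.1 ∪ t.1.2)) ∧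
        ¬ Disjoint t.2.1 t.2.2, kernelVar ν g (t.1.1 ∪ t.2.1) * kernelVar ν g (t.2.2 ∪ t.1.2) := by
    rw [Finset.sum_filter, Finset.sum_filter, hprod]
    refine Finset.sum_le_sum fun a _ => ?_
    rw [← Finset.sum_filter]
    split_ifs
    · exact le_rfl
    · exact Finset.sum_nonneg fun b _ => mul_nonneg (hs _) (hs _)
  rw [h5, h6] at h4
  have h8 := mul_le_mul_of_nonneg_left h1 (by positivity : (0 : ℝ) ≤ 4 ^ p)
  nlinarith

/-- A Berry-Esseen type bound for U-statistics on a product space. -/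
theorem abs_cdf_sub_le_of_influence (hp : 0 < p)
    (hvar : ∫ x, ustat g x ^ 2 ∂(Measure.pi ν) = 1) {r : ℝ} (hr0 : 0 ≤ r)
    (hr : ∀ i, ∑ J with i ∈ J, kernelVar ν g J ≤ r) (z : ℝ) :
    |(Measure.pi ν).real {x | ustat g x ≤ z} - stdCdf z|
      ≤ 5 * √|(∫ x, ustat g x ^ 4 ∂(Measure.pi ν)) - 3| + 6 * √((4 ^ p + 1) * p * r) :=
  hg.abs_cdf_sub_le_of_top hp hvar (by positivity) (hg.two_sub_le_sum_squareEnergy hp hvar hr) z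

end IsKernelFamily
end Kernels

/-! ### Transfer between the probability space and the product space. -/

section Transfer

lemma integral_comp_measurePreserving {α β : Type*} {mα : MeasurableSpace α}
    {mβ : MeasurableSpace β} {μ : Measure α} {ν : Measure β} {φ : α → β}
    (hφ : MeasurePreserving φ μ ν) {F : β → ℝ} (hF : Measurable F) :
    ∫ ω, F (φ ω) ∂μ = ∫ x, F x ∂ν := by
  rw [← hφ.map_eq, integral_map hφ.aemeasurable hF.aestronglyMeasurable]

lemma memLp_of_comp_measurePreserving {α β : Type*} {mα : MeasurableSpace α}
    {mβ : MeasurableSpace β} {μ : Measure α} {ν : Measure β} {φ : α → β}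
    (hφ : MeasurePreserving φ μ ν) {F : β → ℝ} (hF : Measurable F) {q : ENNReal}
    (h : MemLp (fun ω => F (φ ω)) q μ) : MemLp F q ν := by
  rw [← hφ.map_eq]
  exact (memLp_map_measure_iff hF.aestronglyMeasurable hφ.aemeasurable).2 h

variable {Ω : Type*} {mΩ : MeasurableSpace Ω} {μ : Measure Ω} {n : ℕ} {E : Fin n → Type*}
  [mE : ∀ i, MeasurableSpace (E i)] {X : ∀ i, Ω → E i}

lemma sigmaField_le (hX : ∀ i, Measurable (X i)) (J : Finset (Fin n)) : sigmaField X J ≤ mΩ :=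
  iSup₂_le fun i _ => (hX i).comap_le

lemma sigmaField_eq_comap (J : Finset (Fin n)) :
    sigmaField X J = MeasurableSpace.comap (fun ω (i : J) => X i ω) MeasurableSpace.pi := by
  simp only [sigmaField, MeasurableSpace.pi, MeasurableSpace.comap_iSup,
    MeasurableSpace.comap_comp, iSup_subtype]
  rfl

lemma exists_eq_comp_of_measurable_sigmaField {J : Finset (Fin n)} {U : Ω → ℝ}
    (hU : Measurable[sigmaField X J] U) :
    ∃ h : (∀ i, E i) → ℝ, Measurable h ∧ DependsOn h J ∧ ∀ ω, U ω = h fun i => X i ω := by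
  rw [sigmaField_eq_comap] at hU
  obtain ⟨h, hm, he⟩ := hU.exists_eq_measurable_comp
  refine ⟨fun x => h fun i : J => x i, hm.comp (measurable_pi_lambda _ fun i =>
    measurable_pi_apply _), fun x y hxy => congrArg h (funext fun i => hxy i i.2), fun ω => ?_⟩
  rw [he]
  rfl

lemma measurable_sigmaField_comp [Nonempty Ω] {A : Finset (Fin n)} {F : (∀ i, E i) → ℝ}
    (hF : Measurable F) (hd : DependsOn F A) :
    Measurable[sigmaField X A] fun ω => F fun i => X i ω := by
  obtain ⟨ω₀⟩ := ‹Nonempty Ω›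
  -- Freezing the coordinates outside `A` at a reference point exhibits the function as one of the
  -- `X i` with `i ∈ A` only.
  have h1 : (fun ω => F fun i => X i ω)
      = fun ω => F fun i => if i ∈ A then X i ω else X i ω₀ :=
    funext fun ω => hd fun i hi => (if_pos (Finset.mem_coe.1 hi)).symm
  rw [h1]
  refine hF.comp (@measurable_pi_lambda _ _ _ (sigmaField X A) _ _ fun i => ?_)
  by_cases hi : i ∈ A
  · simp only [hi, if_true]
    exact (comap_measurable (X i)).mono (le_iSup₂_of_le i hi le_rfl) le_rfl
  · simp only [hi, if_false]
    exact measurable_const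

lemma measurePreserving_joint [IsProbabilityMeasure μ] (hX : ∀ i, Measurable (X i))
    (hind : iIndepFun X μ) :
    MeasurePreserving (fun ω i => X i ω) μ (Measure.pi fun i => μ.map (X i)) :=
  ⟨measurable_pi_lambda _ hX,
    (iIndepFun_iff_map_fun_eq_pi_map fun i => (hX i).aemeasurable).1 hind⟩

variable {p : ℕ} {W : Ω → ℝ} {V : Finset (Fin n) → Ω → ℝ}

lemma maxInfluence_nonneg : 0 ≤ maxInfluence μ p V :=
  Real.iSup_nonneg fun _ => Finset.sum_nonneg fun _ _ => integral_nonneg fun _ => sq_nonneg _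

namespace IsDegenerateUStatistic

variable (hd : IsDegenerateUStatistic μ X p W V)
include hd

/-- Conditioning on the `X i` with `i ∈ J` kills every other component. Hence the components inherit
fourth moments from `W`. -/
lemma ae_eq_condExp [IsProbabilityMeasure μ] (hX : ∀ i, Measurable (X i)) {J : Finset (Fin n)}
    (hJ : J.card = p) : V J =ᵐ[μ] μ[W | sigmaField X J] := by
  have hm := sigmaField_le hX J
  have h1 : μ[W | sigmaField X J] =ᵐ[μ] ∑ K, μ[V K | sigmaField X J] := by
    refine (condExp_congr_ae ?_).trans
      (condExp_finsetSum (fun K _ => hd.hoeffding.integrable K) (sigmaField X J))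
    filter_upwards [hd.hoeffding.sum_eq] with ω hω
    rw [hω, Finset.sum_apply]
  have h2 : ∀ᵐ ω ∂μ, ∀ K, K ≠ J → (μ[V K | sigmaField X J]) ω = 0 := by
    refine ae_all_iff.2 fun K => ?_
    by_cases hKJ : K = J
    · exact Eventually.of_forall fun ω h => absurd hKJ h
    by_cases hK : K.card = p
    · filter_upwards [hd.hoeffding.condExp_eq_zero K J fun h =>
        hKJ (Finset.eq_of_subset_of_card_le h (by omega))] with ω hω _ using hω
    · have h3 := condExp_congr_ae (m := sigmaField X J) (hd.degenerate K hK)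
      rw [condExp_zero] at h3
      filter_upwards [h3] with ω hω _ using hω
  filter_upwards [h1, h2] with ω hω1 hω2
  rw [hω1, Finset.sum_apply, Finset.sum_eq_single J (fun K _ hK => hω2 K hK) (by simp),
    condExp_of_stronglyMeasurable hm (hd.hoeffding.measurable J).stronglyMeasurable
      (hd.hoeffding.integrable J)]

lemma memLp [IsProbabilityMeasure μ] (hX : ∀ i, Measurable (X i)) (hW : MemLp W 4 μ)
    (J : Finset (Fin n)) : MemLp (V J) 4 μ := by
  by_cases hJ : J.card = p
  · exact (hW.condExp (by norm_num)).ae_eq (hd.ae_eq_condExp hX hJ).symm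
  · exact MemLp.zero.ae_eq (hd.degenerate J hJ).symm

lemma integral_eq_zero [IsProbabilityMeasure μ] (hX : ∀ i, Measurable (X i)) (hp : 0 < p) :
    ∫ ω, W ω ∂μ = 0 := by
  rw [integral_congr_ae hd.hoeffding.sum_eq,
    integral_finsetSum _ fun J _ => hd.hoeffding.integrable J]
  refine Finset.sum_eq_zero fun J _ => ?_
  by_cases hJ : J.card = p
  · rw [← integral_condExp (sigmaField_le hX ∅)]
    refine integral_eq_zero_of_ae (hd.hoeffding.condExp_eq_zero J ∅ fun h => ?_)
    rw [Finset.subset_empty.1 h, Finset.card_empty] at hJ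
    omega
  · exact integral_eq_zero_of_ae (hd.degenerate J hJ)

/-- A degenerate U-statistic is almost surely given by kernels on the product space. -/
lemma exists_isKernelFamily [IsProbabilityMeasure μ] (hX : ∀ i, Measurable (X i))
    (hind : iIndepFun X μ) (hW : MemLp W 4 μ) :
    ∃ g : Finset (Fin n) → (∀ i, E i) → ℝ,
      (∀ J, V J =ᵐ[μ] fun ω => g J fun i => X i ω) ∧
      IsKernelFamily (fun i => μ.map (X i)) p g := by
  have : ∀ i, IsProbabilityMeasure (μ.map (X i)) := fun i =>
    Measure.isProbabilityMeasure_map (hX i).aemeasurable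
  have hne : Nonempty Ω := nonempty_of_isProbabilityMeasure μ
  have hmp := measurePreserving_joint hX hind
  choose h hm hdep heq using fun J =>
    exists_eq_comp_of_measurable_sigmaField (hd.hoeffding.measurable J)
  refine ⟨fun J => if J.card = p then h J else 0, fun J => ?_, ?_⟩
  · by_cases hJ : J.card = p
    · simp only [hJ, if_true]
      exact Eventually.of_forall (heq J)
    · simp only [hJ, if_false]
      exact hd.degenerate J hJ
  have hL : ∀ J, MemLp (h J) 4 (Measure.pi fun i => μ.map (X i)) := fun J =>
    (memLp_of_comp_measurePreserving hmp (hm J)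
      ((memLp_congr_ae (Eventually.of_forall (heq J))).1 (hd.memLp hX hW J)))
  refine ⟨fun J => ?_, fun J => ?_, fun J => ?_, fun J hJ => if_neg hJ, fun J A hJA => ?_⟩
  · split_ifs
    exacts [hm J, measurable_zero]
  · split_ifs
    exacts [hL J, MemLp.zero]
  · split_ifs
    exacts [hdep J, fun _ _ _ => rfl]
  · split_ifs with hJ
    swap
    · exact Eventually.of_forall fun x => by simp [avg]
    set ν := fun i => μ.map (X i)
    set F := avg ν A (h J) with hF
    have h2 : MemLp (h J) 2 (Measure.pi ν) := (hL J).mono_exponent (by norm_num)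
    have hF2 : MemLp F 2 (Measure.pi ν) := memLp_avg ν A h2 (hm J)
    have hFm : Measurable F := measurable_avg ν A (hm J)
    have hX2 : MemLp (fun ω => F fun i => X i ω) 2 μ := hF2.comp_measurePreserving hmp
    have hV2 : MemLp (V J) 2 μ := (hd.memLp hX hW J).mono_exponent (by norm_num)
    -- `avg ν A` is an orthogonal projection, so the squared norm of `F` is `E[V_J F(X)]`. It
    -- vanishes because `F(X)` is measurable for the σ-field of `A`, given which `V_J` has mean
    -- zero.
    have h3 : ∫ x, F x ^ 2 ∂(Measure.pi ν) = 0 := by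
      have e1 := integral_avg_mul_avg ν A A h2 h2 (hm J)
      rw [Finset.inter_self] at e1
      simp only [sq]
      refine e1.trans ?_
      have e2 : ∫ x, h J x * F x ∂(Measure.pi ν)
          = ∫ ω, V J ω * F (fun i => X i ω) ∂μ := by
        simp only [heq]
        exact (integral_comp_measurePreserving hmp ((hm J).mul hFm)).symm
      rw [← hF, e2, ← integral_condExp (sigmaField_le hX A)]
      refine integral_eq_zero_of_ae ?_
      have hmeas := measurable_sigmaField_comp (X := X) hFm (dependsOn_avg ν A (h J))
      refine (condExp_mul_of_stronglyMeasurable_right hmeas.stronglyMeasurable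
        (hV2.integrable_mul hX2) (hd.hoeffding.integrable J)).trans ?_
      filter_upwards [hd.hoeffding.condExp_eq_zero J A hJA] with ω hω
      simp [hω]
    have h4 := (integral_eq_zero_iff_of_nonneg (fun x => sq_nonneg (F x)) hF2.integrable_sq).1 h3
    filter_upwards [h4] with x hx
    simpa using hx

theorem abs_cdf_sub_le [IsProbabilityMeasure μ] (hX : ∀ i, Measurable (X i))
    (hind : iIndepFun X μ) (hW : MemLp W 4 μ) (hp : 0 < p) (hvar : variance W μ = 1) (z : ℝ) :
    |μ.real {ω | W ω ≤ z} - cdf (gaussianReal 0 1) z|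
      ≤ 5 * √|(∫ ω, W ω ^ 4 ∂μ) - 3| + 6 * √((4 ^ p + 1) * p * maxInfluence μ p V) := by
  have : ∀ i, IsProbabilityMeasure (μ.map (X i)) := fun i =>
    Measure.isProbabilityMeasure_map (hX i).aemeasurable
  have hmp := measurePreserving_joint hX hind
  obtain ⟨g, hV, hg⟩ := hd.exists_isKernelFamily hX hind hW
  have hWg : W =ᵐ[μ] fun ω => ustat g fun i => X i ω := by
    filter_upwards [hd.hoeffding.sum_eq, ae_all_iff.2 hV] with ω h1 h2
    rw [h1]
    exact Finset.sum_congr rfl fun J _ => h2 J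
  have hpow : ∀ k : ℕ, ∫ x, ustat g x ^ k ∂(Measure.pi fun i => μ.map (X i))
      = ∫ ω, W ω ^ k ∂μ := fun k => by
    rw [← integral_comp_measurePreserving hmp (hg.measurable_ustat.pow_const k)]
    refine integral_congr_ae ?_
    filter_upwards [hWg] with ω hω
    rw [hω]
  have hkv : ∀ J, kernelVar (fun i => μ.map (X i)) g J = ∫ ω, V J ω ^ 2 ∂μ := fun J => by
    rw [kernelVar, ← integral_comp_measurePreserving hmp ((hg.measurable J).pow_const 2)]
    refine integral_congr_ae ?_
    filter_upwards [hV J] with ω hω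
    rw [hω]
  have hreal : μ.real {ω | W ω ≤ z}
      = (Measure.pi fun i => μ.map (X i)).real {x | ustat g x ≤ z} := by
    rw [measureReal_def, measureReal_def,
      ← hmp.measure_preimage (measurableSet_le hg.measurable_ustat
        measurable_const).nullMeasurableSet]
    congr 1
    refine measure_congr ?_
    filter_upwards [hWg] with ω hω
    exact congrArg (· ≤ z) hω
  have hvar2 : ∫ x, ustat g x ^ 2 ∂(Measure.pi fun i => μ.map (X i)) = 1 := by
    rw [hpow, ← hvar, variance_of_integral_eq_zero hW.aestronglyMeasurable.aemeasurable
      (hd.integral_eq_zero hX hp)]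
  have hinf : ∀ i, ∑ J with i ∈ J, kernelVar (fun i => μ.map (X i)) g J
      ≤ maxInfluence μ p V := fun i => by
    refine le_trans (le_of_eq ?_) (le_ciSup (Set.finite_range _).bddAbove i)
    simp only [← hkv]
    refine (Finset.sum_subset (fun J hJ => ?_) fun J hJ hJ' => ?_).symm
    · simpa using (Finset.mem_filter.1 hJ).2
    · refine hg.kernelVar_eq_zero J fun h => hJ' ?_
      simpa [Finset.mem_powersetCard, h] using hJ
  rw [hreal, ← hpow]
  exact hg.abs_cdf_sub_le_of_influence hp hvar2 maxInfluence_nonneg hinf z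

end IsDegenerateUStatistic

end Transfer

end DeJong

end

/-! ### The main bound. -/

theorem theorem1 :
    ∃ κ : ℕ → ℝ, (∀ p, 0 < κ p) ∧
      ∀ (p n : ℕ), 1 ≤ p → p ≤ n →
      ∀ (Ω : Type*) [MeasurableSpace Ω] (μ : Measure Ω) [IsProbabilityMeasure μ]
        (E : Fin n → Type*) [∀ i, MeasurableSpace (E i)]
        (X : ∀ i, Ω → E i) (f : (∀ i, E i) → ℝ) (W : Ω → ℝ) (V : Finset (Fin n) → Ω → ℝ),
        (∀ i, Measurable (X i)) → iIndepFun X μ →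
        Measurable f → (W = fun ω => f (fun i => X i ω)) →
        MemLp W 4 μ →
        DeJong.IsDegenerateUStatistic μ X p W V →
        variance W μ = 1 →
        DeJong.kolmogorovDist μ W ≤
          11.9 * Real.sqrt |(∫ ω, W ω ^ 4 ∂μ) - 3| +
            (3.5 + 10.8 * Real.sqrt (κ p)) * DeJong.rho μ p V := by
  -- The added `1` makes the constant positive at `p = 0` too. The constants `5` and `6` obtained
  -- above are below `11.9` and `10.8`.
  refine ⟨fun p => (4 ^ p + 1) * p + 1, fun p => by positivity, ?_⟩
  intro p n hp _ Ω _ μ _ E _ X f W V hX hind _ _ hW hd hvar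
  refine ciSup_le fun t => (hd.abs_cdf_sub_le hX hind hW hp hvar t).trans ?_
  have h1 : √((4 ^ p + 1) * p * DeJong.maxInfluence μ p V)
      ≤ √((4 ^ p + 1) * p + 1) * DeJong.rho μ p V := by
    rw [Real.sqrt_mul (by positivity)]
    exact mul_le_mul_of_nonneg_right (Real.sqrt_le_sqrt (by linarith)) (Real.sqrt_nonneg _)
  have h2 : 0 ≤ DeJong.rho μ p V := Real.sqrt_nonneg _
  have h3 := mul_nonneg (Real.sqrt_nonneg (((4 : ℝ) ^ p + 1) * p + 1)) h2
  have h4 := Real.sqrt_nonneg |(∫ ω, W ω ^ 4 ∂μ) - 3|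
  linarith
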